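/- Let $\mathcal S_0$ be the space of real symmetric traceless $3\times3$ matrices with $|Q|^2=\operatorname{tr}(Q^2)$, and let $\Omega=\{x\in\mathbb R^3:|x|>1\}$. For $Q\in\mathcal S_0$ put $$f(Q)=-\tfrac12|Q|^2-\operatorname{tr}(Q^3)+\tfrac34|Q|^4+\tfrac29,\qquad g(Q)=\sqrt{\tfrac23}-\frac{Q_{33}}{|Q|}$$ (with $g(0)=\sqrt{2/3}$), and let $Q_\infty=\mathbf e_3\otimes\mathbf e_3-\tfrac13I$ and $Q_b(x)=\frac{x}{|x|}\otimes\frac{x}{|x|}-\tfrac13 I$. For $\xi,\eta>0$ let $$E_{\xi,\eta}(Q)=\int_\Omega\Big[\tfrac12|\nabla Q|^2+\tfrac1{\xi^2}f(Q)+\tfrac1{\eta^2}g(Q)\Big]dx,\qquad \mathcal H=\{Q\in Q_\infty+H^1(\Omega;\mathcal S_0):\ Q=Q_b\text{ on }\partial\Omega\},$$ the boundary condition being understood in the sense of traces. For $\lambda\in(0,\infty)$ and $Q_0\in\mathcal S_0$ let $$D_\lambda(Q_0)=\inf\Big\{\int_1^\infty\Big[\tfrac12\Big|\frac{dQ}{dr}\Big|^2+\lambda^2f(Q)+g(Q)\Big]dr:\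 Q\in Q_\infty+H^1((1,\infty);\mathcal S_0),\ Q(1)=Q_0\Big\}.$$ **Proposition.** Let $\lambda\in(0,\infty)$. Then $\int_{\mathbb S^2}D_\lambda(Q_b(\omega))\,d\mathcal H^2(\omega)<\infty$, and there is a function $\sigma(h,\varepsilon)\ge0$ of $h,\varepsilon>0$, depending only on $\lambda$, such that $\lim_{\varepsilon\to0}\sigma(h,\varepsilon)$ exists for every $h>0$ and $$\lim_{h\to0}\Big(\lim_{\varepsilon\to0}\sigma(h,\varepsilon)\Big)=0,$$ with the following property. Let $\eta:(0,\infty)\to(0,\infty)$ be any function with $\eta(\xi)/\xi\to\lambda$ as $\xi\to0^+$. Then for all $h,\varepsilon>0$ there are maps $Q_\xi^{h,\varepsilon}\in\mathcal H$, $\xi>0$, each axially symmetric about $\mathbf e_3$ (that is, $Q(Rx)=R\,Q(x)\,R^{T}$ for $x\in\Omega$ and every rotation $R$ about $\mathbf e_3$), such that $$\limsup_{\xi\to0^+}\ \eta(\xi)\,E_{\xi,\eta(\xi)}\big(Q_\xi^{h,\varepsilon}\big)\ \le\ \int_{\mathbb S^2}D_\lambda(Q_b(\omega))\,d\mathcal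 H^2(\omega)+\sigma(h,\varepsilon).$$ -/

import Mathlib

open MeasureTheory Filter Topology Set
open scoped ENNReal ContDiff

noncomputable section

namespace Colloid

/-- Three-dimensional Euclidean space. -/
abbrev E3 : Type := EuclideanSpace ℝ (Fin 3)

/-- Real `3 × 3` matrices. -/
abbrev Mat3 : Type := Matrix (Fin 3) (Fin 3) ℝ

/-- `𝒮₀`: the symmetric matrices with zero trace. -/
def S0 : Set Mat3 := {A | A.IsSymm ∧ A.trace = 0}

/-- The squared Frobenius norm `|A|²`. -/
def normSq (A : Mat3) : ℝ := ∑ i, ∑ j, A i j ^ 2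

/-- The nematic potential `f(Q) = -|Q|²/2 - tr(Q³) + 3|Q|⁴/4 + 2/9`. The additive constant is the one
for which the minimum of `f` over `𝒮₀` is `0`; it is attained exactly at `n ⊗ n - I/3`, `|n| = 1`. -/
def f (Q : Mat3) : ℝ :=
  -(1 / 2) * normSq Q - (Q ^ 3).trace + 3 / 4 * normSq Q ^ 2 + 2 / 9

/-- The symmetry-breaking potential `g(Q) = √(2/3) - Q₃₃ / |Q|`; it is nonnegative on `𝒮₀`.
(At `Q = 0`, where the formula has no meaning, the value is `√(2/3)`.) -/
def g (Q : Mat3) : ℝ := √(2 / 3) - Q 2 2 / √(normSq Q)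

/-- `n ⊗ n - I/3`. -/
def uniaxial (n : E3) : Mat3 := Matrix.vecMulVec n.ofLp n.ofLp - (1 / 3 : ℝ) • (1 : Mat3)

/-- `Q∞ = e₃ ⊗ e₃ - I/3`. -/
def Qinf : Mat3 := uniaxial (EuclideanSpace.single 2 1)

/-- `Q_b(x) = e_r ⊗ e_r - I/3` with `e_r = x / |x|`. -/
def Qb (x : E3) : Mat3 := uniaxial (‖x‖⁻¹ • x)

/-! ### The one-dimensional problem -/

/-- `Q` is locally absolutely continuous on `[1, ∞)`, with (weak) derivative `P`. -/
def HasWeakDeriv (Q P : ℝ → Mat3) : Prop :=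
  ∀ i j, ∀ r, 1 ≤ r → IntervalIntegrable (fun s => P s i j) volume 1 r ∧
    Q r i j = Q 1 i j + ∫ s in (1 : ℝ)..r, P s i j

/-- The space `Q∞ + H¹((1, ∞); 𝒮₀)`; its elements are identified with their continuous
representatives on `[1, ∞)`. -/
def H1Path : Set (ℝ → Mat3) :=
  {Q | (∀ r, 1 ≤ r → Q r ∈ S0) ∧
    (∀ i j, MemLp (fun r => Q r i j - Qinf i j) 2 (volume.restrict (Ioi 1))) ∧
    ∃ P, HasWeakDeriv Q P ∧ ∀ i j, MemLp (fun r => P r i j) 2 (volume.restrict (Ioi 1))}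

/-- `F_l(Q) = ∫_1^∞ (|dQ/dr|²/2 + l² f(Q) + g(Q)) dr`. The weak derivative is unique up to null sets,
so the infimum only serves to name it. -/
def F (l : ℝ) (Q : ℝ → Mat3) : ℝ≥0∞ :=
  ⨅ (P : ℝ → Mat3) (_ : HasWeakDeriv Q P),
    ∫⁻ r in Ioi (1 : ℝ), ENNReal.ofReal (1 / 2 * normSq (P r) + l ^ 2 * f (Q r) + g (Q r))

/-- `D_l(Q₀)`: the least value of `F_l` among the `Q` in `Q∞ + H¹((1, ∞); 𝒮₀)` with `Q(1) = Q₀`. -/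
def D (l : ℝ) (Q₀ : Mat3) : ℝ≥0∞ :=
  ⨅ (Q : ℝ → Mat3) (_ : Q ∈ H1Path) (_ : Q 1 = Q₀), F l Q

/-! ### The three-dimensional problem -/

/-- The exterior `Ω` of the closed unit ball. -/
def Ω : Set E3 := {x | 1 < ‖x‖}

/-- `G k` is the weak partial derivative `∂ₖQ` in `Ω`, for each `k` (componentwise, against test
functions in `C_c^∞(Ω)`). -/
def HasWeakGradient (Q : E3 → Mat3) (G : Fin 3 → E3 → Mat3) : Prop :=
  ∀ i j, LocallyIntegrableOn (fun x => Q x i j) Ω volume ∧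
    ∀ k, LocallyIntegrableOn (fun x => G k x i j) Ω volume ∧
      ∀ φ : E3 → ℝ, ContDiff ℝ ∞ φ → HasCompactSupport φ → tsupport φ ⊆ Ω →
        ∫ x in Ω, Q x i j * fderiv ℝ φ x (EuclideanSpace.single k 1) =
          -∫ x in Ω, G k x i j * φ x

/-- The affine space `Q∞ + H¹(Ω; 𝒮₀)`. -/
def H1Ω : Set (E3 → Mat3) :=
  {Q | (∀ x ∈ Ω, Q x ∈ S0) ∧
    (∀ i j, MemLp (fun x => Q x i j - Qinf i j) 2 (volume.restrict Ω)) ∧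
    ∃ G, HasWeakGradient Q G ∧ ∀ k i j, MemLp (fun x => G k x i j) 2 (volume.restrict Ω)}

/-- `Q = Q_b` on `∂Ω` in the sense of traces: the mean square deviation of `Q` from `Q_b` (which does
not depend on the radius) over the shell `1 < |x| < 1 + δ` tends to `0` with `δ`. For `Q` in
`Q∞ + H¹(Ω)` the functions `Q(r·)` converge in `L²(𝕊²)` to the trace of `Q` as `r → 1⁺`, so this says
that the trace is `Q_b`; for `Q` continuous up to `∂Ω` it says that `Q = Q_b` on `∂Ω`. -/
def HasTraceQb (Q : E3 → Mat3) : Prop :=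
  Tendsto (fun δ : ℝ => ENNReal.ofReal δ⁻¹ *
      ∫⁻ x in {x : E3 | 1 < ‖x‖ ∧ ‖x‖ < 1 + δ}, ENNReal.ofReal (normSq (Q x - Qb x)))
    (𝓝[>] 0) (𝓝 0)

/-- The space `ℋ` of admissible maps: `Q ∈ Q∞ + H¹(Ω; 𝒮₀)` with `Q = Q_b` on `∂Ω`. -/
def admissible : Set (E3 → Mat3) := {Q | Q ∈ H1Ω ∧ HasTraceQb Q}

/-- The energy `∫_Ω (|∇Q|²/2 + f(Q)/ξ² + g(Q)/η²)`. The weak gradient is unique up to null sets, so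
the infimum only serves to name it. -/
def energy (ξ η : ℝ) (Q : E3 → Mat3) : ℝ≥0∞ :=
  ⨅ (G : Fin 3 → E3 → Mat3) (_ : HasWeakGradient Q G),
    ∫⁻ x in Ω, ENNReal.ofReal
      (1 / 2 * (∑ k, normSq (G k x)) + 1 / ξ ^ 2 * f (Q x) + 1 / η ^ 2 * g (Q x))

/-- The rotation of angle `φ` about the axis `e₃`. -/
def rot (φ : ℝ) : Mat3 := !![Real.cos φ, -Real.sin φ, 0; Real.sin φ, Real.cos φ, 0; 0, 0, 1]

/-- Axial symmetry about `e₃`: `Q(Rx) = R Q(x) Rᵀ` for all rotations `R` about `e₃`. -/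
def Axisymmetric (Q : E3 → Mat3) : Prop :=
  ∀ φ : ℝ, ∀ x ∈ Ω, Q (WithLp.toLp 2 (Matrix.mulVec (rot φ) x.ofLp)) = rot φ * Q x * (rot φ).transpose

/-- `∫_{𝕊²} D_l(Q_b(n)) dℋ²(n)`; `volume.toSphere` is the surface measure, of total mass `4π`. -/
def limitEnergy (l : ℝ) : ℝ≥0∞ :=
  ∫⁻ n : Metric.sphere (0 : E3) 1, D l (Qb (n : E3)) ∂(volume : Measure E3).toSphere

end Colloid

end

noncomputable section

namespace Colloid

/-! ### The potentials -/

/-! The recovery maps are boundary layers `Q∞ + B(n, s)` with `n = x/|x|` and `s = (|x| - 1)/η`,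
where `B` does not depend on `ξ` and vanishes for `s ≥ S`. Writing `r = 1 + ηs`, the quantity `η E`
becomes an integral over directions of integrals along rays. Along each ray there appears the
one-dimensional density with Jacobian `(1 + ηs)²`, plus errors: the tangential derivatives of `B`
carry a factor of order `η`, and replacing `(η/ξ)²` by `λ²` in front of `f` costs a multiple of
`|(η/ξ)² - λ²|`. Both vanish in the limit (`IsLayer.energy_density_le`, `IsLayer.exists_energy_le`),
so the limsup is at most the integral over the sphere of the one-dimensional energies of `B(n, ·)`
(`IsLayer.limsup_energy_le`). It remains to find, for each `h > 0`, one axially symmetric `B` with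
the right boundary values whose integrated energy is at most `∫ D + h` (`exists_layer`); then `σ(h,
ε) = h` serves.

Near-optimal profiles cannot be chosen independently for each `n`, since `B` must be smooth in `n`
and equivariant. The sphere is therefore cut into `N` latitude bands. In each band a direction `w`
is chosen whose `D` nearly attains the infimum over the band, together with a profile from `Q_b(w)`
that reaches `Q∞` in finite time and nearly realizes `D` (`exists_profile_cost_le`). Rotations about
`e₃` preserve `f`, `g` and `Q∞`, so the profile can be turned to every meridian at no cost. The
turned boundary value differs from `Q_b(n)` only through the difference of latitudes, and an affine
path of short duration `τ` corrects it at a cost of order `1/(Nτ) + τ` (`layerCost_le_of_band`).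
Neither continuity nor measurability of `D` is needed.

The bands are joined by cutoffs in the latitude. The field is `a(s)(Q_b - Q∞)`, with `a` decreasing
from 1 to 0, plus the cutoffs times loops that start and end at 0; hence the boundary condition
holds whatever the cutoffs are. Where the cutoffs vary, and near the poles, where turning to a
meridian is singular, the energy has a bound that does not depend on the cutoffs
(`exists_layerCost_le`). Those regions can be made arbitrarily small, because circles of latitude
are null (`exists_badSet_le`).

Finiteness of `∫ D` follows from a uniform bound given by straight segments to `Q∞`
(`exists_D_uniaxial_le`). Since profiles are only absolutely continuous, the gradient of the maps
rests on a radial integration by parts (`integral_radial_mul_fderiv`). -/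

lemma normSq_nonneg (A : Mat3) : 0 ≤ normSq A := by
  unfold normSq; positivity

lemma normSq_eq_trace (A : Mat3) : normSq A = (A * A.transpose).trace := by
  simp [normSq, Matrix.trace, Matrix.mul_apply, pow_two]

lemma sq_entry_le_normSq (A : Mat3) (i j : Fin 3) : A i j ^ 2 ≤ normSq A := by
  unfold normSq
  refine le_trans ?_ (Finset.single_le_sum (f := fun i => ∑ j, A i j ^ 2)
    (fun i _ => by positivity) (Finset.mem_univ i))
  exact Finset.single_le_sum (f := fun j => A i j ^ 2) (fun j _ => by positivity)
    (Finset.mem_univ j)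

lemma normSq_le_of_entry {A : Mat3} {M : ℝ} (h : ∀ i j, |A i j| ≤ M) : normSq A ≤ 9 * M ^ 2 := by
  have h2 : ∀ i j, A i j ^ 2 ≤ M ^ 2 := fun i j => sq_le_sq' (abs_le.1 (h i j)).1 (abs_le.1 (h i j)).2
  calc normSq A ≤ ∑ _i : Fin 3, ∑ _j : Fin 3, M ^ 2 :=
        Finset.sum_le_sum fun i _ => Finset.sum_le_sum fun j _ => h2 i j
    _ = 9 * M ^ 2 := by simp; ring

@[simp] lemma normSq_zero : normSq 0 = 0 := by simp [normSq]

lemma normSq_smul (c : ℝ) (A : Mat3) : normSq (c • A) = c ^ 2 * normSq A := by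
  simp [normSq, mul_pow, Finset.mul_sum]

/-- Young's inequality with a free weight. With `t = η` it separates the radial from the tangential
part of a gradient while keeping the leading constant `1 + η` on the radial part. -/
lemma normSq_add_le {t : ℝ} (ht : 0 < t) (A B : Mat3) :
    normSq (A + B) ≤ (1 + t) * normSq A + (1 + 1 / t) * normSq B := by
  unfold normSq
  simp only [Finset.mul_sum, ← Finset.sum_add_distrib]
  refine Finset.sum_le_sum fun i _ => Finset.sum_le_sum fun j _ => ?_
  have h : 0 ≤ t⁻¹ * (t * A i j - B i j) ^ 2 := by positivity
  have h2 : t⁻¹ * (t * A i j - B i j) ^ 2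
      = (1 + t) * A i j ^ 2 + (1 + 1 / t) * B i j ^ 2 - (A i j + B i j) ^ 2 := by
    field_simp; ring
  rw [Matrix.add_apply]; linarith

lemma normSq_sum_le {ι : Type*} (s : Finset ι) (c : ι → ℝ) (A : ι → Mat3) {K : ℝ}
    (hA : ∀ m ∈ s, ∀ i j, |A m i j| ≤ K) :
    normSq (∑ m ∈ s, c m • A m) ≤ 9 * K ^ 2 * s.card * ∑ m ∈ s, c m ^ 2 := by
  have key : ∀ i j, (∑ m ∈ s, c m • A m) i j ^ 2 ≤ K ^ 2 * s.card * ∑ m ∈ s, c m ^ 2 := by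
    intro i j
    rw [Matrix.sum_apply]
    refine (sq_sum_le_card_mul_sum_sq).trans ?_
    rw [mul_comm (K ^ 2), mul_assoc, Finset.mul_sum _ _ (K ^ 2)]
    refine mul_le_mul_of_nonneg_left ?_ (Nat.cast_nonneg _)
    refine Finset.sum_le_sum fun m hm => ?_
    rw [Matrix.smul_apply, smul_eq_mul, mul_pow, mul_comm]
    exact mul_le_mul_of_nonneg_right
      (sq_le_sq' (abs_le.1 (hA m hm i j)).1 (abs_le.1 (hA m hm i j)).2) (by positivity)
  calc normSq (∑ m ∈ s, c m • A m)
      ≤ ∑ _i : Fin 3, ∑ _j : Fin 3, K ^ 2 * s.card * ∑ m ∈ s, c m ^ 2 :=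
        Finset.sum_le_sum fun i _ => Finset.sum_le_sum fun j _ => key i j
    _ = _ := by simp; ring

lemma Qinf_apply (i j : Fin 3) :
    Qinf i j = (if i = 2 then if j = 2 then (1 : ℝ) else 0 else 0) - if i = j then 1 / 3 else 0 := by
  fin_cases i <;> fin_cases j <;> simp [Qinf, uniaxial, Matrix.vecMulVec_apply]

lemma normSq_Qinf : normSq Qinf = 2 / 3 := by
  simp [normSq, Qinf_apply, Fin.sum_univ_three]; norm_num

lemma f_Qinf : f Qinf = 0 := by
  have h : (Qinf ^ 3).trace = 2 / 9 := by
    simp [pow_succ, Matrix.trace, Matrix.mul_apply, Qinf_apply, Fin.sum_univ_three]; norm_num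
  rw [f, normSq_Qinf, h]; norm_num

lemma g_Qinf : g Qinf = 0 := by
  have h : Qinf 2 2 = 2 / 3 := by simp [Qinf_apply]; norm_num
  rw [g, normSq_Qinf, h, sub_eq_zero, eq_comm, Real.div_sqrt]

/-- `g` is discontinuous at `0`, but boundedness and measurability are all that the energy estimates
require of it; the bound includes the value at `0`, where division by zero gives `√(2/3)`. -/
lemma abs_g_le (Q : Mat3) : |g Q| ≤ 2 := by
  have h1 : √(2 / 3 : ℝ) ≤ 1 := by rw [Real.sqrt_le_one]; norm_num
  have h2 : |Q 2 2 / √(normSq Q)| ≤ 1 := by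
    rw [abs_div, abs_of_nonneg (Real.sqrt_nonneg _)]
    exact div_le_one_of_le₀ (Real.abs_le_sqrt (sq_entry_le_normSq Q 2 2)) (Real.sqrt_nonneg _)
  have h3 := Real.sqrt_nonneg (2 / 3)
  rw [abs_le] at *
  unfold g
  constructor <;> linarith [h2.1, h2.2]

lemma continuous_normSq : Continuous normSq := by
  unfold normSq
  exact continuous_finsetSum _ fun i _ => continuous_finsetSum _ fun j _ =>
    (continuous_id.matrix_elem i j).pow 2

lemma continuous_f : Continuous f := by
  unfold f
  have := continuous_normSq
  have h : Continuous fun Q : Mat3 => (Q ^ 3).trace := (continuous_id.pow 3).matrix_trace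
  fun_prop

lemma exists_abs_f_le (M : ℝ) : ∃ C, 0 ≤ C ∧ ∀ Q : Mat3, (∀ i j, |Q i j| ≤ M) → |f Q| ≤ C := by
  have hK : IsCompact (Set.pi univ fun _ : Fin 3 => Set.pi univ fun _ : Fin 3 => Icc (-M) M) :=
    isCompact_univ_pi fun _ => isCompact_univ_pi fun _ => isCompact_Icc
  obtain ⟨C, hC⟩ := hK.exists_bound_of_continuousOn (f := f) continuous_f.continuousOn
  refine ⟨max C 0, le_max_right _ _, fun Q hQ => (hC Q ?_).trans (le_max_left _ _)⟩
  exact fun i _ j _ => abs_le.1 (hQ i j)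

lemma measurable_normSq {α : Type*} [MeasurableSpace α] {Q : α → Mat3}
    (hQ : ∀ i j, Measurable fun x => Q x i j) : Measurable fun x => normSq (Q x) := by
  unfold normSq; fun_prop

lemma measurable_f {α : Type*} [MeasurableSpace α] {Q : α → Mat3}
    (hQ : ∀ i j, Measurable fun x => Q x i j) : Measurable fun x => f (Q x) := by
  have h1 := measurable_normSq hQ
  have h2 : Measurable fun x => (Q x ^ 3).trace := by
    simp only [pow_succ, pow_zero, one_mul, Matrix.trace, Matrix.diag, Matrix.mul_apply]
    fun_prop
  unfold f
  fun_prop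

lemma measurable_g {α : Type*} [MeasurableSpace α] {Q : α → Mat3}
    (hQ : ∀ i j, Measurable fun x => Q x i j) : Measurable fun x => g (Q x) := by
  have h1 := measurable_normSq hQ
  unfold g
  fun_prop

/-! ### Rotations about the axis -/

/-- The matrix of a rotation about `e₃`, if `c ^ 2 + s ^ 2 = 1`. -/
def rotM (c s : ℝ) : Mat3 := !![c, -s, 0; s, c, 0; 0, 0, 1]

lemma rotM_transpose_mul {c s : ℝ} (h : c ^ 2 + s ^ 2 = 1) :
    (rotM c s).transpose * rotM c s = 1 := by
  ext i j
  fin_cases i <;> fin_cases j <;> simp [rotM, Matrix.mul_apply, Fin.sum_univ_three] <;> linarith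

lemma rotM_mul_transpose {c s : ℝ} (h : c ^ 2 + s ^ 2 = 1) :
    rotM c s * (rotM c s).transpose = 1 :=
  mul_eq_one_comm.1 (rotM_transpose_mul h)

lemma rotM_mul_rotM (c s c' s' : ℝ) :
    rotM c s * rotM c' s' = rotM (c * c' - s * s') (s * c' + c * s') := by
  ext i j
  fin_cases i <;> fin_cases j <;> simp [rotM, Matrix.mul_apply, Fin.sum_univ_three] <;> ring

lemma trace_conj {B : Mat3} (h : B.transpose * B = 1) (A : Mat3) :
    (B * A * B.transpose).trace = A.trace := by
  rw [Matrix.trace_mul_comm, ← mul_assoc, h, one_mul]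

lemma normSq_conj {B : Mat3} (h : B.transpose * B = 1) (A : Mat3) :
    normSq (B * A * B.transpose) = normSq A := by
  rw [normSq_eq_trace, normSq_eq_trace, ← trace_conj h (A * A.transpose)]
  simp only [Matrix.transpose_mul, Matrix.transpose_transpose, mul_assoc]
  rw [← mul_assoc B.transpose B, h, one_mul]

lemma conj_pow_three {B : Mat3} (h : B.transpose * B = 1) (A : Mat3) :
    (B * A * B.transpose) ^ 3 = B * A ^ 3 * B.transpose := by
  have : ∀ X Y : Mat3, B * X * B.transpose * (B * Y * B.transpose) = B * (X * Y) * B.transpose := by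
    intro X Y
    calc B * X * B.transpose * (B * Y * B.transpose)
        = B * X * (B.transpose * B) * Y * B.transpose := by simp only [mul_assoc]
      _ = _ := by rw [h]; simp only [mul_assoc, mul_one]
  rw [pow_succ, pow_two, this, this, pow_succ, pow_two]

/-- `f` depends only on `|Q|` and `tr Q³`, so every orthogonal conjugation preserves it; `g` also
sees `Q₃₃`, so for it only rotations about `e₃` are admitted. -/
lemma f_conj {B : Mat3} (h : B.transpose * B = 1) (A : Mat3) :
    f (B * A * B.transpose) = f A := by
  simp only [f, normSq_conj h, conj_pow_three h, trace_conj h]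

lemma rotM_conj_two_two (c s : ℝ) (A : Mat3) :
    (rotM c s * A * (rotM c s).transpose) 2 2 = A 2 2 := by
  simp [rotM, Matrix.mul_apply, Fin.sum_univ_three, Matrix.vecMul, dotProduct]

lemma g_conj {c s : ℝ} (h : c ^ 2 + s ^ 2 = 1) (A : Mat3) :
    g (rotM c s * A * (rotM c s).transpose) = g A := by
  simp only [g, normSq_conj (rotM_transpose_mul h), rotM_conj_two_two]

lemma isSymm_conj (B : Mat3) {A : Mat3} (hA : A.IsSymm) : (B * A * B.transpose).IsSymm := by
  simp only [Matrix.IsSymm, Matrix.transpose_mul, Matrix.transpose_transpose, mul_assoc]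
  rw [hA.eq]

/-! ### Uniaxial tensors and the space `𝒮₀` -/

lemma uniaxial_apply (n : E3) (i j : Fin 3) :
    uniaxial n i j = n i * n j - if i = j then 1 / 3 else 0 := by
  by_cases h : i = j <;> simp [uniaxial, Matrix.vecMulVec_apply, h]

lemma uniaxial_conj {B : Mat3} (h : B * B.transpose = 1) (n : E3) :
    uniaxial (WithLp.toLp 2 (B.mulVec n.ofLp)) = B * uniaxial n * B.transpose := by
  simp only [uniaxial, Matrix.mul_sub, Matrix.sub_mul, Matrix.mul_smul, Matrix.smul_mul, mul_one, h]
  congr 1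
  rw [Matrix.mul_vecMulVec, Matrix.vecMulVec_mul, Matrix.vecMul_transpose]

lemma norm_sq_eq (x : E3) : ‖x‖ ^ 2 = x 0 ^ 2 + x 1 ^ 2 + x 2 ^ 2 := by
  simp [EuclideanSpace.norm_sq_eq, Fin.sum_univ_three]

lemma uniaxial_mem_S0 {n : E3} (h : ‖n‖ = 1) : uniaxial n ∈ S0 := by
  have h2 := norm_sq_eq n
  rw [h] at h2
  constructor
  · ext i j
    simp only [Matrix.transpose_apply, uniaxial_apply, mul_comm, eq_comm]
  · simp only [Matrix.trace, Fin.sum_univ_three, Matrix.diag, uniaxial_apply, if_true]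
    linarith

lemma Qinf_mem_S0 : Qinf ∈ S0 := uniaxial_mem_S0 (by simp)

lemma S0_add {A B : Mat3} (hA : A ∈ S0) (hB : B ∈ S0) : A + B ∈ S0 :=
  ⟨hA.1.add hB.1, by rw [Matrix.trace_add, hA.2, hB.2, add_zero]⟩

lemma S0_smul (c : ℝ) {A : Mat3} (hA : A ∈ S0) : c • A ∈ S0 :=
  ⟨hA.1.smul c, by rw [Matrix.trace_smul, hA.2, smul_zero]⟩

lemma S0_sub {A B : Mat3} (hA : A ∈ S0) (hB : B ∈ S0) : A - B ∈ S0 :=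
  ⟨hA.1.sub hB.1, by rw [Matrix.trace_sub, hA.2, hB.2, sub_zero]⟩

lemma S0_zero : (0 : Mat3) ∈ S0 := ⟨Matrix.isSymm_zero, by simp⟩

lemma S0_sum {ι : Type*} (s : Finset ι) {A : ι → Mat3} (h : ∀ m ∈ s, A m ∈ S0) :
    ∑ m ∈ s, A m ∈ S0 := by
  classical
  induction s using Finset.induction_on with
  | empty => simpa using S0_zero
  | insert a s ha ih =>
    rw [Finset.sum_insert ha]
    exact S0_add (h a (by simp)) (ih fun m hm => h m (by simp [hm]))

lemma abs_entry_le_norm (x : E3) (i : Fin 3) : |x i| ≤ ‖x‖ := by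
  simpa using PiLp.norm_apply_le x i

lemma abs_uniaxial_le {n : E3} (h : ‖n‖ = 1) (i j : Fin 3) : |uniaxial n i j| ≤ 2 := by
  have h1 := abs_entry_le_norm n i
  have h2 := abs_entry_le_norm n j
  rw [h] at h1 h2
  have h3 : |n i * n j| ≤ 1 := by
    rw [abs_mul]; exact mul_le_one₀ h1 (abs_nonneg _) h2
  rw [uniaxial_apply]
  refine (abs_sub _ _).trans ?_
  have : |(if i = j then (1 / 3 : ℝ) else 0)| ≤ 1 := by split_ifs <;> norm_num [abs_le]
  linarith

/-- From `m ⊗ m - n ⊗ n = m ⊗ (m - n) + (m - n) ⊗ n`. -/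
lemma normSq_uniaxial_sub_le {m n : E3} (hm : ‖m‖ = 1) (hn : ‖n‖ = 1) :
    normSq (uniaxial m - uniaxial n) ≤ 36 * ‖m - n‖ ^ 2 := by
  have key : ∀ i j, |(uniaxial m - uniaxial n) i j| ≤ 2 * ‖m - n‖ := by
    intro i j
    rw [Matrix.sub_apply, uniaxial_apply, uniaxial_apply]
    have e : m i * m j - (if i = j then (1 / 3 : ℝ) else 0) - (n i * n j - if i = j then 1 / 3 else 0)
        = m i * (m - n) j + (m - n) i * n j := by simp; ring
    rw [e]
    refine (abs_add_le _ _).trans ?_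
    rw [abs_mul, abs_mul]
    have h1 := abs_entry_le_norm m i
    have h2 := abs_entry_le_norm n j
    have h3 := abs_entry_le_norm (m - n) i
    have h4 := abs_entry_le_norm (m - n) j
    rw [hm] at h1; rw [hn] at h2
    nlinarith [abs_nonneg (m i), abs_nonneg (n j), abs_nonneg ((m - n) i), abs_nonneg ((m - n) j)]
  refine (normSq_le_of_entry key).trans (le_of_eq (by ring))

/-! ### One-dimensional profiles -/

/-- `β` is absolutely continuous with square integrable derivative `p`, constant on `(-∞, 0]`, and
vanishes near `+∞`. -/
structure IsProfile (β p : ℝ → ℝ) : Prop where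
  meas : Measurable p
  memLp : MemLp p 2 volume
  neg : ∀ s, s ≤ 0 → p s = 0
  prim : ∀ s, β s = β 0 + ∫ t in (0 : ℝ)..s, p t
  tail : ∃ S, 0 < S ∧ ∀ s, S ≤ s → β s = 0 ∧ p s = 0

/-- `β` is absolutely continuous on `(-∞, T]` with square integrable derivative `p`, and constant on
`(-∞, 0]`. -/
structure IsPiece (T : ℝ) (β p : ℝ → ℝ) : Prop where
  meas : Measurable p
  memLp : MemLp p 2 (volume.restrict (Iic T))
  neg : ∀ s, s ≤ 0 → p s = 0
  prim : ∀ s, s ≤ T → β s = β 0 + ∫ t in (0 : ℝ)..s, p t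

namespace IsProfile

variable {β p : ℝ → ℝ}

/-- The derivative is supported in `(0, S]`, and on a bounded interval `L²` is contained in `L¹`. -/
lemma integrable (h : IsProfile β p) : Integrable p := by
  obtain ⟨S, -, hS2⟩ := h.tail
  have h1 : IntegrableOn p (Ioc 0 S) := by
    have := (h.memLp.restrict (Ioc 0 S)).mono_exponent (p := 1) (by norm_num)
    exact memLp_one_iff_integrable.1 this
  refine (integrableOn_iff_integrable_of_support_subset fun s hs => ?_).1 h1
  have hs' : p s ≠ 0 := hs
  by_contra hc
  rw [mem_Ioc, not_and_or, not_lt, not_le] at hc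
  rcases hc with hc | hc
  · exact hs' (h.neg s hc)
  · exact hs' (hS2 s hc.le).2

lemma continuous (h : IsProfile β p) : Continuous β := by
  have h2 : β = fun s => β 0 + ∫ t in (0 : ℝ)..s, p t := funext h.prim
  rw [h2]
  exact continuous_const.add (intervalIntegral.continuous_primitive
    (fun a b => h.integrable.intervalIntegrable) 0)

lemma bounded (h : IsProfile β p) : ∃ M, ∀ s, |β s| ≤ M := by
  refine ⟨|β 0| + ∫ t, |p t|, fun s => ?_⟩
  rw [h.prim s]
  refine (abs_add_le _ _).trans (add_le_add le_rfl ?_)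
  refine (intervalIntegral.norm_integral_le_integral_norm_uIoc (f := p)).trans ?_
  exact setIntegral_le_integral h.integrable.abs (Eventually.of_forall fun _ => abs_nonneg _)

end IsProfile

lemma isProfile_zero : IsProfile (fun _ => 0) (fun _ => 0) :=
  ⟨measurable_const, MemLp.zero, fun _ _ => rfl, fun _ => by simp, 1, one_pos, fun _ _ => ⟨rfl, rfl⟩⟩

/-! ### Concatenation and affine pieces -/

/-- Concatenation at time `T`. -/
def catFn {α : Type*} (T : ℝ) (u v : ℝ → α) (s : ℝ) : α := if s ≤ T then u s else v (s - T)

lemma catFn_comp {α γ : Type*} (φ : α → γ) (T : ℝ) (u v : ℝ → α) (s : ℝ) :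
    φ (catFn T u v s) = catFn T (fun s => φ (u s)) (fun s => φ (v s)) s := by
  unfold catFn; split_ifs <;> rfl

lemma lintegral_catFn {T : ℝ} (hT : 0 ≤ T) (U V : ℝ → ℝ≥0∞) :
    ∫⁻ s in Ioi 0, catFn T U V s = (∫⁻ s in Ioc 0 T, U s) + ∫⁻ s in Ioi 0, V s := by
  have hU : ∫⁻ s in Ioi 0, catFn T U V s =
      (∫⁻ s in Ioc 0 T, catFn T U V s) + ∫⁻ s in Ioi T, catFn T U V s := by
    rw [← lintegral_union measurableSet_Ioi (disjoint_left.2 fun x hx hx2 => not_lt.2 hx.2 hx2),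
      Ioc_union_Ioi_eq_Ioi hT]
  rw [hU]
  congr 1
  · exact setLIntegral_congr_fun measurableSet_Ioc fun s hs => by simp [catFn, hs.2]
  · have e : Ioi T = (fun s => s - T) ⁻¹' Ioi 0 := by ext s; simp
    rw [← (measurePreserving_sub_right volume T).setLIntegral_comp_preimage_emb
      (MeasurableEquiv.subRight T).measurableEmbedding V (Ioi 0), ← e]
    exact setLIntegral_congr_fun measurableSet_Ioi fun s hs => by
      simp [catFn, not_le.2 (mem_Ioi.1 hs)]

/-- Matching values at `T` make the concatenation absolutely continuous: the integral of the glued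
derivative splits at `T`, and the second part is shifted back to start at `0`. -/
lemma IsPiece.cat {T : ℝ} (hT : 0 < T) {β₁ p₁ β₂ p₂ : ℝ → ℝ} (h₁ : IsPiece T β₁ p₁)
    (h₂ : IsProfile β₂ p₂) (h : β₁ T = β₂ 0) :
    IsProfile (catFn T β₁ β₂) (catFn T p₁ p₂) where
  meas := Measurable.ite measurableSet_Iic h₁.meas (h₂.meas.comp (measurable_id.sub_const T))
  memLp := by
    classical
    have h3 : MemLp (fun s => p₂ (s - T)) 2 volume :=
      h₂.memLp.comp_measurePreserving (measurePreserving_sub_right volume T)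
    have := MemLp.piecewise (s := Iic T) measurableSet_Iic h₁.memLp (h3.restrict (Iic T)ᶜ)
    exact this
  neg s hs := by simp [catFn, hs.trans hT.le, h₁.neg s hs]
  prim s := by
    have hA : ∀ s, s ≤ T → ∫ t in (0 : ℝ)..s, catFn T p₁ p₂ t = ∫ t in (0 : ℝ)..s, p₁ t := by
      intro s hs
      refine intervalIntegral.integral_congr fun t ht => ?_
      have : t ≤ T := (mem_uIcc.1 ht).elim (fun h => h.2.trans hs) (fun h => h.2.trans hT.le)
      simp [catFn, this]
    have h0 : catFn T β₁ β₂ 0 = β₁ 0 := by simp [catFn, hT.le]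
    by_cases hs : s ≤ T
    · rw [hA s hs, h0, ← h₁.prim s hs]; simp [catFn, hs]
    · push Not at hs
      have hi2 : IntervalIntegrable (catFn T p₁ p₂) volume T s := by
        refine IntervalIntegrable.congr (f := fun t => p₂ (t - T)) (fun t ht => ?_)
          (h₂.integrable.comp_sub_right T).intervalIntegrable
        rw [uIoc_of_le hs.le] at ht
        simp [catFn, ht.1]
      have hi1 : IntervalIntegrable (catFn T p₁ p₂) volume 0 T := by
        refine IntervalIntegrable.congr (f := p₁) (fun t ht => ?_) ?_
        · rw [uIoc_of_le hT.le] at ht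
          simp [catFn, ht.2]
        · rw [intervalIntegrable_iff_integrableOn_Ioc_of_le hT.le]
          have h4 := (h₁.memLp.mono_measure (Measure.restrict_mono (Ioc_subset_Iic_self (a := 0))
            le_rfl)).mono_exponent (p := 1) (by norm_num)
          exact memLp_one_iff_integrable.1 h4
      have hB : ∫ t in T..s, catFn T p₁ p₂ t = ∫ t in T..s, p₂ (t - T) := by
        refine intervalIntegral.integral_congr_ae (Eventually.of_forall fun t ht => ?_)
        rw [uIoc_of_le hs.le] at ht
        simp [catFn, ht.1]
      rw [← intervalIntegral.integral_add_adjacent_intervals hi1 hi2, hA T le_rfl, hB, h0,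
        ← add_assoc, ← h₁.prim T le_rfl, h, intervalIntegral.integral_comp_sub_right, sub_self,
        ← h₂.prim]
      simp [catFn, hs]
  tail := by
    obtain ⟨S, hS, hS2⟩ := h₂.tail
    refine ⟨T + S, by positivity, fun s hs => ?_⟩
    have : ¬ s ≤ T := by linarith
    simpa [catFn, this] using hS2 (s - T) (by linarith)

/-- The affine path from `x` to `y` on `[0, T]`. -/
def linFn (T x y : ℝ) (s : ℝ) : ℝ := x + max s 0 / T * (y - x)

/-- The derivative of `linFn`. -/
def linDeriv (T x y : ℝ) (s : ℝ) : ℝ := if s ≤ 0 then 0 else (y - x) / T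

lemma isPiece_lin (T x y : ℝ) : IsPiece T (linFn T x y) (linDeriv T x y) where
  meas := Measurable.ite measurableSet_Iic measurable_const measurable_const
  memLp := by
    classical
    have h1 : MemLp (fun _ : ℝ => (y - x) / T) 2 ((volume.restrict (Iic T)).restrict (Iic 0)ᶜ) := by
      rw [memLp_const_iff (by norm_num) (by norm_num)]
      right
      rw [Measure.restrict_restrict measurableSet_Iic.compl, Measure.restrict_apply_univ, compl_Iic,
        Ioi_inter_Iic]
      exact measure_Ioc_lt_top
    have := MemLp.piecewise (s := Iic 0) measurableSet_Iic (MemLp.zero' (p := 2)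
      (μ := (volume.restrict (Iic T)).restrict (Iic 0)) (ε := ℝ)) h1
    exact this
  neg s hs := by simp [linDeriv, hs]
  prim s _ := by
    have h0 : linFn T x y 0 = x := by simp [linFn]
    rw [h0]
    rcases le_total s 0 with hs | hs
    · have : ∫ t in (0 : ℝ)..s, linDeriv T x y t = ∫ t in (0 : ℝ)..s, (0 : ℝ) := by
        refine intervalIntegral.integral_congr fun t ht => ?_
        rw [uIcc_of_ge hs] at ht
        simp [linDeriv, ht.2]
      rw [this]; simp [linFn, hs]
    · have : ∫ t in (0 : ℝ)..s, linDeriv T x y t = ∫ t in (0 : ℝ)..s, (y - x) / T := by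
        refine intervalIntegral.integral_congr_ae (Eventually.of_forall fun t ht => ?_)
        rw [uIoc_of_le hs] at ht
        simp [linDeriv, ht.1]
      rw [this]; simp [linFn, hs]; ring

lemma abs_linFn_le {T x y M s : ℝ} (hT : 0 < T) (hx : |x| ≤ M) (hy : |y| ≤ M) (hs : s ≤ T) :
    |linFn T x y s| ≤ M := by
  have h1 : 0 ≤ max s 0 / T := by positivity
  have h2 : max s 0 / T ≤ 1 := (div_le_one hT).2 (max_le hs hT.le)
  rw [abs_le] at *
  unfold linFn
  constructor <;> nlinarith

lemma linFn_zero (T x y : ℝ) : linFn T x y 0 = x := by simp [linFn]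

lemma linFn_self {T : ℝ} (hT : 0 < T) (x y : ℝ) : linFn T x y T = y := by
  simp [linFn, hT.le, hT.ne']

/-! ### Matrix profiles and their one-dimensional energy -/

/-- Matrix valued profiles with values in `𝒮₀`. -/
def IsMatProfile (b p : ℝ → Mat3) : Prop :=
  (∀ i j, IsProfile (fun s => b s i j) (fun s => p s i j)) ∧ ∀ s, b s ∈ S0

/-- Matrix valued pieces with values in `𝒮₀`. -/
def IsMatPiece (T : ℝ) (b p : ℝ → Mat3) : Prop :=
  (∀ i j, IsPiece T (fun s => b s i j) (fun s => p s i j)) ∧ ∀ s, s ≤ T → b s ∈ S0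

/-- The one-dimensional energy density. -/
def density (l : ℝ) (Q P : Mat3) : ℝ := 1 / 2 * normSq P + l ^ 2 * f Q + g Q

/-- The one-dimensional energy of the path `Q∞ + b`. -/
def cost (l : ℝ) (b p : ℝ → Mat3) : ℝ≥0∞ :=
  ∫⁻ s in Ioi 0, ENNReal.ofReal (density l (Qinf + b s) (p s))

lemma IsMatPiece.cat {T : ℝ} (hT : 0 < T) {b₁ p₁ b₂ p₂ : ℝ → Mat3} (h₁ : IsMatPiece T b₁ p₁)
    (h₂ : IsMatProfile b₂ p₂) (h : b₁ T = b₂ 0) :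
    IsMatProfile (catFn T b₁ b₂) (catFn T p₁ p₂) := by
  refine ⟨fun i j => ?_, fun s => ?_⟩
  · have := (h₁.1 i j).cat hT (h₂.1 i j) (by rw [h])
    simpa only [catFn_comp (fun A : Mat3 => A i j)] using this
  · unfold catFn
    split_ifs with hs
    exacts [h₁.2 s hs, h₂.2 _]

lemma cost_catFn (l : ℝ) {T : ℝ} (hT : 0 ≤ T) (b₁ p₁ b₂ p₂ : ℝ → Mat3) :
    cost l (catFn T b₁ b₂) (catFn T p₁ p₂) =
      (∫⁻ s in Ioc 0 T, ENNReal.ofReal (density l (Qinf + b₁ s) (p₁ s))) + cost l b₂ p₂ := by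
  unfold cost
  rw [← lintegral_catFn hT]
  congr 1
  ext s
  unfold catFn
  split_ifs <;> rfl

lemma isMatProfile_zero : IsMatProfile (fun _ => 0) (fun _ => 0) :=
  ⟨fun _ _ => isProfile_zero, fun _ => S0_zero⟩

lemma cost_zero (l : ℝ) : cost l (fun _ => 0) (fun _ => 0) = 0 := by
  simp [cost, density, f_Qinf, g_Qinf]

/-- The affine path of matrices from `X` to `Y` on `[0, T]`. -/
def linMat (T : ℝ) (X Y : Mat3) (s : ℝ) : Mat3 := X + (max s 0 / T) • (Y - X)

/-- The derivative of `linMat`. -/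
def linMatDeriv (T : ℝ) (X Y : Mat3) (s : ℝ) : Mat3 := if s ≤ 0 then 0 else T⁻¹ • (Y - X)

lemma linMat_apply (T : ℝ) (X Y : Mat3) (s : ℝ) (i j : Fin 3) :
    linMat T X Y s i j = linFn T (X i j) (Y i j) s := by simp [linMat, linFn]

lemma linMatDeriv_apply (T : ℝ) (X Y : Mat3) (s : ℝ) (i j : Fin 3) :
    linMatDeriv T X Y s i j = linDeriv T (X i j) (Y i j) s := by
  unfold linMatDeriv linDeriv
  split_ifs
  · rfl
  · simp; ring

lemma isMatPiece_lin {T : ℝ} {X Y : Mat3} (hX : X ∈ S0) (hY : Y ∈ S0) :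
    IsMatPiece T (linMat T X Y) (linMatDeriv T X Y) := by
  refine ⟨fun i j => ?_, fun s _ => S0_add hX (S0_smul _ (S0_sub hY hX))⟩
  simp only [linMat_apply, linMatDeriv_apply]
  exact isPiece_lin _ _ _

lemma linMat_zero (T : ℝ) (X Y : Mat3) : linMat T X Y 0 = X := by simp [linMat]

lemma linMat_self {T : ℝ} (hT : 0 < T) (X Y : Mat3) : linMat T X Y T = Y := by
  simp [linMat, hT.le, hT.ne']

lemma density_le_of_potential_le {l K C : ℝ} {Q P : Mat3} (hP : normSq P ≤ K)
    (hQ : l ^ 2 * f Q + g Q ≤ C) : density l Q P ≤ K / 2 + C := by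
  unfold density; linarith

lemma exists_potential_le (l M : ℝ) : ∃ C, 0 ≤ C ∧
    ∀ Q : Mat3, (∀ i j, |Q i j| ≤ M) → |l ^ 2 * f Q + g Q| ≤ C := by
  obtain ⟨C, h0, hC⟩ := exists_abs_f_le M
  refine ⟨l ^ 2 * C + 2, by positivity, fun Q hQ => (abs_add_le _ _).trans ?_⟩
  rw [abs_mul, abs_of_nonneg (sq_nonneg l)]
  exact add_le_add (mul_le_mul_of_nonneg_left (hC Q hQ) (sq_nonneg l)) (abs_g_le Q)

/-- The speed is `|Y - X|/T`, so the kinetic term over time `T` is at most `K/(2T)`. The segment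
stays in the convex box that contains its endpoints, where `C` bounds the potential. -/
lemma setLIntegral_linMat_le {l C M T K : ℝ}
    (hC : ∀ Q : Mat3, (∀ i j, |Q i j| ≤ M) → |l ^ 2 * f Q + g Q| ≤ C) (hT : 0 < T) {X Y : Mat3}
    (hX : ∀ i j, |(Qinf + X) i j| ≤ M) (hY : ∀ i j, |(Qinf + Y) i j| ≤ M)
    (hK : normSq (Y - X) ≤ K) :
    ∫⁻ s in Ioc 0 T, ENNReal.ofReal (density l (Qinf + linMat T X Y s) (linMatDeriv T X Y s)) ≤
      ENNReal.ofReal (K / T / 2 + C * T) := by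
  have key : ∀ s ∈ Ioc 0 T, ENNReal.ofReal
      (density l (Qinf + linMat T X Y s) (linMatDeriv T X Y s)) ≤
      ENNReal.ofReal (K / T ^ 2 / 2 + C) := by
    intro s hs
    refine ENNReal.ofReal_le_ofReal (density_le_of_potential_le ?_ (le_of_abs_le (hC _ fun i j => ?_)))
    · rw [linMatDeriv, if_neg (not_le.2 hs.1), normSq_smul, inv_pow, ← div_eq_inv_mul]
      gcongr
    · have : (Qinf + linMat T X Y s) i j = linFn T ((Qinf + X) i j) ((Qinf + Y) i j) s := by
        simp [linMat, linFn]; ring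
      rw [this]
      exact abs_linFn_le hT (hX i j) (hY i j) hs.2
  refine (setLIntegral_mono' measurableSet_Ioc key).trans ?_
  rw [setLIntegral_const, Real.volume_Ioc, sub_zero, ← ENNReal.ofReal_mul' hT.le]
  refine ENNReal.ofReal_le_ofReal (le_of_eq ?_)
  field_simp

/-! ### Comparison of `D` with the energies of profiles -/

lemma D_le_cost (l : ℝ) {b p : ℝ → Mat3} (h : IsMatProfile b p) :
    D l (Qinf + b 0) ≤ cost l b p := by
  -- Shift by `r = 1 + s`. Square integrability of `Q - Q∞` holds because `b` is bounded and
  -- vanishes for large `s`.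
  set Q : ℝ → Mat3 := fun r => Qinf + b (r - 1) with hQ
  set P : ℝ → Mat3 := fun r => p (r - 1) with hP
  have hW : HasWeakDeriv Q P := by
    intro i j r hr
    refine ⟨((h.1 i j).integrable.comp_sub_right 1).intervalIntegrable, ?_⟩
    simp only [hQ, hP, Matrix.add_apply]
    rw [intervalIntegral.integral_comp_sub_right (fun s => p s i j), (h.1 i j).prim (r - 1)]
    simp [add_assoc]
  have hmp := measurePreserving_sub_right (volume : Measure ℝ) 1
  have hmem : Q ∈ H1Path := by
    refine ⟨fun r _ => S0_add Qinf_mem_S0 (h.2 _), fun i j => ?_, P, hW, fun i j => ?_⟩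
    · obtain ⟨S, hS, hS2⟩ := (h.1 i j).tail
      obtain ⟨M, hM⟩ := (h.1 i j).bounded
      have hb : MemLp (fun s => b s i j) 2 (volume.restrict (Ioi 0)) := by
        have h1 : MemLp (fun s => b s i j) 2 (volume.restrict (Ioc 0 S)) :=
          MemLp.of_bound (h.1 i j).continuous.aestronglyMeasurable M
            (Eventually.of_forall fun s => hM s)
        have h2 := (memLp_indicator_iff_restrict (p := 2) (μ := (volume.restrict (Ioi (0 : ℝ))))
          (f := fun s => b s i j) (s := Ioc 0 S) measurableSet_Ioc).2
          (by rwa [Measure.restrict_restrict measurableSet_Ioc, inter_eq_left.2 Ioc_subset_Ioi_self])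
        refine h2.ae_eq ?_
        filter_upwards [ae_restrict_mem measurableSet_Ioi] with s hs
        by_cases hsS : s ≤ S
        · exact indicator_of_mem (mem_Ioc.2 ⟨hs, hsS⟩) _
        · rw [indicator_of_notMem fun h => hsS h.2, (hS2 s (not_le.1 hsS).le).1]
      have h3 := hb.comp_measurePreserving (hmp.restrict_preimage (measurableSet_Ioi (a := (0 : ℝ))))
      have e : (fun s : ℝ => s - 1) ⁻¹' Ioi 0 = Ioi 1 := by ext s; simp
      rw [e] at h3
      simpa [hQ, Function.comp_def] using h3
    · exact ((h.1 i j).memLp.comp_measurePreserving hmp).restrict (Ioi 1)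
  refine (iInf₂_le Q hmem).trans ((iInf_le _ (by simp [hQ])).trans ((iInf₂_le P hW).trans ?_))
  have e : Ioi (1 : ℝ) = (fun s => s - 1) ⁻¹' Ioi 0 := by ext s; simp
  rw [e]
  exact (hmp.setLIntegral_comp_preimage_emb (MeasurableEquiv.subRight 1).measurableEmbedding
    (fun s => ENNReal.ofReal (density l (Qinf + b s) (p s))) (Ioi 0)).le

lemma abs_Qinf_le (i j : Fin 3) : |Qinf i j| ≤ 2 := abs_uniaxial_le (by simp) i j

/-- The competitor is the segment from `n ⊗ n - I/3` to `Q∞` in unit time. Its energy is bounded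
uniformly in `n`, because unit vectors are at distance at most `2`. -/
lemma exists_D_uniaxial_le (l : ℝ) : ∃ C : ℝ, ∀ n : E3, ‖n‖ = 1 →
    D l (uniaxial n) ≤ ENNReal.ofReal C := by
  obtain ⟨C, -, hC⟩ := exists_potential_le l 2
  refine ⟨(36 * 2 ^ 2) / 1 / 2 + C * 1, fun n hn => ?_⟩
  have hb := (isMatPiece_lin (T := 1) (S0_sub (uniaxial_mem_S0 hn) Qinf_mem_S0) S0_zero).cat one_pos
    isMatProfile_zero (linMat_self one_pos _ _)
  have h := D_le_cost l hb
  have h0 : Qinf + catFn 1 (linMat 1 (uniaxial n - Qinf) 0) (fun _ => 0) 0 = uniaxial n := by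
    simp [catFn, linMat]
  rw [h0, cost_catFn l zero_le_one, cost_zero, add_zero] at h
  refine h.trans (setLIntegral_linMat_le hC one_pos ?_ ?_ ?_)
  · intro i j; rw [add_sub_cancel]; exact abs_uniaxial_le hn i j
  · intro i j; rw [add_zero]; exact abs_Qinf_le i j
  · rw [zero_sub, neg_sub]
    refine (normSq_uniaxial_sub_le (by simp) hn).trans ?_
    have : ‖EuclideanSpace.single 2 1 - n‖ ≤ 2 := (norm_sub_le _ _).trans (by rw [hn]; simp; norm_num)
    gcongr

lemma HasWeakDeriv.continuousOn {Q P : ℝ → Mat3} (h : HasWeakDeriv Q P) (i j : Fin 3) {r : ℝ}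
    (hr : 1 ≤ r) : ContinuousOn (fun s => Q s i j) (Icc 1 r) := by
  have h1 : ContinuousOn (fun s => Q 1 i j + ∫ t in (1 : ℝ)..s, P t i j) (Icc 1 r) := by
    have := intervalIntegral.continuousOn_primitive_interval' (μ := volume) (a := 1)
      ((h i j r hr).1) left_mem_uIcc
    rw [uIcc_of_le hr] at this
    exact continuousOn_const.add this
  exact h1.congr fun s hs => (h i j s hs.1).2

/-- A path in `Q∞ + H¹` comes close to `Q∞`. -/
lemma exists_near_Qinf {Q : ℝ → Mat3} (hQ : Q ∈ H1Path) {ε : ℝ} (hε : 0 < ε) :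
    ∃ r, 1 < r ∧ normSq (Q r - Qinf) < ε := by
  by_contra! hc
  have hint : Integrable (fun r => normSq (Q r - Qinf)) (volume.restrict (Ioi 1)) := by
    unfold normSq
    exact integrable_finsetSum _ fun i _ => integrable_finsetSum _ fun j _ => (hQ.2.1 i j).integrable_sq
  have h1 : ∫⁻ r in Ioi (1 : ℝ), ENNReal.ofReal ε ≤
      ∫⁻ r in Ioi (1 : ℝ), ENNReal.ofReal (normSq (Q r - Qinf)) :=
    setLIntegral_mono' measurableSet_Ioi fun r hr => ENNReal.ofReal_le_ofReal (hc r hr)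
  have h2 : ∫⁻ r in Ioi (1 : ℝ), ENNReal.ofReal (normSq (Q r - Qinf)) < ⊤ :=
    hint.lintegral_lt_top
  rw [setLIntegral_const, Real.volume_Ioi, ENNReal.mul_top (by simpa using hε)] at h1
  exact absurd h2 (not_lt.2 h1)

/-- A path of finite energy, restricted to a bounded interval, as a piece starting at time `0`. -/
lemma exists_piece_of_path (l : ℝ) {Q P : ℝ → Mat3} (hS : ∀ r, 1 ≤ r → Q r ∈ S0)
    (hW : HasWeakDeriv Q P)
    (hfin : ∫⁻ r in Ioi (1 : ℝ), ENNReal.ofReal (density l (Q r) (P r)) ≠ ⊤) {r : ℝ} (hr : 1 < r) :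
    ∃ b p : ℝ → Mat3, IsMatPiece (r - 1) b p ∧ b 0 = Q 1 - Qinf ∧ b (r - 1) = Q r - Qinf ∧
      ∫⁻ s in Ioc 0 (r - 1), ENNReal.ofReal (density l (Qinf + b s) (p s)) ≤
        ∫⁻ r in Ioi (1 : ℝ), ENNReal.ofReal (density l (Q r) (P r)) := by
  have hPi : ∀ i j, IntegrableOn (fun s => P s i j) (Ioc 1 r) := fun i j =>
    (intervalIntegrable_iff_integrableOn_Ioc_of_le hr.le).1 (hW i j r hr.le).1
  -- A piece requires a measurable derivative, whereas `P` is only almost everywhere measurable on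
  -- the interval.
  obtain ⟨P', hP'm, hP'e⟩ : ∃ P' : Fin 3 → Fin 3 → ℝ → ℝ, (∀ i j, Measurable (P' i j)) ∧
      ∀ i j, (fun s => P s i j) =ᵐ[volume.restrict (Ioc 1 r)] P' i j :=
    ⟨fun i j => (hPi i j).1.mk _, fun i j => (hPi i j).1.measurable_mk,
      fun i j => (hPi i j).1.ae_eq_mk⟩
  have hall : ∀ᵐ s ∂volume.restrict (Ioc 1 r), ∀ i j, P s i j = P' i j s := by
    rw [ae_all_iff]; intro i; rw [ae_all_iff]; intro j; exact hP'e i j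
  -- square integrability
  obtain ⟨M, hM⟩ : ∃ M : ℝ, ∀ s ∈ Icc 1 r, ∀ i j, |Q s i j| ≤ M := by
    have : ∀ i j, ∃ M : ℝ, ∀ s ∈ Icc 1 r, |Q s i j| ≤ M := fun i j =>
      isCompact_Icc.exists_bound_of_continuousOn (hW.continuousOn i j hr.le)
    choose M hM using this
    refine ⟨∑ i, ∑ j, |M i j|, fun s hs i j => (hM i j s hs).trans ((le_abs_self _).trans ?_)⟩
    refine le_trans ?_ (Finset.single_le_sum (f := fun i => ∑ j, |M i j|)
      (fun i _ => by positivity) (Finset.mem_univ i))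
    exact Finset.single_le_sum (f := fun j => |M i j|) (fun j _ => by positivity)
      (Finset.mem_univ j)
  obtain ⟨C, hC0, hC⟩ := exists_potential_le l M
  -- Finite energy controls only the positive part of the density. On the compact interval the path
  -- is bounded, so the potential is at least `-C` and `|P|²` is at most twice the density plus
  -- `2C`.
  have hsq : ∀ i j, ∫⁻ s in Ioc 1 r, ENNReal.ofReal (P' i j s ^ 2) < ⊤ := by
    intro i j
    have h1 : ∫⁻ s in Ioc 1 r, ENNReal.ofReal (P' i j s ^ 2) ≤
        ∫⁻ s in Ioc 1 r, (2 * ENNReal.ofReal (density l (Q s) (P s)) + 2 * ENNReal.ofReal C) := by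
      refine lintegral_mono_ae ?_
      filter_upwards [hall, ae_restrict_mem measurableSet_Ioc] with s hs hs2
      rw [← hs i j, ← mul_add, ← ENNReal.ofReal_ofNat 2]
      refine le_trans ?_ (mul_le_mul_right ENNReal.ofReal_add_le _)
      rw [← ENNReal.ofReal_mul (by norm_num)]
      refine ENNReal.ofReal_le_ofReal ?_
      have h2 := sq_entry_le_normSq (P s) i j
      have h3 := neg_le_of_abs_le (hC (Q s) (hM s ⟨hs2.1.le, hs2.2⟩))
      unfold density
      linarith
    refine h1.trans_lt ?_
    rw [lintegral_add_right _ measurable_const, setLIntegral_const, lintegral_const_mul' _ _ (by simp)]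
    refine ENNReal.add_lt_top.2 ⟨ENNReal.mul_lt_top (by simp) ?_, ?_⟩
    · exact lt_of_le_of_lt (lintegral_mono_set Ioc_subset_Ioi_self) hfin.lt_top
    · exact ENNReal.mul_lt_top (ENNReal.mul_lt_top (by simp) (by simp)) measure_Ioc_lt_top
  set T := r - 1 with hT
  have hT0 : 0 < T := by linarith
  -- The maximum with `0` makes the path constant for negative times, as the notion of a piece
  -- demands.
  let b : ℝ → Mat3 := fun s => Q (1 + max s 0) - Qinf
  let p : ℝ → Mat3 := fun s => Matrix.of fun i j => (Ioc 0 T).indicator (fun s => P' i j (1 + s)) s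
  have hmp := measurePreserving_add_left (volume : Measure ℝ) 1
  have hpre : (fun s : ℝ => 1 + s) ⁻¹' Ioc 1 r = Ioc 0 T := by
    ext s; simp only [mem_preimage, mem_Ioc, hT]
    constructor <;> rintro ⟨h1, h2⟩ <;> constructor <;> linarith
  have hmpr := hmp.restrict_preimage (measurableSet_Ioc (a := (1 : ℝ)) (b := r))
  rw [hpre] at hmpr
  refine ⟨b, p, ⟨fun i j => ⟨?_, ?_, ?_, ?_⟩, ?_⟩, by simp [b], by simp only [b, max_eq_left hT0.le]; simp [hT], ?_⟩
  · exact ((hP'm i j).comp (measurable_const_add 1)).indicator measurableSet_Ioc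
  · have h1 : MemLp (P' i j) 2 (volume.restrict (Ioc 1 r)) := by
      rw [memLp_two_iff_integrable_sq (hP'm i j).aestronglyMeasurable]
      refine ⟨((hP'm i j).pow_const 2).aestronglyMeasurable, ?_⟩
      rw [hasFiniteIntegral_iff_ofReal (Eventually.of_forall fun _ => sq_nonneg _)]
      exact hsq i j
    have h2 := (memLp_indicator_iff_restrict measurableSet_Ioc).2 (h1.comp_measurePreserving hmpr)
    exact h2.restrict (Iic T)
  · intro s hs
    simp [p, hs]
  · intro s hs
    rcases le_total s 0 with h0 | h0
    · have : ∫ t in (0 : ℝ)..s, p t i j = ∫ t in (0 : ℝ)..s, (0 : ℝ) := by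
        refine intervalIntegral.integral_congr fun t ht => ?_
        rw [uIcc_of_ge h0] at ht
        simp [p, ht.2]
      rw [this]; simp [b, h0]
    · have h1 : ∫ t in (0 : ℝ)..s, p t i j = ∫ t in (0 : ℝ)..s, P' i j (1 + t) := by
        refine intervalIntegral.integral_congr_ae (Eventually.of_forall fun t ht => ?_)
        rw [uIoc_of_le h0] at ht
        simp [p, ht.1, ht.2.trans hs]
      have h2 : ∫ t in (1 : ℝ)..(1 + s), P' i j t = ∫ t in (1 : ℝ)..(1 + s), P t i j := by
        refine intervalIntegral.integral_congr_ae_restrict ?_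
        rw [uIoc_of_le (by linarith)]
        have h3 : 1 + s ≤ r := by linarith
        filter_upwards [ae_restrict_of_ae_restrict_of_subset (Ioc_subset_Ioc_right h3)
          (hP'e i j)] with t ht using ht.symm
      rw [h1, intervalIntegral.integral_comp_add_left (P' i j), add_zero, h2]
      simp only [b, Matrix.sub_apply, max_eq_left h0, max_self, add_zero]
      rw [(hW i j (1 + s) (by linarith)).2]
      ring
  · intro s hs
    exact S0_sub (hS _ (by linarith [le_max_right s 0])) Qinf_mem_S0
  · calc ∫⁻ s in Ioc 0 T, ENNReal.ofReal (density l (Qinf + b s) (p s))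
        = ∫⁻ s in Ioc 0 T, ENNReal.ofReal (density l (Q (1 + s)) (P (1 + s))) := by
          refine lintegral_congr_ae ?_
          have := hmpr.quasiMeasurePreserving.ae hall
          filter_upwards [this, ae_restrict_mem measurableSet_Ioc] with s hs hs2
          have e1 : p s = P (1 + s) := by
            ext i j
            rw [hs i j]
            simp [p, hs2.1, hs2.2]
          simp only [e1, b, max_eq_left hs2.1.le, add_sub_cancel]
      _ = ∫⁻ s in Ioc 1 r, ENNReal.ofReal (density l (Q s) (P s)) := by
          rw [← hpre]
          exact hmp.setLIntegral_comp_preimage_emb (MeasurableEquiv.addLeft 1).measurableEmbedding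
            (fun s => ENNReal.ofReal (density l (Q s) (P s))) _
      _ ≤ _ := lintegral_mono_set Ioc_subset_Ioi_self

/-- `D` is approximated by the energies of profiles that reach `Q∞` in finite time. -/
lemma exists_profile_cost_le (l : ℝ) {Q₀ : Mat3} (hD : D l Q₀ ≠ ⊤) {δ : ℝ} (hδ : 0 < δ) :
    ∃ b p : ℝ → Mat3, IsMatProfile b p ∧ b 0 = Q₀ - Qinf ∧ cost l b p ≤ D l Q₀ + ENNReal.ofReal δ := by
  obtain ⟨C, hC0, hC⟩ := exists_potential_le l 3
  -- The path is cut at a time where it is within `ε` of `Q∞` and joined to `Q∞` by a segment of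
  -- duration `ε`. This costs at most `ε²/(2ε) + Cε = ε(1/2 + C)`. The box of size `3` suffices for
  -- `C` because `ε ≤ 1`.
  obtain ⟨ε, hε0, hε1, hεδ⟩ : ∃ ε : ℝ, 0 < ε ∧ ε ≤ 1 ∧ ε * (1 / 2 + C) ≤ δ / 2 := by
    refine ⟨min 1 (δ / 2 / (1 / 2 + C)), by positivity, min_le_left _ _, ?_⟩
    calc _ ≤ δ / 2 / (1 / 2 + C) * (1 / 2 + C) := by gcongr; exact min_le_right _ _
      _ = δ / 2 := by field_simp
  have hlt : D l Q₀ < D l Q₀ + ENNReal.ofReal (δ / 2) :=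
    ENNReal.lt_add_right hD (by simpa using hδ)
  obtain ⟨Q, hQ⟩ := iInf_lt_iff.1 hlt
  obtain ⟨hQ1, hQ⟩ := iInf_lt_iff.1 hQ
  obtain ⟨hQ0, hQ⟩ := iInf_lt_iff.1 hQ
  obtain ⟨P, hQ⟩ := iInf_lt_iff.1 hQ
  obtain ⟨hW, hQ⟩ := iInf_lt_iff.1 hQ
  obtain ⟨r, hr, hrn⟩ := exists_near_Qinf hQ1 (ε := ε ^ 2) (by positivity)
  obtain ⟨b₁, p₁, hb₁, h10, h1T, hc₁⟩ := exists_piece_of_path l hQ1.1 hW hQ.ne_top hr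
  have hb₂ := (isMatPiece_lin (T := ε) (X := Q r - Qinf) (S0_sub (hQ1.1 r hr.le) Qinf_mem_S0)
    S0_zero).cat hε0 isMatProfile_zero (linMat_self hε0 _ _)
  have hb := hb₁.cat (by linarith) hb₂ (by rw [h1T]; simp [catFn, hε0.le, linMat_zero])
  refine ⟨_, _, hb, ?_, ?_⟩
  · simp [catFn, hr.le, h10, hQ0]
  · rw [cost_catFn l (by linarith), cost_catFn l hε0.le, cost_zero, add_zero]
    have e : ENNReal.ofReal δ = ENNReal.ofReal (δ / 2) + ENNReal.ofReal (δ / 2) := by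
      rw [← ENNReal.ofReal_add (by positivity) (by positivity), add_halves]
    rw [e, ← add_assoc]
    refine add_le_add (hc₁.trans hQ.le) ?_
    refine (setLIntegral_linMat_le hC hε0 (K := ε ^ 2) ?_ ?_ ?_).trans
      (ENNReal.ofReal_le_ofReal ?_)
    · intro i j
      have h1 := sq_entry_le_normSq (Q r - Qinf) i j
      have h2 : |(Q r - Qinf) i j| ≤ 1 := by
        rw [← sq_le_one_iff_abs_le_one]; nlinarith
      rw [Matrix.add_apply]
      refine (abs_add_le _ _).trans ?_
      linarith [abs_Qinf_le i j]
    · intro i j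
      rw [add_zero]; linarith [abs_Qinf_le i j]
    · rw [zero_sub, ← neg_one_smul ℝ, normSq_smul]; linarith
    · have : ε ^ 2 / ε = ε := by field_simp
      rw [this]; linarith

/-! ### Polar coordinates -/

lemma finrank_E3 : Module.finrank ℝ E3 = 3 := by simp

lemma measurableSet_Ω : MeasurableSet Ω := measurableSet_lt measurable_const measurable_norm

lemma isOpen_Ω : IsOpen Ω := isOpen_lt continuous_const continuous_norm

lemma ne_zero_of_mem_Ω {x : E3} (hx : x ∈ Ω) : x ≠ 0 := by
  rintro rfl
  have : (1 : ℝ) < ‖(0 : E3)‖ := hx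
  simp at this
  linarith

/-- Transport by the homeomorphism of `E3 \ {0}` with sphere times half-line, under which volume
becomes surface measure times `r² dr`; the domain enters as an indicator. -/
lemma lintegral_Ω_polar {h : E3 → ℝ≥0∞} (hh : Measurable h) :
    ∫⁻ x in Ω, h x = ∫⁻ n : Metric.sphere (0 : E3) 1, (∫⁻ r in Ioi (1 : ℝ),
      ENNReal.ofReal (r ^ 2) * h (r • (n : E3))) ∂(volume : Measure E3).toSphere := by
  set h' : E3 → ℝ≥0∞ := Ω.indicator h with hh'
  have hm : Measurable h' := hh.indicator measurableSet_Ω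
  have h1 : ∫⁻ x in Ω, h x = ∫⁻ x : ({(0 : E3)}ᶜ : Set E3), h' x
      ∂((volume : Measure E3).comap Subtype.val) := by
    rw [lintegral_subtype_comap (measurableSet_singleton _).compl h', hh',
      setLIntegral_indicator measurableSet_Ω, inter_eq_left.2]
    exact fun x hx => ne_zero_of_mem_Ω hx
  have hmp := (volume : Measure E3).measurePreserving_homeomorphUnitSphereProd
  have h2 : ∫⁻ x : ({(0 : E3)}ᶜ : Set E3), h' x ∂((volume : Measure E3).comap Subtype.val) =
      ∫⁻ z : Metric.sphere (0 : E3) 1 × Ioi (0 : ℝ), h' ((z.2 : ℝ) • (z.1 : E3))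
        ∂((volume : Measure E3).toSphere.prod
          (Measure.volumeIoiPow (Module.finrank ℝ E3 - 1))) := by
    rw [← hmp.lintegral_comp_emb (Homeomorph.measurableEmbedding _)]
    refine lintegral_congr fun x => ?_
    congr 1
    have hx : ‖(x : E3)‖ ≠ 0 := norm_ne_zero_iff.2 x.2
    simp [homeomorphUnitSphereProd, smul_smul, hx]
  have hm2 : Measurable fun z : Metric.sphere (0 : E3) 1 × Ioi (0 : ℝ) =>
      h' ((z.2 : ℝ) • (z.1 : E3)) := by
    refine hm.comp ?_
    exact (measurable_subtype_coe.comp measurable_snd).smul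
      (measurable_subtype_coe.comp measurable_fst)
  rw [h1, h2, lintegral_prod _ hm2.aemeasurable]
  refine lintegral_congr fun n => ?_
  have hn : ‖(n : E3)‖ = 1 := by simp
  have hmn : Measurable fun r : Ioi (0 : ℝ) => h' ((r : ℝ) • (n : E3)) :=
    hm.comp (measurable_subtype_coe.smul_const (n : E3))
  rw [Measure.volumeIoiPow, lintegral_withDensity_eq_lintegral_mul _ (by fun_prop) hmn, finrank_E3]
  have e : (fun r : Ioi (0 : ℝ) => (((fun r : Ioi (0 : ℝ) => ENNReal.ofReal ((r : ℝ) ^ (3 - 1))) *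
      fun r : Ioi (0 : ℝ) => h' ((r : ℝ) • (n : E3))) r)) =
      fun r : Ioi (0 : ℝ) => (fun r : ℝ => (Ioi (1 : ℝ)).indicator
        (fun r => ENNReal.ofReal (r ^ 2) * h (r • (n : E3))) r) (r : ℝ) := by
    ext r
    have hr : (0 : ℝ) < r := r.2
    simp only [Pi.mul_apply, hh']
    by_cases h1r : (1 : ℝ) < r
    · rw [indicator_of_mem (show (r : ℝ) • (n : E3) ∈ Ω by
        simp [Ω, norm_smul, abs_of_pos hr, h1r]), indicator_of_mem (mem_Ioi.2 h1r)]
    · rw [indicator_of_notMem (show (r : ℝ) • (n : E3) ∉ Ω by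
        simpa [Ω, norm_smul, abs_of_pos hr] using h1r), indicator_of_notMem (by simpa using h1r),
        mul_zero]
  have h3 := lintegral_subtype_comap (μ := (volume : Measure ℝ)) (measurableSet_Ioi (a := (0 : ℝ)))
    (fun r : ℝ => (Ioi (1 : ℝ)).indicator (fun r => ENNReal.ofReal (r ^ 2) * h (r • (n : E3))) r)
  refine Eq.trans ?_ (h3.trans ?_)
  · exact congrArg (lintegral (Measure.comap Subtype.val volume)) e
  · rw [setLIntegral_indicator measurableSet_Ioi, inter_eq_left.2 (Ioi_subset_Ioi zero_le_one)]

/-- Cutting off to `1 < |x| ≤ R` bounds the weight `r²` of polar coordinates by `R²`. -/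
lemma integrable_radial {w : ℝ → ℝ} (hw : Integrable w) (R : ℝ) :
    Integrable fun x : E3 => (Ioc 1 R).indicator w ‖x‖ := by
  rw [integrable_fun_norm_addHaar, finrank_E3]
  have h1 : Integrable ((Ioc 1 R).indicator w) := hw.indicator measurableSet_Ioc
  have h2 : Integrable fun y : ℝ => (Ioc 1 R).indicator (fun y => y ^ 2) y * (Ioc 1 R).indicator w y := by
    refine h1.bdd_mul (c := R ^ 2)
      ((measurable_id.pow_const 2).indicator measurableSet_Ioc).aestronglyMeasurable
      (Eventually.of_forall fun y => ?_)
    by_cases hy : y ∈ Ioc 1 R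
    · rw [indicator_of_mem hy, Real.norm_eq_abs, abs_of_nonneg (by positivity)]
      have := hy.1; have := hy.2
      gcongr
    · rw [indicator_of_notMem hy]; simp; positivity
  refine Integrable.integrableOn (h2.congr (Eventually.of_forall fun y => ?_))
  by_cases hy : y ∈ Ioc 1 R
  · simp [indicator_of_mem hy]
  · simp [indicator_of_notMem hy]

lemma integral_abs_radial_le {w : ℝ → ℝ} (hw : Integrable w) (R : ℝ) :
    ∫ x : E3, |(Ioc 1 R).indicator w ‖x‖| ≤
      3 * (volume : Measure E3).real (Metric.ball 0 1) * R ^ 2 * ∫ r, |w r| := by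
  have h := integral_fun_norm_addHaar (volume : Measure E3) (fun r => |(Ioc 1 R).indicator w r|)
  rw [h, finrank_E3, nsmul_eq_mul, smul_eq_mul]
  have h2 : ∫ y in Ioi (0 : ℝ), y ^ (3 - 1) • |(Ioc 1 R).indicator w y| ≤ R ^ 2 * ∫ r, |w r| := by
    rw [← integral_const_mul]
    refine (integral_mono_of_nonneg (g := fun r => R ^ 2 * |w r|) (Eventually.of_forall fun y => ?_)
      ((hw.abs.const_mul _).restrict) (Eventually.of_forall fun y => ?_)).trans ?_
    · exact mul_nonneg (sq_nonneg y) (abs_nonneg _)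
    · by_cases hy : y ∈ Ioc 1 R
      · simp only [indicator_of_mem hy, smul_eq_mul]
        have := hy.1; have := hy.2
        gcongr
      · simp only [indicator_of_notMem hy, abs_zero, smul_zero]; positivity
    · exact setIntegral_le_integral (hw.abs.const_mul _)
        (Eventually.of_forall fun y => by simp only [Pi.zero_apply]; positivity)
  push_cast
  rw [mul_assoc, mul_assoc]
  gcongr

/-! ### Weak gradients -/

/-- The `k`-th vector of the standard basis. -/
abbrev basisVec (k : Fin 3) : E3 := EuclideanSpace.single k 1

lemma hasFDerivAt_norm {x : E3} (hx : x ≠ 0) :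
    HasFDerivAt (fun y : E3 => ‖y‖) (‖x‖⁻¹ • innerSL ℝ x) x := by
  have h1 := (hasStrictFDerivAt_norm_sq x).hasFDerivAt.sqrt (by simpa using hx)
  have e : (fun y : E3 => √(‖y‖ ^ 2)) = fun y => ‖y‖ := by
    ext y; exact Real.sqrt_sq (norm_nonneg y)
  rw [e, Real.sqrt_sq (norm_nonneg x)] at h1
  have e2 : (1 / (2 * ‖x‖)) • (2 : ℕ) • innerSL ℝ x = ‖x‖⁻¹ • innerSL ℝ x := by
    rw [← Nat.cast_smul_eq_nsmul ℝ, smul_smul]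
    congr 1
    push_cast
    field_simp
  rwa [e2] at h1

lemma innerSL_basisVec (x : E3) (k : Fin 3) : innerSL ℝ x (basisVec k) = x k := by
  simp [EuclideanSpace.inner_single_right]

lemma hasFDerivAt_comp_norm {v : ℝ → ℝ} {d : ℝ} {x : E3} (hx : x ≠ 0) (hv : HasDerivAt v d ‖x‖) :
    HasFDerivAt (fun y : E3 => v ‖y‖) (d • ‖x‖⁻¹ • innerSL ℝ x) x :=
  hv.comp_hasFDerivAt x (hasFDerivAt_norm hx)

lemma abs_div_norm_le (x : E3) (k : Fin 3) : |x k / ‖x‖| ≤ 1 := by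
  rw [abs_div, abs_norm]
  exact div_le_one_of_le₀ (abs_entry_le_norm x k) (norm_nonneg x)

lemma measurable_div_norm (k : Fin 3) : Measurable fun x : E3 => x k / ‖x‖ := by fun_prop

/-- For continuous `p` the radial function is differentiable off the origin, and the ordinary
integration by parts applies. The singularities at the origin are harmless because `Φ` is supported
in `Ω`. -/
lemma integral_radial_mul_fderiv_of_continuous {c : ℝ} {p : ℝ → ℝ} (hp : Continuous p) {Φ : E3 → ℝ}
    (hΦ : ContDiff ℝ 1 Φ) (hc : HasCompactSupport Φ) (hs : tsupport Φ ⊆ Ω) (k : Fin 3) :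
    ∫ x : E3, (c + ∫ t in (1 : ℝ)..‖x‖, p t) * fderiv ℝ Φ x (basisVec k) =
      -∫ x : E3, p ‖x‖ * (x k / ‖x‖) * Φ x := by
  set v : ℝ → ℝ := fun r => c + ∫ t in (1 : ℝ)..r, p t with hv
  have hd : ∀ r, HasDerivAt v (p r) r := fun r =>
    (intervalIntegral.integral_hasDerivAt_right (hp.intervalIntegrable _ _)
      (hp.stronglyMeasurableAtFilter _ _) hp.continuousAt).const_add c
  have hvc : Continuous v := continuous_iff_continuousAt.2 fun r => (hd r).continuousAt
  have hfd : ∀ x : E3, x ≠ 0 → HasFDerivAt (fun y : E3 => v ‖y‖) (p ‖x‖ • ‖x‖⁻¹ • innerSL ℝ x) x :=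
    fun x hx => hasFDerivAt_comp_norm hx (hd _)
  have hfe : ∀ x : E3, fderiv ℝ (fun y : E3 => v ‖y‖) x (basisVec k) * Φ x =
      p ‖x‖ * (x k / ‖x‖) * Φ x := by
    intro x
    by_cases hx : x ∈ tsupport Φ
    · rw [(hfd x (ne_zero_of_mem_Ω (hs hx))).fderiv]
      simp only [_root_.smul_apply, innerSL_basisVec, smul_eq_mul]
      ring
    · rw [image_eq_zero_of_notMem_tsupport hx]; simp
  have hcont : Continuous fun x : E3 => p ‖x‖ * (x k / ‖x‖) * Φ x := by
    refine continuous_of_tsupport fun x hx => ?_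
    have hx0 := ne_zero_of_mem_Ω (hs (tsupport_mul_subset_right hx))
    have h1 : ContinuousAt (fun y : E3 => y k / ‖y‖) x :=
      ContinuousAt.div (by fun_prop) (by fun_prop) (norm_ne_zero_iff.2 hx0)
    exact ((hp.comp continuous_norm).continuousAt.mul h1).mul hΦ.continuous.continuousAt
  have hdΦ : Continuous fun x => fderiv ℝ Φ x (basisVec k) :=
    (hΦ.continuous_fderiv one_ne_zero).clm_apply continuous_const
  have := integral_mul_fderiv_eq_neg_fderiv_mul_of_integrable (μ := (volume : Measure E3))
    (f := fun y : E3 => v ‖y‖) (g := Φ) (v := basisVec k) ?_ ?_ ?_ ?_ ?_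
  · rw [this]; simp only [hfe]
  · simp only [hfe]
    exact hcont.integrable_of_hasCompactSupport hc.mul_left
  · exact ((hvc.comp continuous_norm).mul hdΦ).integrable_of_hasCompactSupport
      ((hc.fderiv_apply ℝ (basisVec k)).mul_left)
  · exact ((hvc.comp continuous_norm).mul hΦ.continuous).integrable_of_hasCompactSupport hc.mul_left
  · exact fun x hx => (hfd x (ne_zero_of_mem_Ω (hs hx))).differentiableAt
  · exact fun x _ => hΦ.differentiable one_ne_zero x

lemma exists_radius {Φ : E3 → ℝ} (hc : HasCompactSupport Φ) (hs : tsupport Φ ⊆ Ω) :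
    ∃ R, 1 ≤ R ∧ ∀ x, ‖x‖ ∉ Ioc 1 R → Φ x = 0 := by
  obtain ⟨R, hR⟩ := hc.isCompact.isBounded.exists_norm_le
  refine ⟨max R 1, le_max_right _ _, fun x hx => image_eq_zero_of_notMem_tsupport fun h => hx ?_⟩
  exact ⟨hs h, (hR x h).trans (le_max_left _ _)⟩

lemma integrable_radial_mul {p : ℝ → ℝ} (hp : Integrable p) {Φ : E3 → ℝ} (hΦ : Continuous Φ)
    (hc : HasCompactSupport Φ) (hs : tsupport Φ ⊆ Ω) (k : Fin 3) :
    Integrable fun x : E3 => p ‖x‖ * (x k / ‖x‖) * Φ x := by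
  obtain ⟨R, -, hR⟩ := exists_radius hc hs
  obtain ⟨M, hM⟩ := hc.exists_bound_of_continuous hΦ
  have h1 : Integrable fun x : E3 => (x k / ‖x‖ * Φ x) * (Ioc 1 R).indicator p ‖x‖ := by
    refine (integrable_radial hp R).bdd_mul (c := 1 * M)
      ((measurable_div_norm k).mul hΦ.measurable).aestronglyMeasurable
      (Eventually.of_forall fun x => ?_)
    rw [norm_mul]
    exact mul_le_mul (abs_div_norm_le x k) (hM x) (norm_nonneg _) zero_le_one
  refine h1.congr (Eventually.of_forall fun x => ?_)
  by_cases hx : ‖x‖ ∈ Ioc 1 R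
  · simp only [indicator_of_mem hx]; ring
  · simp only [hR x hx]; ring

/-- Integration by parts for a radial, absolutely continuous function. -/
lemma integral_radial_mul_fderiv {v p : ℝ → ℝ} (hp : Integrable p) (hvc : Continuous v)
    (hv : ∀ r, 1 ≤ r → v r = v 1 + ∫ t in (1 : ℝ)..r, p t) {Φ : E3 → ℝ}
    (hΦ : ContDiff ℝ 1 Φ) (hc : HasCompactSupport Φ) (hs : tsupport Φ ⊆ Ω) (k : Fin 3) :
    ∫ x : E3, v ‖x‖ * fderiv ℝ Φ x (basisVec k) = -∫ x : E3, p ‖x‖ * (x k / ‖x‖) * Φ x := by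
  obtain ⟨R, hR1, hR⟩ := exists_radius hc hs
  obtain ⟨M, hM⟩ := hc.exists_bound_of_continuous hΦ.continuous
  have hM0 : 0 ≤ M := (norm_nonneg _).trans (hM 0)
  have hdΦ : Continuous fun x => fderiv ℝ Φ x (basisVec k) :=
    (hΦ.continuous_fderiv one_ne_zero).clm_apply continuous_const
  have hdc : HasCompactSupport fun x => fderiv ℝ Φ x (basisVec k) := hc.fderiv_apply ℝ (basisVec k)
  have hd0 : ∀ x : E3, ‖x‖ ≤ 1 → fderiv ℝ Φ x (basisVec k) = 0 := by
    intro x hx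
    refine image_eq_zero_of_notMem_tsupport (f := fun x => fderiv ℝ Φ x (basisVec k)) fun h => ?_
    exact absurd (hs (tsupport_fderiv_apply_subset ℝ (basisVec k) h)) (not_lt.2 hx)
  set N : ℝ := ∫ x, |fderiv ℝ Φ x (basisVec k)|
  have hN : 0 ≤ N := integral_nonneg fun _ => abs_nonneg _
  set c : ℝ := 3 * (volume : Measure E3).real (Metric.ball 0 1) * R ^ 2
  have hc0 : 0 ≤ c := by positivity
  -- Approximate `p` in `L¹` by a continuous `q`. Both integrals are stable: the primitives differ
  -- uniformly by at most `‖p - q‖₁`, and on the support of `Φ` polar coordinates bound the other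
  -- difference by a multiple of `‖p - q‖₁`.
  have key : ∀ ε : ℝ, 0 < ε → |(∫ x : E3, v ‖x‖ * fderiv ℝ Φ x (basisVec k)) +
      ∫ x : E3, p ‖x‖ * (x k / ‖x‖) * Φ x| ≤ 0 + (N + M * c) * ε := by
    intro ε hε
    obtain ⟨q, -, hq, hqc, hqi⟩ := hp.exists_hasCompactSupport_integral_sub_le hε
    have hq0 := integral_radial_mul_fderiv_of_continuous (c := v 1) hqc hΦ hc hs k
    set vq : ℝ → ℝ := fun r => v 1 + ∫ t in (1 : ℝ)..r, q t with hvq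
    have hvqc : Continuous vq := continuous_const.add
      (intervalIntegral.continuous_primitive (fun a b => hqc.intervalIntegrable a b) 1)
    have i1 : Integrable fun x : E3 => v ‖x‖ * fderiv ℝ Φ x (basisVec k) :=
      ((hvc.comp continuous_norm).mul hdΦ).integrable_of_hasCompactSupport hdc.mul_left
    have i2 : Integrable fun x : E3 => vq ‖x‖ * fderiv ℝ Φ x (basisVec k) :=
      ((hvqc.comp continuous_norm).mul hdΦ).integrable_of_hasCompactSupport hdc.mul_left
    have i3 := integrable_radial_mul hp hΦ.continuous hc hs k
    have i4 := integrable_radial_mul hqi hΦ.continuous hc hs k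
    have e : (∫ x : E3, v ‖x‖ * fderiv ℝ Φ x (basisVec k)) + ∫ x : E3, p ‖x‖ * (x k / ‖x‖) * Φ x =
        (∫ x : E3, (v ‖x‖ * fderiv ℝ Φ x (basisVec k) - vq ‖x‖ * fderiv ℝ Φ x (basisVec k))) +
        ∫ x : E3, (p ‖x‖ * (x k / ‖x‖) * Φ x - q ‖x‖ * (x k / ‖x‖) * Φ x) := by
      rw [integral_sub i1 i2, integral_sub i3 i4, hq0]; ring
    rw [e, zero_add, add_mul]
    refine (abs_add_le _ _).trans (add_le_add ?_ ?_)
    · refine (abs_integral_le_integral_abs).trans ?_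
      rw [mul_comm N, ← integral_const_mul]
      refine integral_mono (i1.sub i2).abs
        ((hdΦ.integrable_of_hasCompactSupport hdc).abs.const_mul _) fun x => ?_
      simp only [← sub_mul, abs_mul]
      rcases le_or_gt ‖x‖ 1 with hx | hx
      · rw [hd0 x hx]; simp
      · refine mul_le_mul_of_nonneg_right ?_ (abs_nonneg _)
        rw [hv _ hx.le, hvq]
        simp only [add_sub_add_left_eq_sub]
        rw [← intervalIntegral.integral_sub hp.intervalIntegrable hqi.intervalIntegrable]
        refine (intervalIntegral.norm_integral_le_integral_norm_uIoc
          (f := fun t => p t - q t)).trans (le_trans ?_ hq)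
        exact setIntegral_le_integral (hp.sub hqi).norm (Eventually.of_forall fun _ => norm_nonneg _)
    · refine (abs_integral_le_integral_abs).trans ?_
      have h1 := integral_abs_radial_le (hp.sub hqi) R
      have h2 : ∫ x : E3, |p ‖x‖ * (x k / ‖x‖) * Φ x - q ‖x‖ * (x k / ‖x‖) * Φ x| ≤
          ∫ x : E3, M * |(Ioc 1 R).indicator (p - q) ‖x‖| := by
        refine integral_mono (i3.sub i4).abs
          ((integrable_radial (hp.sub hqi) R).abs.const_mul _) fun x => ?_
        simp only
        by_cases hx : ‖x‖ ∈ Ioc 1 R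
        · rw [indicator_of_mem hx]
          have e2 : p ‖x‖ * (x k / ‖x‖) * Φ x - q ‖x‖ * (x k / ‖x‖) * Φ x
              = (x k / ‖x‖) * (Φ x * (p - q) ‖x‖) := by simp; ring
          rw [e2, abs_mul, abs_mul]
          refine (mul_le_of_le_one_left (by positivity) (abs_div_norm_le x k)).trans ?_
          exact mul_le_mul_of_nonneg_right (hM x) (abs_nonneg _)
        · rw [hR x hx]; simp [indicator_of_notMem hx]
      rw [integral_const_mul] at h2
      refine h2.trans ?_
      rw [mul_assoc]
      refine mul_le_mul_of_nonneg_left (h1.trans ?_) hM0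
      exact mul_le_mul_of_nonneg_left hq hc0
  have hz := le_of_forall_pos_le_add (a := |(∫ x : E3, v ‖x‖ * fderiv ℝ Φ x (basisVec k)) +
      ∫ x : E3, p ‖x‖ * (x k / ‖x‖) * Φ x|) (b := 0) fun ε hε => by
    have := key (ε / (N + M * c + 1)) (by positivity)
    refine this.trans (add_le_add le_rfl ?_)
    rw [← mul_div_assoc, div_le_iff₀ (by positivity)]
    nlinarith
  have := abs_nonpos_iff.1 hz
  linarith

/-- `G k` is the weak partial derivative `∂ₖu` in `Ω` for the scalar function `u`. -/
def HasWeakPartial (u : E3 → ℝ) (G : Fin 3 → E3 → ℝ) : Prop :=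
  LocallyIntegrableOn u Ω volume ∧
    ∀ k, LocallyIntegrableOn (G k) Ω volume ∧
      ∀ φ : E3 → ℝ, ContDiff ℝ ∞ φ → HasCompactSupport φ → tsupport φ ⊆ Ω →
        ∫ x in Ω, u x * fderiv ℝ φ x (basisVec k) = -∫ x in Ω, G k x * φ x

lemma integrable_locallyIntegrableOn_mul {u φ : E3 → ℝ} (hu : LocallyIntegrableOn u Ω volume)
    (hφ : Continuous φ) (hc : HasCompactSupport φ) (hs : tsupport φ ⊆ Ω) :
    IntegrableOn (fun x => u x * φ x) Ω := by
  have h1 : IntegrableOn (fun x => u x * φ x) (tsupport φ) :=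
    (hu.integrableOn_compact_subset hs hc).mul_continuousOn hφ.continuousOn hc
  have h2 : Integrable (fun x => u x * φ x) := by
    refine (integrableOn_iff_integrable_of_support_subset fun x hx => ?_).1 h1
    by_contra h
    exact hx (by simp [image_eq_zero_of_notMem_tsupport h])
  exact h2.integrableOn

lemma HasWeakPartial.add {u w : E3 → ℝ} {G H : Fin 3 → E3 → ℝ} (hu : HasWeakPartial u G)
    (hw : HasWeakPartial w H) :
    HasWeakPartial (fun x => u x + w x) (fun k x => G k x + H k x) := by
  refine ⟨hu.1.add hw.1, fun k => ⟨(hu.2 k).1.add (hw.2 k).1, fun φ hφ hc hs => ?_⟩⟩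
  have hd : Continuous fun x => fderiv ℝ φ x (basisVec k) :=
    (hφ.continuous_fderiv (by simp)).clm_apply continuous_const
  have hdc : HasCompactSupport fun x => fderiv ℝ φ x (basisVec k) := hc.fderiv_apply ℝ (basisVec k)
  have hds : tsupport (fun x => fderiv ℝ φ x (basisVec k)) ⊆ Ω :=
    (tsupport_fderiv_apply_subset ℝ (basisVec k)).trans hs
  simp only [add_mul]
  rw [integral_add (integrable_locallyIntegrableOn_mul hu.1 hd hdc hds)
    (integrable_locallyIntegrableOn_mul hw.1 hd hdc hds),
    integral_add (integrable_locallyIntegrableOn_mul (hu.2 k).1 hφ.continuous hc hs)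
    (integrable_locallyIntegrableOn_mul (hw.2 k).1 hφ.continuous hc hs),
    (hu.2 k).2 φ hφ hc hs, (hw.2 k).2 φ hφ hc hs, neg_add]

/-- The radial factor is only weakly differentiable and `A` is smooth on `Ω`, so `A φ` is an
admissible test function for the radial formula; expanding its derivative gives the product rule. -/
lemma hasWeakPartial_radial_mul {v p : ℝ → ℝ} {A : E3 → ℝ} (hp : Integrable p) (hvc : Continuous v)
    (hv : ∀ r, 1 ≤ r → v r = v 1 + ∫ t in (1 : ℝ)..r, p t)
    (hsupp : ∃ R, ∀ r, r ∉ Ioc 1 R → p r = 0) (hA : ContDiffOn ℝ ∞ A {0}ᶜ) :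
    HasWeakPartial (fun x => v ‖x‖ * A x)
      (fun k x => v ‖x‖ * fderiv ℝ A x (basisVec k) + p ‖x‖ * (x k / ‖x‖) * A x) := by
  have hAt : ∀ x ∈ Ω, ContDiffAt ℝ ∞ A x := fun x hx =>
    (hA x (ne_zero_of_mem_Ω hx)).contDiffAt (isOpen_compl_singleton.mem_nhds (ne_zero_of_mem_Ω hx))
  have hAc : ContinuousOn A Ω := fun x hx => (hAt x hx).continuousAt.continuousWithinAt
  have hdA : ∀ k, ∀ x ∈ Ω, ContinuousAt (fun y => fderiv ℝ A y (basisVec k)) x := fun k x hx =>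
    ((hAt x hx).fderiv_right (m := 0) (by simp)).continuousAt.clm_apply continuousAt_const
  have hvn : Continuous fun x : E3 => v ‖x‖ := hvc.comp continuous_norm
  obtain ⟨R, hR⟩ := hsupp
  have hpn : Integrable fun x : E3 => p ‖x‖ := by
    refine (integrable_radial hp R).congr (Eventually.of_forall fun x => ?_)
    by_cases hx : ‖x‖ ∈ Ioc 1 R
    · simp only [indicator_of_mem hx]
    · simp only [indicator_of_notMem hx, hR _ hx]
  have hK : ∀ k, ContinuousOn (fun x : E3 => x k / ‖x‖) Ω := fun k =>
    ContinuousOn.div (by fun_prop) (by fun_prop) fun x hx => norm_ne_zero_iff.2 (ne_zero_of_mem_Ω hx)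
  have l2 : ∀ k, LocallyIntegrableOn (fun x : E3 => v ‖x‖ * fderiv ℝ A x (basisVec k)) Ω volume :=
    fun k => ContinuousOn.locallyIntegrableOn
      (hvn.continuousOn.mul fun x hx => (hdA k x hx).continuousWithinAt) measurableSet_Ω
  have l3 : ∀ k, LocallyIntegrableOn (fun x : E3 => p ‖x‖ * (x k / ‖x‖) * A x) Ω volume := by
    intro k
    have := (hpn.locallyIntegrable.locallyIntegrableOn Ω).mul_continuousOn ((hK k).mul hAc)
      isOpen_Ω.isLocallyClosed
    simpa only [mul_assoc, Pi.mul_apply] using this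
  refine ⟨(hvn.continuousOn.mul hAc).locallyIntegrableOn measurableSet_Ω,
    fun k => ⟨(l2 k).add (l3 k), fun φ hφ hc hs => ?_⟩⟩
  have hΦs : tsupport (fun x => A x * φ x) ⊆ Ω := tsupport_mul_subset_right.trans hs
  have hΦ : ContDiff ℝ 1 fun x => A x * φ x := by
    refine contDiff_iff_contDiffAt.2 fun x => ?_
    by_cases hx : x ∈ tsupport φ
    · exact ((hAt x (hs hx)).of_le (by simp)).mul (hφ.contDiffAt.of_le (by simp))
    · refine (contDiffAt_const (c := (0 : ℝ))).congr_of_eventuallyEq ?_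
      filter_upwards [(isClosed_tsupport φ).isOpen_compl.mem_nhds hx] with y hy
      rw [image_eq_zero_of_notMem_tsupport hy, mul_zero]
  have hΦc : HasCompactSupport fun x => A x * φ x := hc.mul_left
  have h1 := integral_radial_mul_fderiv hp hvc hv hΦ hΦc hΦs k
  have hd : Continuous fun x => fderiv ℝ φ x (basisVec k) :=
    (hφ.continuous_fderiv (by simp)).clm_apply continuous_const
  have hfd : ∀ x ∈ Ω, fderiv ℝ (fun x => A x * φ x) x (basisVec k) =
      A x * fderiv ℝ φ x (basisVec k) + φ x * fderiv ℝ A x (basisVec k) := by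
    intro x hx
    have := ((hAt x hx).differentiableAt (by simp)).hasFDerivAt.mul
      (hφ.differentiable (by simp) x).hasFDerivAt
    have e := this.fderiv
    rw [show (A * φ) = fun x => A x * φ x from rfl] at e
    rw [e]; simp
  have z1 : ∫ x : E3, v ‖x‖ * fderiv ℝ (fun x => A x * φ x) x (basisVec k) =
      ∫ x in Ω, v ‖x‖ * fderiv ℝ (fun x => A x * φ x) x (basisVec k) := by
    refine (setIntegral_eq_integral_of_forall_compl_eq_zero fun x hx => ?_).symm
    rw [image_eq_zero_of_notMem_tsupport (f := fun y => fderiv ℝ (fun x => A x * φ x) y (basisVec k))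
      fun h => hx (hΦs (tsupport_fderiv_apply_subset ℝ (basisVec k) h)), mul_zero]
  have z2 : ∫ x : E3, p ‖x‖ * (x k / ‖x‖) * (A x * φ x) =
      ∫ x in Ω, p ‖x‖ * (x k / ‖x‖) * (A x * φ x) := by
    refine (setIntegral_eq_integral_of_forall_compl_eq_zero fun x hx => ?_).symm
    rw [image_eq_zero_of_notMem_tsupport fun h => hx (hs h)]; simp
  rw [z1, z2] at h1
  have i1 := integrable_locallyIntegrableOn_mul (l2 k) hφ.continuous hc hs
  have i2 := integrable_locallyIntegrableOn_mul (l3 k) hφ.continuous hc hs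
  have i3 : IntegrableOn (fun x => v ‖x‖ * A x * fderiv ℝ φ x (basisVec k)) Ω :=
    integrable_locallyIntegrableOn_mul ((hvn.continuousOn.mul hAc).locallyIntegrableOn measurableSet_Ω)
      hd (hc.fderiv_apply ℝ (basisVec k)) ((tsupport_fderiv_apply_subset ℝ (basisVec k)).trans hs)
  have h2 : ∫ x in Ω, v ‖x‖ * fderiv ℝ (fun x => A x * φ x) x (basisVec k) =
      (∫ x in Ω, v ‖x‖ * A x * fderiv ℝ φ x (basisVec k)) +
      ∫ x in Ω, v ‖x‖ * fderiv ℝ A x (basisVec k) * φ x := by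
    rw [← integral_add i3 i1]
    refine setIntegral_congr_fun measurableSet_Ω fun x hx => ?_
    simp only [hfd x hx]; ring
  have h3 : ∫ x in Ω, (v ‖x‖ * fderiv ℝ A x (basisVec k) + p ‖x‖ * (x k / ‖x‖) * A x) * φ x =
      (∫ x in Ω, v ‖x‖ * fderiv ℝ A x (basisVec k) * φ x) +
      ∫ x in Ω, p ‖x‖ * (x k / ‖x‖) * (A x * φ x) := by
    have : ∀ x, (v ‖x‖ * fderiv ℝ A x (basisVec k) + p ‖x‖ * (x k / ‖x‖) * A x) * φ x =
      v ‖x‖ * fderiv ℝ A x (basisVec k) * φ x + p ‖x‖ * (x k / ‖x‖) * A x * φ x := fun x => by ring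
    simp only [this]
    rw [integral_add i1 i2]
    simp only [mul_assoc]
  rw [h3]
  linarith

/-! ### Maps with a boundary layer -/

/-- The data of a boundary layer map: finitely many `0`-homogeneous matrix fields `A m`, smooth off
the origin, with radial profiles `β m` of derivative `p m`. -/
structure IsLayer {ι : Type} (A : ι → E3 → Mat3) (β p : ι → ℝ → ℝ) : Prop where
  profile : ∀ m, IsProfile (β m) (p m)
  smooth : ∀ m i j, ContDiffOn ℝ ∞ (fun x => A m x i j) {0}ᶜ
  homog : ∀ m (t : ℝ), 0 < t → ∀ x, A m (t • x) = A m x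

section

variable {ι : Type} {A : ι → E3 → Mat3} {β p : ι → ℝ → ℝ}

/-- The entrywise partial derivatives of a matrix field. -/
def partialMat (k : Fin 3) (A : E3 → Mat3) (x : E3) : Mat3 :=
  Matrix.of fun i j => fderiv ℝ (fun y => A y i j) x (basisVec k)

lemma IsLayer.continuousOn (h : IsLayer A β p) (m : ι) (i j : Fin 3) :
    ContinuousOn (fun x => A m x i j) {0}ᶜ := (h.smooth m i j).continuousOn

lemma IsLayer.continuousOn_partial (h : IsLayer A β p) (k : Fin 3) (m : ι) (i j : Fin 3) :
    ContinuousOn (fun x => partialMat k (A m) x i j) {0}ᶜ := fun x hx =>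
  ((((h.smooth m i j x hx).contDiffAt (isOpen_compl_singleton.mem_nhds hx)).fderiv_right (m := 0)
    (by simp)).continuousAt.clm_apply continuousAt_const).continuousWithinAt

variable [Fintype ι]

/-- The combination `∑ m, β m s • A m x`. -/
def combine (A : ι → E3 → Mat3) (β : ι → ℝ → ℝ) (x : E3) (s : ℝ) : Mat3 := ∑ m, β m s • A m x

/-- The boundary layer map of width `η`. -/
def layerMap (A : ι → E3 → Mat3) (β : ι → ℝ → ℝ) (η : ℝ) (x : E3) : Mat3 :=
  Qinf + combine A β x ((‖x‖ - 1) / η)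

/-- The gradient of `layerMap`. -/
def layerGrad (A : ι → E3 → Mat3) (β p : ι → ℝ → ℝ) (η : ℝ) (k : Fin 3) (x : E3) : Mat3 :=
  combine (fun m => partialMat k (A m)) β x ((‖x‖ - 1) / η) +
    (x k / ‖x‖ / η) • combine A p x ((‖x‖ - 1) / η)

lemma combine_apply (A : ι → E3 → Mat3) (β : ι → ℝ → ℝ) (x : E3) (s : ℝ) (i j : Fin 3) :
    combine A β x s i j = ∑ m, β m s * A m x i j := by
  simp [combine, Matrix.sum_apply]

lemma HasWeakPartial.sum {κ : Type*} (s : Finset κ) {u : κ → E3 → ℝ} {G : κ → Fin 3 → E3 → ℝ}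
    (h : ∀ m ∈ s, HasWeakPartial (u m) (G m)) :
    HasWeakPartial (fun x => ∑ m ∈ s, u m x) (fun k x => ∑ m ∈ s, G m k x) := by
  classical
  induction s using Finset.induction_on with
  | empty =>
    simp only [Finset.sum_empty]
    refine ⟨locallyIntegrable_zero.locallyIntegrableOn _,
      fun k => ⟨locallyIntegrable_zero.locallyIntegrableOn _, fun φ _ _ _ => by simp⟩⟩
  | insert a s ha ih =>
    simp only [Finset.sum_insert ha]
    exact (h a (by simp)).add (ih fun m hm => h m (by simp [hm]))

lemma exists_common_support (h : ∀ m, IsProfile (β m) (p m)) :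
    ∃ S, 0 < S ∧ ∀ m s, S ≤ s → β m s = 0 ∧ p m s = 0 := by
  choose S hS hS2 using fun m => (h m).tail
  refine ⟨1 + ∑ m, S m, by have := Finset.sum_nonneg fun m (_ : m ∈ Finset.univ) => (hS m).le
                           linarith, fun m s hs => hS2 m s ?_⟩
  have := Finset.single_le_sum (fun m _ => (hS m).le) (Finset.mem_univ m)
  linarith

/-- Compactness of the closed annulus `1 ≤ |x| ≤ R`, which avoids the origin. -/
lemma exists_bound_annulus {B : ι → E3 → Mat3}
    (hB : ∀ m i j, ContinuousOn (fun x => B m x i j) {0}ᶜ) (R : ℝ) :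
    ∃ K, 0 ≤ K ∧ ∀ m x, 1 ≤ ‖x‖ → ‖x‖ ≤ R → ∀ i j, |B m x i j| ≤ K := by
  have hc : IsCompact (Metric.closedBall (0 : E3) R ∩ {x | 1 ≤ ‖x‖}) :=
    (isCompact_closedBall _ _).inter_right (isClosed_le continuous_const continuous_norm)
  have : ∀ m i j, ∃ K : ℝ, ∀ x ∈ Metric.closedBall (0 : E3) R ∩ {x | 1 ≤ ‖x‖}, |B m x i j| ≤ K := by
    intro m i j
    refine hc.exists_bound_of_continuousOn ((hB m i j).mono fun x hx => ?_)
    rintro rfl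
    have : (1 : ℝ) ≤ ‖(0 : E3)‖ := hx.2
    simp at this
    linarith
  choose K hK using this
  refine ⟨∑ m, ∑ i, ∑ j, |K m i j|, by positivity, fun m x h1 h2 i j => ?_⟩
  refine (hK m i j x ⟨by simpa using h2, h1⟩).trans ((le_abs_self _).trans ?_)
  refine le_trans ?_ (Finset.single_le_sum (f := fun m => ∑ i, ∑ j, |K m i j|)
      (fun m _ => by positivity) (Finset.mem_univ m))
  refine le_trans ?_ (Finset.single_le_sum (f := fun i => ∑ j, |K m i j|)
      (fun i _ => by positivity) (Finset.mem_univ i))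
  exact Finset.single_le_sum (f := fun j => |K m i j|) (fun j _ => by positivity)
      (Finset.mem_univ j)

lemma measurable_entry {B : E3 → ℝ} (hB : ContinuousOn B {0}ᶜ) : Measurable B :=
  measurable_of_continuousOn_compl_singleton 0 hB

lemma IsLayer.measurable_combine (h : IsLayer A β p) {q : ι → ℝ → ℝ} (hq : ∀ m, Measurable (q m))
    (η : ℝ) (i j : Fin 3) : Measurable fun x : E3 => combine A q x ((‖x‖ - 1) / η) i j := by
  simp only [combine_apply]
  have := fun m => measurable_entry (h.continuousOn m i j)
  fun_prop

lemma IsLayer.measurable_layerMap (h : IsLayer A β p) (η : ℝ) (i j : Fin 3) :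
    Measurable fun x => layerMap A β η x i j := by
  simp only [layerMap, Matrix.add_apply]
  exact (h.measurable_combine (fun m => (h.profile m).continuous.measurable) η i j).const_add _

lemma IsLayer.measurable_layerGrad (h : IsLayer A β p) (η : ℝ) (k i j : Fin 3) :
    Measurable fun x => layerGrad A β p η k x i j := by
  simp only [layerGrad, Matrix.add_apply, Matrix.smul_apply, smul_eq_mul]
  have h1 := h.measurable_combine (fun m => (h.profile m).meas) η i j
  have h2 : Measurable fun x : E3 =>
      combine (fun m => partialMat k (A m)) β x ((‖x‖ - 1) / η) i j := by
    simp only [combine_apply]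
    have h3 := fun m => measurable_entry (h.continuousOn_partial k m i j)
    have h4 := fun m => (h.profile m).continuous.measurable
    fun_prop
  fun_prop

/-- Each term is an absolutely continuous function of `|x|` times a field smooth off the origin, and
the radial derivative has bounded support in `(1, 1 + Sη]`. -/
lemma IsLayer.hasWeakGradient (h : IsLayer A β p) {η : ℝ} (hη : 0 < η) :
    HasWeakGradient (layerMap A β η) (layerGrad A β p η) := by
  obtain ⟨S, hS, hS2⟩ := exists_common_support h.profile
  intro i j
  change HasWeakPartial (fun x => layerMap A β η x i j) (fun k x => layerGrad A β p η k x i j)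
  have hconst : HasWeakPartial (fun _ : E3 => Qinf i j) (fun _ _ => 0) := by
    have := hasWeakPartial_radial_mul (v := fun _ => Qinf i j) (p := fun _ => 0) (A := fun _ => 1)
      (integrable_zero _ _ _) continuous_const (fun r _ => by simp) ⟨1, fun _ _ => rfl⟩ contDiffOn_const
    simpa using this
  have hterm : ∀ m, HasWeakPartial (fun x => β m ((‖x‖ - 1) / η) * A m x i j)
      (fun k x => β m ((‖x‖ - 1) / η) * fderiv ℝ (fun y => A m y i j) x (basisVec k) +
        p m ((‖x‖ - 1) / η) / η * (x k / ‖x‖) * A m x i j) := by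
    intro m
    refine hasWeakPartial_radial_mul (v := fun r => β m ((r - 1) / η))
      (p := fun r => p m ((r - 1) / η) / η) (A := fun x => A m x i j) ?_ ?_ ?_ ?_ (h.smooth m i j)
    · exact (((h.profile m).integrable.comp_div hη.ne').comp_sub_right 1).div_const η
    · exact (h.profile m).continuous.comp (by fun_prop)
    · intro r _
      rw [(h.profile m).prim, (h.profile m).prim ((1 - 1) / η)]
      simp only [intervalIntegral.integral_div]
      have e3 : ∫ t in (1 : ℝ)..r, p m ((t - 1) / η) = η * ∫ t in (0 : ℝ)..((r - 1) / η), p m t := by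
        have e4 := intervalIntegral.integral_comp_div (a := 0) (b := r - 1) (p m) hη.ne'
        have e5 := intervalIntegral.integral_comp_sub_right (a := 1) (b := r) (fun t => p m (t / η)) 1
        rw [e5, sub_self, e4]
        simp
      rw [e3]
      field_simp
      simp
    · refine ⟨1 + S * η, fun r hr => ?_⟩
      rw [mem_Ioc, not_and_or, not_lt, not_le] at hr
      rcases hr with hr | hr
      · rw [(h.profile m).neg _ (div_nonpos_of_nonpos_of_nonneg (by linarith) hη.le), zero_div]
      · rw [(hS2 m _ ((le_div_iff₀ hη).2 (by linarith))).2, zero_div]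
  have := hconst.add (HasWeakPartial.sum Finset.univ fun m _ => hterm m)
  convert this using 1
  · ext x
    simp [layerMap, combine_apply]
  · ext k x
    simp only [layerGrad, Matrix.add_apply, Matrix.smul_apply, combine_apply, zero_add,
      Finset.sum_add_distrib, smul_eq_mul, Finset.mul_sum, partialMat, Matrix.of_apply]
    congr 1
    refine Finset.sum_congr rfl fun m _ => ?_
    ring

lemma memLp_of_support {u : E3 → ℝ} (hu : Measurable u) {w : ℝ → ℝ} (hw : MemLp w 2 volume) {R : ℝ}
    (hR : ∀ x ∈ Ω, R < ‖x‖ → u x = 0) (h : ∀ x ∈ Ω, ‖x‖ ≤ R → |u x| ≤ |w ‖x‖|) :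
    MemLp u 2 (volume.restrict Ω) := by
  rw [memLp_two_iff_integrable_sq hu.aestronglyMeasurable]
  refine (integrable_radial hw.integrable_sq R).restrict.mono'
    (hu.pow_const 2).aestronglyMeasurable ?_
  filter_upwards [ae_restrict_mem measurableSet_Ω] with x hx
  by_cases hxR : ‖x‖ ≤ R
  · rw [indicator_of_mem (mem_Ioc.2 ⟨hx, hxR⟩), Real.norm_eq_abs, abs_of_nonneg (sq_nonneg _)]
    exact sq_le_sq.2 (h x hx hxR)
  · rw [hR x hx (not_le.1 hxR), indicator_of_notMem fun h => hxR h.2]; simp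

lemma sq_div_scale_memLp {q : ℝ → ℝ} (hq : MemLp q 2 volume) {η : ℝ} (hη : 0 < η) :
    MemLp (fun r => q ((r - 1) / η)) 2 volume := by
  have hm : AEStronglyMeasurable (fun r => q ((r - 1) / η)) volume := by
    have hq2 : Measure.QuasiMeasurePreserving (fun r : ℝ => (r - 1) / η) volume volume := by
      have h1 : Measure.QuasiMeasurePreserving (fun r : ℝ => r / η) volume volume := by
        refine ⟨by fun_prop, ?_⟩
        have : (fun r : ℝ => r / η) = fun r => r * η⁻¹ := by ext; rw [div_eq_mul_inv]
        rw [this, Real.map_volume_mul_right (inv_ne_zero hη.ne')]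
        exact Measure.smul_absolutelyContinuous
      exact h1.comp (measurePreserving_sub_right volume 1).quasiMeasurePreserving
    exact hq.1.comp_quasiMeasurePreserving hq2
  rw [memLp_two_iff_integrable_sq hm]
  exact (hq.integrable_sq.comp_div hη.ne').comp_sub_right 1

lemma IsLayer.mem_H1Ω (h : IsLayer A β p) {η : ℝ} (hη : 0 < η)
    (hS0 : ∀ x ∈ Ω, layerMap A β η x ∈ S0) : layerMap A β η ∈ H1Ω := by
  obtain ⟨S, hS, hS2⟩ := exists_common_support h.profile
  set R := 1 + S * η with hR
  have hfar : ∀ x : E3, R < ‖x‖ → S ≤ (‖x‖ - 1) / η := fun x hx =>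
    (le_div_iff₀ hη).2 (by linarith)
  obtain ⟨K, hK0, hK⟩ := exists_bound_annulus h.continuousOn R
  have hK' : ∀ k, ∃ K, 0 ≤ K ∧ ∀ m x, 1 ≤ ‖x‖ → ‖x‖ ≤ R → ∀ i j, |partialMat k (A m) x i j| ≤ K :=
    fun k => exists_bound_annulus (h.continuousOn_partial k) R
  -- A profile is constant, possibly nonzero, on negative times, hence need not be in `L²(ℝ)`. Only
  -- positive times correspond to points of `Ω`.
  have hβ : ∀ m, MemLp ((Ioi 0).indicator (β m)) 2 volume := by
    intro m
    obtain ⟨M, hM⟩ := (h.profile m).bounded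
    have h1 : MemLp ((Ioc 0 S).indicator fun _ => M) 2 (volume : Measure ℝ) :=
      memLp_indicator_const 2 measurableSet_Ioc M (Or.inr measure_Ioc_lt_top.ne)
    refine h1.mono ((h.profile m).continuous.measurable.indicator
      measurableSet_Ioi).aestronglyMeasurable (Eventually.of_forall fun s => ?_)
    by_cases hs : s ∈ Ioc 0 S
    · rw [indicator_of_mem hs, indicator_of_mem (mem_Ioi.2 hs.1)]
      exact (hM s).trans (le_abs_self M)
    · rw [indicator_of_notMem hs, norm_zero, norm_le_zero_iff]
      by_cases h0 : 0 < s
      · rw [indicator_of_mem (mem_Ioi.2 h0)]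
        exact (hS2 m s (le_of_not_ge fun h => hs ⟨h0, h⟩)).1
      · exact indicator_of_notMem h0 _
  have hmain : ∀ (q : ι → ℝ → ℝ) (B : ι → E3 → Mat3) (K : ℝ), 0 ≤ K →
      (∀ m, Measurable (q m)) → (∀ m, MemLp ((Ioi 0).indicator (q m)) 2 volume) → (∀ m s, S ≤ s → q m s = 0) →
      (∀ m i j, Measurable fun x => B m x i j) →
      (∀ m x, 1 ≤ ‖x‖ → ‖x‖ ≤ R → ∀ i j, |B m x i j| ≤ K) → ∀ i j,
      MemLp (fun x => combine B q x ((‖x‖ - 1) / η) i j) 2 (volume.restrict Ω) := by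
    intro q B K hK0 hqm hq hqS hBm hB i j
    simp only [combine_apply]
    refine memLp_finsetSum _ fun m _ => ?_
    refine memLp_of_support (R := R) (w := fun r => K * (Ioi 0).indicator (q m) ((r - 1) / η)) ?_
      ((sq_div_scale_memLp (hq m) hη).const_mul K) ?_ ?_
    · have := hqm m; have := hBm m i j
      fun_prop
    · intro x _ hx
      rw [hqS m _ (hfar x hx), zero_mul]
    · intro x hx hx2
      have hpos : 0 < (‖x‖ - 1) / η := div_pos (sub_pos.2 hx) hη
      rw [indicator_of_mem (mem_Ioi.2 hpos), abs_mul, abs_mul, mul_comm, abs_of_nonneg hK0]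
      exact mul_le_mul_of_nonneg_right (hB m x (le_of_lt hx) hx2 i j) (abs_nonneg _)
  refine ⟨hS0, fun i j => ?_, layerGrad A β p η, h.hasWeakGradient hη, fun k i j => ?_⟩
  · have := hmain β A K hK0 (fun m => (h.profile m).continuous.measurable) hβ
      (fun m s hs => (hS2 m s hs).1) (fun m i j => measurable_entry (h.continuousOn m i j)) hK i j
    simpa [layerMap] using this
  · obtain ⟨K', hK0', hKk⟩ := hK' k
    have h1 := hmain β (fun m => partialMat k (A m)) K' hK0'
      (fun m => (h.profile m).continuous.measurable) hβ
      (fun m s hs => (hS2 m s hs).1)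
      (fun m i j => measurable_entry (h.continuousOn_partial k m i j)) hKk i j
    have h2 := hmain p A K hK0 (fun m => (h.profile m).meas) 
      (fun m => (h.profile m).memLp.indicator measurableSet_Ioi)
      (fun m s hs => (hS2 m s hs).2) (fun m i j => measurable_entry (h.continuousOn m i j)) hK i j
    refine h1.add (h2.of_le_mul (c := 1 / η) ?_ (Eventually.of_forall fun x => ?_))
    · have h3 := h.measurable_combine (fun m => (h.profile m).meas) η i j
      simp only [Matrix.smul_apply, smul_eq_mul]
      exact Measurable.aestronglyMeasurable (by fun_prop)
    · simp only [Matrix.smul_apply, smul_eq_mul, norm_mul]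
      refine mul_le_mul_of_nonneg_right ?_ (norm_nonneg _)
      rw [Real.norm_eq_abs, abs_div, abs_of_pos hη]
      exact div_le_div_of_nonneg_right (abs_div_norm_le x k) hη.le

end

/-! ### Trace and energy of a boundary layer map -/

section

variable {ι : Type} {A : ι → E3 → Mat3} {β p : ι → ℝ → ℝ} [Fintype ι]

lemma normSq_combine_le {B : ι → E3 → Mat3} {q : ι → ℝ → ℝ} {K : ℝ} {x : E3}
    (hB : ∀ m i j, |B m x i j| ≤ K) (s : ℝ) :
    normSq (combine B q x s) ≤ 9 * K ^ 2 * Fintype.card ι * ∑ m, q m s ^ 2 :=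
  normSq_sum_le Finset.univ (fun m => q m s) (fun m => B m x) fun m _ => hB m

lemma volume_shell_le {δ : ℝ} (h0 : 0 < δ) (h1 : δ ≤ 1) :
    volume {x : E3 | 1 < ‖x‖ ∧ ‖x‖ < 1 + δ} ≤
      ENNReal.ofReal (7 * δ) * volume (Metric.ball (0 : E3) 1) := by
  have e : {x : E3 | 1 < ‖x‖ ∧ ‖x‖ < 1 + δ} = Metric.ball 0 (1 + δ) \ Metric.closedBall 0 1 := by
    ext x; simp [and_comm]
  -- For `0 < δ ≤ 1`, `(1 + δ)³ - 1 = 3δ + 3δ² + δ³ ≤ 7δ`.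
  have hle : ENNReal.ofReal ((1 + δ) ^ 3) ≤ ENNReal.ofReal (7 * δ) + 1 := by
    rw [← ENNReal.ofReal_one, ← ENNReal.ofReal_add (by positivity) zero_le_one]
    refine ENNReal.ofReal_le_ofReal ?_
    nlinarith [mul_nonneg h0.le (sub_nonneg.2 h1), mul_nonneg (mul_nonneg h0.le h0.le) (sub_nonneg.2 h1)]
  rw [e, measure_sdiff ((Metric.closedBall_subset_ball (by linarith)))
    measurableSet_closedBall.nullMeasurableSet measure_closedBall_lt_top.ne,
    Measure.addHaar_closedBall _ _ zero_le_one, Measure.addHaar_ball _ _ (by positivity), finrank_E3,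
    tsub_le_iff_right, one_pow, ENNReal.ofReal_one, one_mul]
  exact (mul_le_mul_left hle _).trans (le_of_eq (by rw [add_mul, one_mul]))

/-- The fields are bounded and the profiles continuous at `0`, so the map is uniformly close to
`Q_b` in thin shells; the volume of a shell is `O(δ)`, which compensates the factor `δ⁻¹`. -/
lemma IsLayer.hasTraceQb (h : IsLayer A β p) {η : ℝ} (hη : 0 < η)
    (h0 : ∀ x ∈ Ω, combine A β x 0 = Qb x - Qinf) : HasTraceQb (layerMap A β η) := by
  obtain ⟨K, hK0, hK⟩ := exists_bound_annulus h.continuousOn 2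
  set w : ℝ → ℝ := fun s => 9 * K ^ 2 * Fintype.card ι * ∑ m, (β m s - β m 0) ^ 2 with hw
  have hwc : Continuous w := by
    have := fun m => (h.profile m).continuous
    fun_prop
  have hw0 : w 0 = 0 := by simp [hw]
  set V : ℝ := (volume : Measure E3).real (Metric.ball 0 1) with hV
  have hV0 : 0 ≤ V := measureReal_nonneg
  have hVe : volume (Metric.ball (0 : E3) 1) = ENNReal.ofReal V :=
    (ofReal_measureReal measure_ball_lt_top.ne).symm
  rw [HasTraceQb, ENNReal.tendsto_nhds_zero]
  intro ε hε
  obtain ⟨ε', hε'0, hε'⟩ : ∃ ε' : ℝ, 0 < ε' ∧ ENNReal.ofReal (7 * V * ε') ≤ ε := by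
    rcases eq_or_ne ε ⊤ with rfl | htop
    · exact ⟨1, one_pos, le_top⟩
    · have hεr := ENNReal.toReal_pos hε.ne' htop
      refine ⟨ε.toReal / (7 * V + 1), by positivity, ?_⟩
      rw [ENNReal.ofReal_le_iff_le_toReal htop, ← mul_div_assoc, div_le_iff₀ (by positivity)]
      nlinarith
  have hev : ∀ᶠ s in 𝓝 (0 : ℝ), w s < ε' := by
    have := hwc.continuousAt (x := 0)
    rw [ContinuousAt, hw0] at this
    exact this.eventually_lt_const hε'0
  obtain ⟨s₀, hs₀, hs⟩ := Metric.eventually_nhds_iff.1 hev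
  have hmin : 0 < min 1 (s₀ * η) := lt_min one_pos (by positivity)
  filter_upwards [Ioo_mem_nhdsGT hmin] with δ hδ
  have hδ1 : δ ≤ 1 := hδ.2.le.trans (min_le_left _ _)
  have hδ2 : δ < s₀ * η := hδ.2.trans_le (min_le_right _ _)
  have hms : MeasurableSet {x : E3 | 1 < ‖x‖ ∧ ‖x‖ < 1 + δ} :=
    (measurableSet_lt measurable_const measurable_norm).inter
      (measurableSet_lt measurable_norm measurable_const)
  have hpt : ∀ x ∈ {x : E3 | 1 < ‖x‖ ∧ ‖x‖ < 1 + δ},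
      ENNReal.ofReal (normSq (layerMap A β η x - Qb x)) ≤ ENNReal.ofReal ε' := by
    intro x hx
    refine ENNReal.ofReal_le_ofReal ?_
    set s := (‖x‖ - 1) / η with hsdef
    have e : layerMap A β η x - Qb x = combine A (fun m s => β m s - β m 0) x s := by
      have h1 : combine A (fun m s => β m s - β m 0) x s = combine A β x s - combine A β x 0 := by
        simp [combine, sub_smul]
      rw [h1, h0 x hx.1, layerMap]
      abel
    rw [e]
    refine (normSq_combine_le (hK · x hx.1.le (by linarith [hx.2])) s).trans (le_of_lt ?_)
    refine hs ?_
    have hs1 : 0 < s := div_pos (sub_pos.2 hx.1) hη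
    rw [Real.dist_eq, sub_zero, abs_of_pos hs1, hsdef, div_lt_iff₀ hη]
    linarith [hx.2]
  calc ENNReal.ofReal δ⁻¹ * ∫⁻ x in {x : E3 | 1 < ‖x‖ ∧ ‖x‖ < 1 + δ},
        ENNReal.ofReal (normSq (layerMap A β η x - Qb x))
      ≤ ENNReal.ofReal δ⁻¹ * (ENNReal.ofReal ε' * (ENNReal.ofReal (7 * δ) * ENNReal.ofReal V)) := by
        refine mul_le_mul_right ((setLIntegral_mono' hms hpt).trans ?_) _
        rw [setLIntegral_const, ← hVe]
        exact mul_le_mul_right (volume_shell_le hδ.1 hδ1) _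
    _ = ENNReal.ofReal (7 * V * ε') := by
        have h1 := hδ.1
        rw [← ENNReal.ofReal_mul (by positivity), ← ENNReal.ofReal_mul (by positivity),
          ← ENNReal.ofReal_mul (by positivity)]
        congr 1
        field_simp
    _ ≤ ε := hε'

/-- The energy density of the boundary layer map in terms of the one-dimensional density. -/
lemma IsLayer.energy_density_le (h : IsLayer A β p) (l : ℝ) {ξ η Ct Cf s : ℝ} (hη : 0 < η)
    (hs : 0 ≤ s) {n : E3} (hn : ‖n‖ = 1)
    (hCt : ∑ k, normSq (combine (fun m => partialMat k (A m)) β ((1 + η * s) • n) s) ≤ Ct)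
    (hCf : |f (Qinf + combine A β n s)| ≤ Cf) :
    η ^ 2 * (1 / 2 * (∑ k, normSq (layerGrad A β p η k ((1 + η * s) • n))) +
      1 / ξ ^ 2 * f (layerMap A β η ((1 + η * s) • n)) +
      1 / η ^ 2 * g (layerMap A β η ((1 + η * s) • n))) ≤
    density l (Qinf + combine A β n s) (combine A p n s) +
      (η / 2 * normSq (combine A p n s) + ((η ^ 2 + η) / 2 * Ct + |(η / ξ) ^ 2 - l ^ 2| * Cf)) := by
  have hr : 0 < 1 + η * s := by positivity
  set x := (1 + η * s) • n with hx
  have hxn : ‖x‖ = 1 + η * s := by rw [hx, norm_smul, hn, Real.norm_eq_abs, abs_of_pos hr, mul_one]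
  have hsx : (‖x‖ - 1) / η = s := by rw [hxn]; field_simp; ring
  have hcomb : ∀ q : ι → ℝ → ℝ, combine A q x s = combine A q n s := fun q => by
    simp only [combine, hx, h.homog _ _ hr]
  have hxk : ∀ k, x k / ‖x‖ = n k := fun k => by
    rw [hxn, hx, PiLp.smul_apply, smul_eq_mul]; field_simp
  have hmap : layerMap A β η x = Qinf + combine A β n s := by rw [layerMap, hsx, hcomb]
  set N := normSq (combine A p n s)
  have hN : 0 ≤ N := normSq_nonneg _
  -- Young's inequality with weight `η`: after multiplication by `η²` the radial part keeps
  -- coefficient `1 + η`, and the tangential part gets `η² + η`, which tends to `0`.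
  have hgrad : ∀ k, normSq (layerGrad A β p η k x) ≤
      (1 + η) * ((n k / η) ^ 2 * N) + (1 + 1 / η) *
        normSq (combine (fun m => partialMat k (A m)) β x s) := by
    intro k
    rw [layerGrad, hsx, hcomb, hxk, add_comm, ← normSq_smul]
    exact normSq_add_le hη _ _
  have hsum : ∑ k, normSq (layerGrad A β p η k x) ≤ (1 + η) / η ^ 2 * N + (1 + 1 / η) * Ct := by
    refine (Finset.sum_le_sum fun k _ => hgrad k).trans ?_
    rw [Finset.sum_add_distrib, ← Finset.mul_sum, ← Finset.mul_sum, ← Finset.sum_mul]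
    refine add_le_add (le_of_eq ?_) (mul_le_mul_of_nonneg_left hCt (by positivity))
    have : ∑ k, (n k / η) ^ 2 = 1 / η ^ 2 := by
      simp only [div_pow, ← Finset.sum_div]
      rw [Fin.sum_univ_three, ← norm_sq_eq, hn, one_pow]
    rw [this]; ring
  rw [hmap]
  set Q := Qinf + combine A β n s
  have h1 : η ^ 2 * (1 / 2 * (∑ k, normSq (layerGrad A β p η k x))) ≤
      1 / 2 * N + η / 2 * N + (η ^ 2 + η) / 2 * Ct := by
    calc _ ≤ η ^ 2 * (1 / 2 * ((1 + η) / η ^ 2 * N + (1 + 1 / η) * Ct)) := by gcongr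
      _ = _ := by field_simp
  have h2 : η ^ 2 * (1 / ξ ^ 2 * f Q) ≤ l ^ 2 * f Q + |(η / ξ) ^ 2 - l ^ 2| * Cf := by
    have : η ^ 2 * (1 / ξ ^ 2 * f Q) = l ^ 2 * f Q + ((η / ξ) ^ 2 - l ^ 2) * f Q := by ring
    rw [this]
    refine add_le_add le_rfl ((le_abs_self _).trans ?_)
    rw [abs_mul]
    exact mul_le_mul_of_nonneg_left hCf (abs_nonneg _)
  have h3 : η ^ 2 * (1 / η ^ 2 * g Q) = g Q := by field_simp
  unfold density
  rw [mul_add, mul_add, h3]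
  linarith

/-- The energy of the path in direction `n`. -/
def layerCost (A : ι → E3 → Mat3) (β p : ι → ℝ → ℝ) (l : ℝ) (n : E3) : ℝ≥0∞ :=
  cost l (combine A β n) (combine A p n)

lemma setLIntegral_Ioi_one_eq {η : ℝ} (hη : 0 < η) (F : ℝ → ℝ≥0∞) :
    ∫⁻ r in Ioi (1 : ℝ), F r = ∫⁻ s in Ioi (0 : ℝ), ENNReal.ofReal η * F (1 + η * s) := by
  have hinj : InjOn (fun s : ℝ => 1 + η * s) (Ioi 0) := fun a _ b _ hab => by
    have : η * a = η * b := by simpa using hab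
    exact mul_left_cancel₀ hη.ne' this
  have himg : (fun s : ℝ => 1 + η * s) '' Ioi 0 = Ioi 1 := by
    ext r
    simp only [mem_image, mem_Ioi]
    constructor
    · rintro ⟨s, hs, rfl⟩; have := mul_pos hη hs; linarith
    · intro hr
      exact ⟨(r - 1) / η, div_pos (by linarith) hη, by field_simp; ring⟩
  have := lintegral_image_eq_lintegral_abs_deriv_mul (f := fun s : ℝ => 1 + η * s)
    (f' := fun _ => η) measurableSet_Ioi (fun s _ =>
      (((hasDerivAt_id s).const_mul η).const_add 1).hasDerivWithinAt.congr_deriv (by simp)) hinj F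
  rw [himg] at this
  simpa [abs_of_pos hη] using this

/-- The energy of the boundary layer map is at most the integral of the one-dimensional energies,
up to errors that vanish with `η` and `(η / ξ) ^ 2 - l ^ 2`. -/
lemma IsLayer.exists_energy_le (h : IsLayer A β p) (l : ℝ) :
    ∃ S C : ℝ, 0 < S ∧ 0 ≤ C ∧ ∀ ξ η : ℝ, 0 < η → η * S ≤ 1 →
      ENNReal.ofReal η * energy ξ η (layerMap A β η) ≤
        ENNReal.ofReal ((1 + η * S) ^ 2) *
          ((∫⁻ n : Metric.sphere (0 : E3) 1, layerCost A β p l n ∂(volume : Measure E3).toSphere) +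
            ENNReal.ofReal (C * (η + η ^ 2 + |(η / ξ) ^ 2 - l ^ 2|)) *
              (volume : Measure E3).toSphere univ) := by
  obtain ⟨S, hS, hS2⟩ := exists_common_support h.profile
  obtain ⟨K, hK0, hK⟩ := exists_bound_annulus h.continuousOn 2
  have hKt := fun k => exists_bound_annulus (h.continuousOn_partial k) 2
  choose Kt hKt0 hKt using hKt
  have hM := fun m => (h.profile m).bounded
  choose M hM using hM
  have hβ2 : ∀ s, ∑ m, β m s ^ 2 ≤ ∑ m, M m ^ 2 := fun s => Finset.sum_le_sum fun m _ =>
    sq_le_sq' (abs_le.1 (hM m s)).1 (abs_le.1 (hM m s)).2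
  set c : ℝ := ((Fintype.card ι : ℕ) : ℝ) with hc
  have hc0 : 0 ≤ c := Nat.cast_nonneg _
  -- bounds on the tangential derivatives, on the potential and on the radial derivative
  set Ct : ℝ := ∑ k, 9 * Kt k ^ 2 * c * ∑ m, M m ^ 2 with hCt
  have hCt0 : 0 ≤ Ct := by positivity
  have hCt' : ∀ (x : E3) (s : ℝ), 1 ≤ ‖x‖ → ‖x‖ ≤ 2 →
      ∑ k, normSq (combine (fun m => partialMat k (A m)) β x s) ≤ Ct := by
    intro x s h1 h2
    refine Finset.sum_le_sum fun k _ => (normSq_combine_le (hKt k · x h1 h2) s).trans ?_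
    exact mul_le_mul_of_nonneg_left (hβ2 s) (by positivity)
  set B : ℝ := 9 * K ^ 2 * c * ∑ m, M m ^ 2 with hB
  have hB0 : 0 ≤ B := by positivity
  obtain ⟨Cf, hCf0, hCf⟩ := exists_abs_f_le (2 + (1 + B))
  have hCf' : ∀ (n : E3) (s : ℝ), ‖n‖ = 1 → |f (Qinf + combine A β n s)| ≤ Cf := by
    intro n s hn
    refine hCf _ fun i j => ?_
    have h1 := (sq_entry_le_normSq (combine A β n s) i j).trans
      ((normSq_combine_le (hK · n hn.ge (by rw [hn]; norm_num)) s).trans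
      (mul_le_mul_of_nonneg_left (hβ2 s) (by positivity)))
    refine (abs_add_le _ _).trans (add_le_add (abs_Qinf_le i j) ?_)
    refine abs_le_of_sq_le_sq ?_ (by positivity)
    nlinarith
  set P : ℝ := ∫ s, 9 * K ^ 2 * c * ∑ m, p m s ^ 2 with hP
  have hPi : Integrable fun s => 9 * K ^ 2 * c * ∑ m, p m s ^ 2 :=
    (integrable_finsetSum _ fun m _ => (h.profile m).memLp.integrable_sq).const_mul _
  have hP0 : 0 ≤ P := integral_nonneg fun s => by positivity
  refine ⟨S, P / 2 + S * (Ct + Cf), hS, by positivity, fun ξ η hη hηS => ?_⟩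
  set dens : E3 → ℝ := fun x => 1 / 2 * (∑ k, normSq (layerGrad A β p η k x)) +
      1 / ξ ^ 2 * f (layerMap A β η x) + 1 / η ^ 2 * g (layerMap A β η x) with hdens
  have hdm : Measurable dens := by
    have h1 := measurable_f (h.measurable_layerMap η)
    have h2 := measurable_g (h.measurable_layerMap η)
    have h3 := fun k => measurable_normSq (h.measurable_layerGrad η k)
    fun_prop
  set E : ℝ := (η ^ 2 + η) / 2 * Ct + |(η / ξ) ^ 2 - l ^ 2| * Cf with hE
  have hE0 : 0 ≤ E := by positivity
  have hen : energy ξ η (layerMap A β η) ≤ ∫⁻ x in Ω, ENNReal.ofReal (dens x) :=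
    iInf₂_le (layerGrad A β p η) (h.hasWeakGradient hη)
  -- the estimate along a ray
  have hpt : ∀ n : E3, ‖n‖ = 1 → ∀ s ∈ Ioi (0 : ℝ),
      ENNReal.ofReal η * (ENNReal.ofReal η * (ENNReal.ofReal ((1 + η * s) ^ 2) *
        ENNReal.ofReal (dens ((1 + η * s) • n)))) ≤
      ENNReal.ofReal ((1 + η * S) ^ 2) *
        (ENNReal.ofReal (density l (Qinf + combine A β n s) (combine A p n s)) +
        (ENNReal.ofReal (η / 2 * (9 * K ^ 2 * c * ∑ m, p m s ^ 2)) +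
          (Ioc 0 S).indicator (fun _ => ENNReal.ofReal E) s)) := by
    intro n hn s hs
    have hs0 : (0 : ℝ) < s := hs
    have hr : 0 < 1 + η * s := by positivity
    have hxn : ‖(1 + η * s) • n‖ = 1 + η * s := by
      rw [norm_smul, hn, Real.norm_eq_abs, abs_of_pos hr, mul_one]
    have hsx : (‖(1 + η * s) • n‖ - 1) / η = s := by rw [hxn]; field_simp; ring
    by_cases hsS : s ≤ S
    · rw [indicator_of_mem (mem_Ioc.2 ⟨hs0, hsS⟩)]
      have hηs : η * s ≤ η * S := by gcongr
      calc _ = ENNReal.ofReal ((1 + η * s) ^ 2) *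
            ENNReal.ofReal (η ^ 2 * dens ((1 + η * s) • n)) := by
            rw [ENNReal.ofReal_mul (p := η ^ 2) (by positivity), pow_two η, ENNReal.ofReal_mul hη.le]
            ring
        _ ≤ _ := by
            refine mul_le_mul' (ENNReal.ofReal_le_ofReal (by gcongr)) ?_
            refine (ENNReal.ofReal_le_ofReal (h.energy_density_le l hη hs0.le hn
              (hCt' _ s (by rw [hxn]; linarith [mul_pos hη hs0]) (by rw [hxn]; linarith))
              (hCf' n s hn))).trans ?_
            refine ENNReal.ofReal_add_le.trans (add_le_add le_rfl
              (ENNReal.ofReal_add_le.trans (add_le_add (ENNReal.ofReal_le_ofReal ?_) le_rfl)))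
            exact mul_le_mul_of_nonneg_left
              (normSq_combine_le (hK · n hn.ge (by rw [hn]; norm_num)) s) (by positivity)
    -- Beyond `S` the map equals `Q∞` and its gradient vanishes, so the density is `0`; the error
    -- terms are thus needed only for `s ≤ S`.
    · have hz : dens ((1 + η * s) • n) = 0 := by
        have hz1 : ∀ B : ι → E3 → Mat3, combine B β ((1 + η * s) • n) s = 0 := fun B =>
          Finset.sum_eq_zero fun m _ => by rw [(hS2 m s (not_le.1 hsS).le).1, zero_smul]
        have hz2 : combine A p ((1 + η * s) • n) s = 0 :=
          Finset.sum_eq_zero fun m _ => by rw [(hS2 m s (not_le.1 hsS).le).2, zero_smul]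
        simp only [hdens, layerMap, layerGrad, hsx, hz1, hz2, smul_zero, add_zero, normSq_zero,
          f_Qinf, g_Qinf, mul_zero, Finset.sum_const_zero]
      simp [hz]
  have hray : ∀ n : E3, ‖n‖ = 1 → ENNReal.ofReal η * ∫⁻ r in Ioi (1 : ℝ),
      ENNReal.ofReal (r ^ 2) * ENNReal.ofReal (dens (r • n)) ≤
      ENNReal.ofReal ((1 + η * S) ^ 2) * (layerCost A β p l n +
        ENNReal.ofReal ((P / 2 + S * (Ct + Cf)) * (η + η ^ 2 + |(η / ξ) ^ 2 - l ^ 2|))) := by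
    intro n hn
    have hpm := fun m => (h.profile m).meas
    rw [setLIntegral_Ioi_one_eq hη, ← lintegral_const_mul' _ _ ENNReal.ofReal_ne_top]
    refine (setLIntegral_mono' measurableSet_Ioi (hpt n hn)).trans ?_
    rw [lintegral_const_mul' _ _ ENNReal.ofReal_ne_top]
    refine mul_le_mul_right ?_ _
    have hm1 : Measurable fun s => ENNReal.ofReal (η / 2 * (9 * K ^ 2 * c * ∑ m, p m s ^ 2)) := by
      fun_prop
    have hm2 : Measurable ((Ioc 0 S).indicator fun _ : ℝ => ENNReal.ofReal E) :=
      measurable_const.indicator measurableSet_Ioc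
    have hm3 : Measurable fun s => ENNReal.ofReal (η / 2 * (9 * K ^ 2 * c * ∑ m, p m s ^ 2)) +
        (Ioc 0 S).indicator (fun _ : ℝ => ENNReal.ofReal E) s := hm1.add hm2
    rw [lintegral_add_right _ hm3]
    refine add_le_add le_rfl ?_
    rw [lintegral_add_left hm1, lintegral_indicator measurableSet_Ioc, setLIntegral_const,
      Measure.restrict_apply measurableSet_Ioc, inter_eq_left.2 Ioc_subset_Ioi_self, Real.volume_Ioc,
      sub_zero, ← ENNReal.ofReal_mul hE0]
    have h1 : ∫⁻ s in Ioi (0 : ℝ), ENNReal.ofReal (η / 2 * (9 * K ^ 2 * c * ∑ m, p m s ^ 2)) ≤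
        ENNReal.ofReal (η / 2 * P) := by
      refine (setLIntegral_le_lintegral _ _).trans (le_of_eq ?_)
      rw [← ofReal_integral_eq_lintegral_ofReal (hPi.const_mul _)
        (Eventually.of_forall fun s => by simp only [Pi.zero_apply]; positivity), integral_const_mul]
    refine (add_le_add h1 le_rfl).trans ?_
    rw [← ENNReal.ofReal_add (by positivity) (by positivity)]
    refine ENNReal.ofReal_le_ofReal ?_
    rw [hE]
    have ha := abs_nonneg ((η / ξ) ^ 2 - l ^ 2)
    set a := |(η / ξ) ^ 2 - l ^ 2|
    have : 0 ≤ P / 2 * (η ^ 2 + a) + S * (Ct * ((η ^ 2 + η) / 2 + a) + Cf * (η + η ^ 2)) := by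
      positivity
    linarith
  have hpol := lintegral_Ω_polar (h := fun x => ENNReal.ofReal (dens x)) (by fun_prop)
  rw [hpol] at hen
  refine (mul_le_mul_right hen _).trans ?_
  rw [← lintegral_const_mul' _ _ ENNReal.ofReal_ne_top]
  refine (lintegral_mono fun n : Metric.sphere (0 : E3) 1 => hray n (norm_eq_of_mem_sphere n)).trans ?_
  -- Only the constant summand has to be measurable; nothing is asked of the dependence of
  -- `layerCost` on the direction.
  rw [lintegral_const_mul' _ _ ENNReal.ofReal_ne_top, lintegral_add_right _ measurable_const, lintegral_const]

/-- The rescaled energies of the boundary layer maps are asymptotically at most the integral of the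
one-dimensional energies. -/
lemma IsLayer.limsup_energy_le (h : IsLayer A β p) (l : ℝ) {η : ℝ → ℝ} (hη : ∀ ξ, 0 < ξ → 0 < η ξ)
    (hl : Tendsto (fun ξ => η ξ / ξ) (𝓝[>] 0) (𝓝 l)) :
    limsup (fun ξ => ENNReal.ofReal (η ξ) * energy ξ (η ξ) (layerMap A β (η ξ))) (𝓝[>] 0) ≤
      ∫⁻ n : Metric.sphere (0 : E3) 1, layerCost A β p l n ∂(volume : Measure E3).toSphere := by
  obtain ⟨S, C, hS, hC, hle⟩ := h.exists_energy_le l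
  set J := ∫⁻ n : Metric.sphere (0 : E3) 1, layerCost A β p l n ∂(volume : Measure E3).toSphere
  have hpos : ∀ᶠ ξ in 𝓝[>] (0 : ℝ), 0 < ξ := eventually_mem_nhdsWithin
  have hη0 : Tendsto η (𝓝[>] 0) (𝓝 0) := by
    have h1 : Tendsto (fun ξ : ℝ => η ξ / ξ * ξ) (𝓝[>] 0) (𝓝 (l * 0)) :=
      hl.mul (tendsto_id.mono_left nhdsWithin_le_nhds)
    rw [mul_zero] at h1
    refine h1.congr' ?_
    filter_upwards [hpos] with ξ hξ
    field_simp
  have hsmall : ∀ᶠ ξ in 𝓝[>] (0 : ℝ), η ξ * S ≤ 1 := by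
    have : Tendsto (fun ξ => η ξ * S) (𝓝[>] 0) (𝓝 (0 * S)) := hη0.mul_const S
    rw [zero_mul] at this
    exact (this.eventually_lt_const one_pos).mono fun _ => le_of_lt
  have hlim : Tendsto (fun ξ => ENNReal.ofReal ((1 + η ξ * S) ^ 2) *
      (J + ENNReal.ofReal (C * (η ξ + η ξ ^ 2 + |(η ξ / ξ) ^ 2 - l ^ 2|)) *
        (volume : Measure E3).toSphere univ)) (𝓝[>] 0) (𝓝 J) := by
    have h1 : Tendsto (fun ξ => ENNReal.ofReal ((1 + η ξ * S) ^ 2)) (𝓝[>] 0)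
        (𝓝 (ENNReal.ofReal ((1 + 0 * S) ^ 2))) :=
      ENNReal.tendsto_ofReal (((hη0.mul_const S).const_add 1).pow 2)
    have h2 : Tendsto (fun ξ => C * (η ξ + η ξ ^ 2 + |(η ξ / ξ) ^ 2 - l ^ 2|)) (𝓝[>] 0)
        (𝓝 (C * (0 + 0 ^ 2 + |l ^ 2 - l ^ 2|))) :=
      ((hη0.add (hη0.pow 2)).add ((hl.pow 2).sub_const _).abs).const_mul C
    have h3 := ENNReal.Tendsto.mul_const (b := (volume : Measure E3).toSphere univ)
      (ENNReal.tendsto_ofReal h2) (Or.inr (measure_lt_top _ _).ne)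
    have h4 := ENNReal.Tendsto.mul h1 (Or.inl (by simp)) (h3.const_add J) (Or.inr (by simp))
    simpa using h4
  rw [← hlim.limsup_eq]
  refine limsup_le_limsup ?_
  filter_upwards [hpos, hsmall] with ξ hξ hξ2
  exact hle ξ (η ξ) (hη ξ hξ) hξ2

end

/-! ### Circles of latitude are null sets -/

/-- All level sets of `G` are translates of one another. If one had positive measure, uncountably
many disjoint sets would, which is impossible for a σ-finite measure. -/
lemma volume_level_eq_zero {G : E3 → ℝ} (hG : Measurable G) {v : E3}
    (hv : ∀ (t : ℝ) x, G (x + t • v) = G x + t) (c : ℝ) : volume {x | G x = c} = 0 := by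
  by_contra hne
  have hall : ∀ t : ℝ, 0 < volume {x | G x = t} := by
    intro t
    have e : (fun x => x + (c - t) • v) ⁻¹' {x | G x = c} = {x | G x = t} := by
      ext x
      simp only [mem_preimage, mem_ofPred_eq, hv]
      constructor <;> intro h <;> linarith
    rw [← e, measure_preimage_add_right]
    exact pos_iff_ne_zero.2 hne
  have hc := Measure.countable_meas_level_set_pos (μ := (volume : Measure E3)) hG
  rw [show {t : ℝ | 0 < volume {a | G a = t}} = univ from eq_univ_of_forall hall] at hc
  exact not_countable_univ hc

-- Surface measure is the volume of the cone over the set, up to a factor. For `c² ≠ 1` this cone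
-- lies in the graph `x₂ = κ √(x₀² + x₁²)`; for `c² = 1` it lies on the axis, hence in the plane `x₀
-- = 0`.
open scoped Pointwise in
lemma toSphere_latitude_eq_zero (c : ℝ) :
    (volume : Measure E3).toSphere {n | (n : E3) 2 = c} = 0 := by
  have hms : MeasurableSet {n : Metric.sphere (0 : E3) 1 | (n : E3) 2 = c} :=
    measurableSet_eq_fun (by fun_prop) measurable_const
  rw [Measure.toSphere_apply' _ hms]
  refine mul_eq_zero.2 (Or.inr ?_)
  have hsub : ∀ x ∈ Ioo (0 : ℝ) 1 • (Subtype.val '' {n : Metric.sphere (0 : E3) 1 | (n : E3) 2 = c}),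
      x 2 = c * ‖x‖ := by
    rintro x hx
    obtain ⟨r, hr, _, ⟨n, hn, rfl⟩, rfl⟩ := Set.mem_smul.1 hx
    have hn' : (n : E3) 2 = c := hn
    rw [norm_smul, norm_eq_of_mem_sphere n, Real.norm_eq_abs, abs_of_pos hr.1]
    simp [hn']; ring
  rcases eq_or_ne (1 - c ^ 2) 0 with h1 | h1
  · refine measure_mono_null (t := {x : E3 | x 0 = 0}) (fun x hx => ?_)
      (volume_level_eq_zero (v := basisVec 0) (by fun_prop) (fun t x => by simp) 0)
    have h2 := hsub x hx
    have h3 := norm_sq_eq x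
    have h4 : x 2 ^ 2 = ‖x‖ ^ 2 := by rw [h2, mul_pow, show c ^ 2 = 1 by linarith, one_mul]
    have : x 0 ^ 2 = 0 := by nlinarith [sq_nonneg (x 0), sq_nonneg (x 1)]
    exact pow_eq_zero_iff (two_ne_zero) |>.1 this
  · set κ := c / √(1 - c ^ 2) with hκ
    refine measure_mono_null (t := {x : E3 | x 2 - κ * √(x 0 ^ 2 + x 1 ^ 2) = 0}) (fun x hx => ?_)
      (volume_level_eq_zero (v := basisVec 2) (by fun_prop) (fun t x => by simp; ring) 0)
    have h2 := hsub x hx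
    have h3 := norm_sq_eq x
    have h5 : x 0 ^ 2 + x 1 ^ 2 = (1 - c ^ 2) * ‖x‖ ^ 2 := by
      have : x 2 ^ 2 = c ^ 2 * ‖x‖ ^ 2 := by rw [h2, mul_pow]
      linarith
    rcases eq_or_ne x 0 with hx0 | hx0
    · simp [hx0]
    · have hpos : 0 < ‖x‖ := norm_pos_iff.2 hx0
      have h6 : 0 < 1 - c ^ 2 := by
        refine lt_of_le_of_ne ?_ (Ne.symm h1)
        have : 0 ≤ (1 - c ^ 2) * ‖x‖ ^ 2 := by rw [← h5]; positivity
        exact nonneg_of_mul_nonneg_left this (by positivity)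
      have h7 : √(1 - c ^ 2) ≠ 0 := (Real.sqrt_pos.2 h6).ne'
      rw [mem_ofPred_eq, h5, Real.sqrt_mul h6.le, Real.sqrt_sq hpos.le, h2, hκ]
      field_simp
      ring

/-! ### Latitude bands and their transition regions -/

/-- The centre of the `j`-th of `N` intervals of equal length that fill `[-1, 1]`. -/
def latCenter (N : ℕ) (j : Fin N) : ℝ := -1 + (2 * (j : ℝ) + 1) / N

/-- The directions that are not well inside one of the `N` latitude bands. -/
def badSet (N : ℕ) (κ : ℝ) : Set (Metric.sphere (0 : E3) 1) :=
  {n | ∀ j : Fin N, 1 / (N : ℝ) - κ < |(n : E3) 2 - latCenter N j|}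

lemma measurableSet_badSet (N : ℕ) (κ : ℝ) : MeasurableSet (badSet N κ) := by
  rw [badSet, ofPred_forall]
  refine MeasurableSet.iInter fun j => measurableSet_lt measurable_const ?_
  have : Measurable fun n : Metric.sphere (0 : E3) 1 => (n : E3) 2 := by fun_prop
  fun_prop

/-- The band is found by taking the integer part of `(z + 1)N/2`. Excluding the latitudes `-1 +
2k/N` and `1` makes the inequality strict. -/
lemma exists_mem_band {N : ℕ} (hN : 0 < N) {z : ℝ} (hz : |z| ≤ 1)
    (hg : ∀ k : ℕ, z ≠ -1 + 2 * (k : ℝ) / N) (hz1 : z ≠ 1) :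
    ∃ j : Fin N, |z - latCenter N j| < 1 / (N : ℝ) := by
  have hN' : (0 : ℝ) < N := by exact_mod_cast hN
  rw [abs_le] at hz
  have hz2 : z < 1 := lt_of_le_of_ne hz.2 hz1
  set y := (z + 1) * N / 2 with hy
  have hy0 : 0 ≤ y := by have := hz.1; have : 0 ≤ z + 1 := by linarith
                         positivity
  have hyN : y < N := by rw [hy]; nlinarith
  have hzy : z = -1 + 2 * y / N := by rw [hy]; field_simp; ring
  have hfl := Nat.floor_le hy0
  have hlt := Nat.lt_floor_add_one y
  have hne : (⌊y⌋₊ : ℝ) ≠ y := fun h => hg ⌊y⌋₊ (by rw [h]; exact hzy)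
  refine ⟨⟨⌊y⌋₊, (Nat.floor_lt hy0).2 hyN⟩, ?_⟩
  have e : z - latCenter N ⟨⌊y⌋₊, (Nat.floor_lt hy0).2 hyN⟩ = (2 * (y - ⌊y⌋₊) - 1) / N := by
    rw [latCenter, hzy]; field_simp; ring
  rw [e, abs_div, abs_of_pos hN']
  refine div_lt_div_of_pos_right ?_ hN'
  rw [abs_lt]
  have : (⌊y⌋₊ : ℝ) < y := lt_of_le_of_ne hfl hne
  constructor <;> linarith

/-- As `κ` decreases to `0` the bad sets decrease to a subset of countably many circles of latitude,
which is null; continuity of the finite surface measure from above gives the claim. -/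
lemma exists_badSet_le {N : ℕ} (hN : 0 < N) {ε : ℝ≥0∞} (hε : 0 < ε) :
    ∃ κ, 0 < κ ∧ 2 * κ < 1 / (N : ℝ) ∧ (volume : Measure E3).toSphere (badSet N (2 * κ)) < ε := by
  have hN' : (0 : ℝ) < N := by exact_mod_cast hN
  set μ := (volume : Measure E3).toSphere
  -- The shift by `3` ensures `2 u k < 1/N` already for `k = 0`.
  set u : ℕ → ℝ := fun k => 1 / (N : ℝ) / (k + 3) with hu
  have hu0 : ∀ k, 0 < u k := fun k => by positivity
  have hanti : Antitone fun k => badSet N (2 * u k) := by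
    intro a b hab n hn j
    refine lt_of_le_of_lt ?_ (hn j)
    have : u b ≤ u a := by simp only [hu]; gcongr
    linarith
  have hlim := tendsto_measure_iInter_atTop (μ := μ) (s := fun k => badSet N (2 * u k))
    (fun k => (measurableSet_badSet _ _).nullMeasurableSet) hanti ⟨0, (measure_lt_top _ _).ne⟩
  have hnull : μ (⋂ k, badSet N (2 * u k)) = 0 := by
    refine measure_mono_null (t := {n | (n : E3) 2 = 1} ∪
      ⋃ k : ℕ, {n | (n : E3) 2 = -1 + 2 * (k : ℝ) / N}) (fun n hn => ?_) ?_
    · by_contra hc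
      rw [mem_union, mem_iUnion, not_or, not_exists] at hc
      have hz : |(n : E3) 2| ≤ 1 := by
        have := abs_entry_le_norm (n : E3) 2
        rwa [norm_eq_of_mem_sphere n] at this
      obtain ⟨j, hj⟩ := exists_mem_band hN hz hc.2 hc.1
      have hu2 : Tendsto (fun k => 1 / (N : ℝ) - 2 * u k) atTop (𝓝 (1 / (N : ℝ) - 2 * 0)) := by
        refine tendsto_const_nhds.sub (Tendsto.const_mul 2 ?_)
        have h3 : Tendsto (fun k : ℕ => (k : ℝ) + 3) atTop atTop :=
          tendsto_atTop_add_const_right _ _ tendsto_natCast_atTop_atTop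
        exact h3.const_div_atTop _
      rw [mul_zero, sub_zero] at hu2
      have h4 := le_of_tendsto hu2 (Eventually.of_forall fun k =>
        (mem_iInter.1 hn k j).le)
      linarith
    · exact measure_union_null (toSphere_latitude_eq_zero _)
        (measure_iUnion_null fun k => toSphere_latitude_eq_zero _)
  rw [hnull] at hlim
  obtain ⟨k, hk⟩ := (hlim.eventually_lt_const hε).exists
  refine ⟨u k, hu0 k, ?_, hk⟩
  simp only [hu]
  rw [mul_div_assoc', div_lt_iff₀ (by positivity)]
  have : (0 : ℝ) < 1 / N := by positivity
  have : (0 : ℝ) ≤ k := by positivity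
  nlinarith

lemma latCenter_dist {N : ℕ} {i j : Fin N} (hij : i ≠ j) :
    2 / (N : ℝ) ≤ |latCenter N i - latCenter N j| := by
  have hN : (0 : ℝ) < N := by exact_mod_cast i.pos
  have e : latCenter N i - latCenter N j = 2 * ((i : ℝ) - j) / N := by
    rw [latCenter, latCenter]; field_simp; ring
  rw [e, abs_div, abs_of_pos hN, abs_mul, abs_two]
  refine div_le_div_of_nonneg_right ?_ hN.le
  have h1 : (1 : ℤ) ≤ |((i : ℕ) : ℤ) - ((j : ℕ) : ℤ)| := by
    refine Int.one_le_abs (sub_ne_zero.2 fun h => hij (Fin.ext (by exact_mod_cast h)))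
  have h2 : (1 : ℝ) ≤ |(i : ℝ) - j| := by exact_mod_cast h1
  linarith

lemma abs_latCenter_le {N : ℕ} (j : Fin N) : |latCenter N j| ≤ 1 - 1 / (N : ℝ) := by
  have hN : (0 : ℝ) < N := by exact_mod_cast j.pos
  have hj : (j : ℝ) + 1 ≤ N := by exact_mod_cast j.2
  have h1 : (2 * (j : ℝ) + 1) / N ≤ 2 - 1 / N := by
    rw [div_le_iff₀ hN]; field_simp; linarith
  have h2 : 1 / (N : ℝ) ≤ (2 * (j : ℝ) + 1) / N := by
    gcongr; have : (0 : ℝ) ≤ j := by positivity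
    linarith
  rw [abs_le, latCenter]
  constructor <;> linarith

/-! ### The axially symmetric boundary layer -/

/-- The distance to the axis. -/
def rho (x : E3) : ℝ := √(x 0 ^ 2 + x 1 ^ 2)

/-- The rotation about `e₃` that takes the meridian of azimuth `(c, s)` to the meridian of `x`. -/
def turn (c s : ℝ) (x : E3) : Mat3 :=
  rotM ((x 0 * c + x 1 * s) / rho x) ((x 1 * c - x 0 * s) / rho x)

/-- The axially symmetric extension of `E` from the meridian `(c, s)`, with cutoff `ψ` in the
latitude. -/
def bandField (ψ : ℝ → ℝ) (c s : ℝ) (E : Mat3) (x : E3) : Mat3 :=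
  ψ (x 2 / ‖x‖) • (turn c s x * E * (turn c s x).transpose)

/-- The fields of the boundary layer: the boundary data, and one family for each band. -/
def layerField {N : ℕ} (ψ : Fin N → ℝ → ℝ) (c s : Fin N → ℝ) :
    Option (Fin N × Fin 3 × Fin 3) → E3 → Mat3
  | none => fun x => Qb x - Qinf
  | some m => bandField (ψ m.1) (c m.1) (s m.1) (Matrix.single m.2.1 m.2.2 1)

/-- The profiles of the boundary layer. -/
def layerProf {N : ℕ} (a : ℝ → ℝ) (b : Fin N → ℝ → Mat3) :
    Option (Fin N × Fin 3 × Fin 3) → ℝ → ℝ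
  | none => a
  | some m => fun t => b m.1 t m.2.1 m.2.2

/-- A band field is linear in the matrix it carries, so the nine elementary matrices with the
entries of `b j` as coefficients reassemble into the field of `b j t`. This fits matrix profiles
into the scalar-profile format of `IsLayer`. -/
lemma combine_layerField {N : ℕ} (ψ : Fin N → ℝ → ℝ) (c s : Fin N → ℝ) (a : ℝ → ℝ)
    (b : Fin N → ℝ → Mat3) (x : E3) (t : ℝ) :
    combine (layerField ψ c s) (layerProf a b) x t = a t • (Qb x - Qinf) +
      ∑ j, bandField (ψ j) (c j) (s j) (b j t) x := by
  rw [combine, Fintype.sum_option]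
  congr 1
  rw [Fintype.sum_prod_type]
  refine Finset.sum_congr rfl fun j _ => ?_
  rw [Fintype.sum_prod_type]
  conv_rhs => rw [Matrix.matrix_eq_sum_single (b j t)]
  simp only [bandField, layerField, layerProf, Matrix.mul_sum, Matrix.sum_mul, Finset.smul_sum]
  refine Finset.sum_congr rfl fun k _ => Finset.sum_congr rfl fun m _ => ?_
  have : Matrix.single k m (b j t k m) = b j t k m • Matrix.single k m (1 : ℝ) := by
    rw [Matrix.smul_single, smul_eq_mul, mul_one]
  rw [this, Matrix.mul_smul, Matrix.smul_mul, smul_comm]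

/-- The entries are affine in `(c, s)`, so smoothness of `turn` reduces to that of its two scalar
coefficients. -/
lemma rotM_decomp (c s : ℝ) (i j : Fin 3) :
    rotM c s i j = c * (rotM 1 0 i j - rotM 0 0 i j) + s * (rotM 0 1 i j - rotM 0 0 i j) +
      rotM 0 0 i j := by
  fin_cases i <;> fin_cases j <;> simp [rotM]

lemma mul_single_mul_transpose (B : Mat3) (a b i j : Fin 3) :
    (B * Matrix.single a b (1 : ℝ) * B.transpose : Mat3) i j = B i a * B j b := by
  rw [Matrix.mul_apply, Finset.sum_eq_single b]
  · rw [Matrix.mul_single_apply_same, mul_one, Matrix.transpose_apply]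
  · intro k _ hk
    rw [Matrix.mul_single_apply_of_ne _ _ _ _ _ hk, zero_mul]
  · simp

lemma rho_sq (x : E3) : rho x ^ 2 = x 0 ^ 2 + x 1 ^ 2 := Real.sq_sqrt (by positivity)

lemma norm_sq_eq_rho (x : E3) : ‖x‖ ^ 2 = rho x ^ 2 + x 2 ^ 2 := by rw [rho_sq, norm_sq_eq]

lemma abs_latitude_of_rho_eq_zero {x : E3} (hx : x ≠ 0) (h : rho x = 0) : |x 2 / ‖x‖| = 1 := by
  have h1 := norm_sq_eq_rho x
  have hpos := norm_pos_iff.2 hx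
  rw [h, zero_pow two_ne_zero, zero_add, sq_eq_sq_iff_abs_eq_abs, abs_norm] at h1
  rw [abs_div, abs_norm, ← h1, div_self hpos.ne']

lemma contDiffAt_coord (x : E3) (i : Fin 3) : ContDiffAt ℝ ∞ (fun y : E3 => y i) x :=
  (EuclideanSpace.proj (𝕜 := ℝ) i).contDiff.contDiffAt

lemma contDiffAt_turn {x : E3} (hx : rho x ≠ 0) (c s : ℝ) (i j : Fin 3) :
    ContDiffAt ℝ ∞ (fun y => turn c s y i j) x := by
  have h0 := contDiffAt_coord x 0
  have h1 := contDiffAt_coord x 1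
  have hr : ContDiffAt ℝ ∞ rho x :=
    ((h0.pow 2).add (h1.pow 2)).sqrt fun h => hx (by rw [rho, h, Real.sqrt_zero])
  have e : (fun y => turn c s y i j) = fun y =>
      (y 0 * c + y 1 * s) / rho y * (rotM 1 0 i j - rotM 0 0 i j) +
      (y 1 * c - y 0 * s) / rho y * (rotM 0 1 i j - rotM 0 0 i j) + rotM 0 0 i j := by
    ext y; rw [turn, rotM_decomp]
  rw [e]
  exact (((((h0.mul contDiffAt_const).add (h1.mul contDiffAt_const)).div hr hx).mul
    contDiffAt_const).add ((((h1.mul contDiffAt_const).sub (h0.mul contDiffAt_const)).div hr hx).mul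
    contDiffAt_const)).add contDiffAt_const

lemma contDiffAt_Qb {x : E3} (hx : x ≠ 0) (i j : Fin 3) :
    ContDiffAt ℝ ∞ (fun y => Qb y i j) x := by
  simp only [Qb, uniaxial_apply, PiLp.smul_apply, smul_eq_mul]
  have hn : ContDiffAt ℝ ∞ (fun y : E3 => ‖y‖⁻¹) x :=
    (contDiffAt_norm ℝ hx).inv (norm_ne_zero_iff.2 hx)
  exact ((hn.mul (contDiffAt_coord x i)).mul (hn.mul (contDiffAt_coord x j))).sub contDiffAt_const

/-- `turn` is singular on the axis, but there the latitude is `±1` and the cutoff vanishes in a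
whole neighbourhood; elsewhere every factor is smooth. -/
lemma contDiffAt_bandField {ψ : ℝ → ℝ} (hψ : ContDiff ℝ ∞ ψ) {κ : ℝ} (hκ : 0 < κ)
    (hz : ∀ z, 1 - κ ≤ |z| → ψ z = 0) (c s : ℝ) (a b : Fin 3) {x : E3} (hx : x ≠ 0) (i j : Fin 3) :
    ContDiffAt ℝ ∞ (fun y => bandField ψ c s (Matrix.single a b 1) y i j) x := by
  have hlat : ContDiffAt ℝ ∞ (fun y : E3 => y 2 / ‖y‖) x :=
    (contDiffAt_coord x 2).div (contDiffAt_norm ℝ hx) (norm_ne_zero_iff.2 hx)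
  by_cases h : rho x = 0
  · refine (contDiffAt_const (c := (0 : ℝ))).congr_of_eventuallyEq ?_
    have h1 : ∀ᶠ y in 𝓝 x, 1 - κ < |y 2 / ‖y‖| := by
      refine hlat.continuousAt.abs.eventually_const_lt ?_
      simp only [abs_latitude_of_rho_eq_zero hx h]; linarith
    filter_upwards [h1] with y hy
    rw [bandField, hz _ hy.le, zero_smul, Matrix.zero_apply]
  · simp only [bandField, Matrix.smul_apply, mul_single_mul_transpose, smul_eq_mul]
    exact (hψ.contDiffAt.comp x hlat).mul ((contDiffAt_turn h c s i a).mul (contDiffAt_turn h c s j b))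

lemma rho_smul {t : ℝ} (ht : 0 < t) (x : E3) : rho (t • x) = t * rho x := by
  simp only [rho, PiLp.smul_apply, smul_eq_mul, mul_pow]
  rw [← mul_add, Real.sqrt_mul (by positivity), Real.sqrt_sq ht.le]

lemma turn_smul {t : ℝ} (ht : 0 < t) (c s : ℝ) (x : E3) : turn c s (t • x) = turn c s x := by
  rw [turn, turn, rho_smul ht]
  simp only [PiLp.smul_apply, smul_eq_mul, mul_assoc]
  rw [← mul_add, ← mul_sub, mul_div_mul_left _ _ ht.ne', mul_div_mul_left _ _ ht.ne']

lemma Qb_smul {t : ℝ} (ht : 0 < t) (x : E3) : Qb (t • x) = Qb x := by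
  rw [Qb, Qb, smul_smul, norm_smul, Real.norm_eq_abs, abs_of_pos ht, mul_inv, mul_right_comm,
    inv_mul_cancel₀ ht.ne', one_mul]

lemma bandField_smul {t : ℝ} (ht : 0 < t) (ψ : ℝ → ℝ) (c s : ℝ) (E : Mat3) (x : E3) :
    bandField ψ c s E (t • x) = bandField ψ c s E x := by
  rw [bandField, bandField, turn_smul ht, norm_smul, Real.norm_eq_abs, abs_of_pos ht,
    PiLp.smul_apply, smul_eq_mul, mul_div_mul_left _ _ ht.ne']

lemma isLayer_layerField {N : ℕ} {ψ : Fin N → ℝ → ℝ} (hψ : ∀ j, ContDiff ℝ ∞ (ψ j)) {κ : ℝ}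
    (hκ : 0 < κ) (hz : ∀ j z, 1 - κ ≤ |z| → ψ j z = 0) (c s : Fin N → ℝ) {a a' : ℝ → ℝ}
    (ha : IsProfile a a') {b p : Fin N → ℝ → Mat3} (hb : ∀ j, IsMatProfile (b j) (p j)) :
    IsLayer (layerField ψ c s) (layerProf a b) (layerProf a' p) := by
  refine ⟨?_, ?_, ?_⟩
  · rintro (_ | m)
    exacts [ha, (hb m.1).1 m.2.1 m.2.2]
  · rintro (_ | m) i j x hx
    · exact ((contDiffAt_Qb hx i j).sub contDiffAt_const).contDiffWithinAt
    · exact (contDiffAt_bandField (hψ m.1) hκ (hz m.1) _ _ _ _ hx i j).contDiffWithinAt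
  · rintro (_ | m) t ht x
    · simp only [layerField, Qb_smul ht]
    · exact bandField_smul ht _ _ _ _ _

lemma turn_sq_add_sq {c s : ℝ} (h : c ^ 2 + s ^ 2 = 1) {x : E3} (hx : rho x ≠ 0) :
    ((x 0 * c + x 1 * s) / rho x) ^ 2 + ((x 1 * c - x 0 * s) / rho x) ^ 2 = 1 := by
  have e : (x 0 * c + x 1 * s) ^ 2 + (x 1 * c - x 0 * s) ^ 2 = rho x ^ 2 * (c ^ 2 + s ^ 2) := by
    rw [rho_sq]; ring
  rw [div_pow, div_pow, ← add_div, e, h, mul_one, div_self (pow_ne_zero 2 hx)]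

lemma turn_transpose_mul {c s : ℝ} (h : c ^ 2 + s ^ 2 = 1) {x : E3} (hx : rho x ≠ 0) :
    (turn c s x).transpose * turn c s x = 1 :=
  rotM_transpose_mul (turn_sq_add_sq h hx)

lemma norm_inv_smul {x : E3} (hx : x ≠ 0) : ‖‖x‖⁻¹ • x‖ = 1 := by
  rw [norm_smul, norm_inv, norm_norm, inv_mul_cancel₀ (norm_ne_zero_iff.2 hx)]

lemma bandField_mem_S0 {ψ : ℝ → ℝ} {κ : ℝ} (hκ : 0 < κ) (hz : ∀ z, 1 - κ ≤ |z| → ψ z = 0) {c s : ℝ}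
    (h : c ^ 2 + s ^ 2 = 1) {E : Mat3} (hE : E ∈ S0) {x : E3} (hx : x ≠ 0) :
    bandField ψ c s E x ∈ S0 := by
  by_cases hr : rho x = 0
  · rw [bandField, hz _ (by rw [abs_latitude_of_rho_eq_zero hx hr]; linarith), zero_smul]
    exact S0_zero
  · refine S0_smul _ ⟨isSymm_conj _ hE.1, ?_⟩
    rw [trace_conj (turn_transpose_mul h hr), hE.2]

lemma layerMap_mem_S0 {N : ℕ} {ψ : Fin N → ℝ → ℝ} {κ : ℝ}
    (hκ : 0 < κ) (hz : ∀ j z, 1 - κ ≤ |z| → ψ j z = 0) {c s : Fin N → ℝ}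
    (h : ∀ j, c j ^ 2 + s j ^ 2 = 1) (a : ℝ → ℝ) {b : Fin N → ℝ → Mat3}
    (hb : ∀ j t, b j t ∈ S0) (η : ℝ) {x : E3} (hx : x ≠ 0) :
    layerMap (layerField ψ c s) (layerProf a b) η x ∈ S0 := by
  rw [layerMap, combine_layerField]
  exact S0_add Qinf_mem_S0 (S0_add
    (S0_smul _ (S0_sub (uniaxial_mem_S0 (norm_inv_smul hx)) Qinf_mem_S0))
    (S0_sum _ fun j _ => bandField_mem_S0 hκ (hz j) (h j) (hb j _) hx))

/-- The rotation of angle `φ` as a map of the space. -/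
def rotVec (φ : ℝ) (x : E3) : E3 := WithLp.toLp 2 (Matrix.mulVec (rot φ) x.ofLp)

lemma rotVec_zero (φ : ℝ) (x : E3) : rotVec φ x 0 = Real.cos φ * x 0 - Real.sin φ * x 1 := by
  simp [rotVec, rot, dotProduct, Fin.sum_univ_three]; ring

lemma rotVec_one (φ : ℝ) (x : E3) : rotVec φ x 1 = Real.sin φ * x 0 + Real.cos φ * x 1 := by
  simp [rotVec, rot, dotProduct, Fin.sum_univ_three]

lemma rotVec_two (φ : ℝ) (x : E3) : rotVec φ x 2 = x 2 := by
  simp [rotVec, rot, dotProduct, Fin.sum_univ_three]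

lemma rho_rotVec (φ : ℝ) (x : E3) : rho (rotVec φ x) = rho x := by
  rw [rho, rho, rotVec_zero, rotVec_one]
  congr 1
  linear_combination (x 0 ^ 2 + x 1 ^ 2) * Real.sin_sq_add_cos_sq φ

lemma norm_rotVec (φ : ℝ) (x : E3) : ‖rotVec φ x‖ = ‖x‖ := by
  rw [← sq_eq_sq₀ (norm_nonneg _) (norm_nonneg _), norm_sq_eq_rho, norm_sq_eq_rho, rho_rotVec,
    rotVec_two]

lemma rot_eq (φ : ℝ) : rot φ = rotM (Real.cos φ) (Real.sin φ) := rfl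

lemma rot_mul_transpose (φ : ℝ) : rot φ * (rot φ).transpose = 1 :=
  rotM_mul_transpose (Real.cos_sq_add_sin_sq φ)

/-- Composition of planar rotations: this equivariance is the source of the axial symmetry. It also
holds on the axis, where both sides are `rotM 0 0`, since division by `rho x = 0` gives `0`. -/
lemma turn_rotVec (c s φ : ℝ) (x : E3) : turn c s (rotVec φ x) = rot φ * turn c s x := by
  rw [turn, turn, rho_rotVec, rot_eq, rotM_mul_rotM, rotVec_zero, rotVec_one]
  congr 1 <;> ring

lemma Qb_rotVec (φ : ℝ) (x : E3) : Qb (rotVec φ x) = rot φ * Qb x * (rot φ).transpose := by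
  rw [Qb, norm_rotVec, Qb, ← uniaxial_conj (rot_mul_transpose φ)]
  congr 1
  ext i
  simp [rotVec, Matrix.mulVec_smul]

lemma Qinf_conj_rot (φ : ℝ) : rot φ * Qinf * (rot φ).transpose = Qinf := by
  rw [Qinf, ← uniaxial_conj (rot_mul_transpose φ)]
  congr 1
  ext i
  fin_cases i <;> simp [rot, Matrix.mulVec, dotProduct]

lemma bandField_rotVec (ψ : ℝ → ℝ) (c s : ℝ) (E : Mat3) (φ : ℝ) (x : E3) :
    bandField ψ c s E (rotVec φ x) = rot φ * bandField ψ c s E x * (rot φ).transpose := by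
  rw [bandField, bandField, turn_rotVec, norm_rotVec, rotVec_two, Matrix.mul_smul, Matrix.smul_mul,
    Matrix.transpose_mul]
  simp only [mul_assoc]

lemma axisymmetric_layerMap {N : ℕ} (ψ : Fin N → ℝ → ℝ) (c s : Fin N → ℝ) (a : ℝ → ℝ)
    (b : Fin N → ℝ → Mat3) (η : ℝ) :
    Axisymmetric (layerMap (layerField ψ c s) (layerProf a b) η) := by
  intro φ x _
  change layerMap _ _ η (rotVec φ x) = _
  rw [layerMap, layerMap, norm_rotVec, combine_layerField, combine_layerField]
  simp only [bandField_rotVec, Qb_rotVec]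
  nth_rewrite 1 2 [← Qinf_conj_rot φ]
  simp only [Matrix.mul_add, Matrix.add_mul, Matrix.mul_sub, Matrix.sub_mul, Matrix.mul_smul,
    Matrix.smul_mul, Matrix.mul_sum, Matrix.sum_mul]

/-! ### Energy of the paths -/

/-- The constant depends on the profiles and on `K`, not on the fields. The cutoffs may therefore be
chosen after it. -/
lemma exists_layerCost_le {ι : Type} [Fintype ι] {β p : ι → ℝ → ℝ} (h : ∀ m, IsProfile (β m) (p m))
    (l K : ℝ) : ∃ C : ℝ, ∀ (A : ι → E3 → Mat3) (n : E3), (∀ m i j, |A m n i j| ≤ K) →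
      layerCost A β p l n ≤ ENNReal.ofReal C := by
  obtain ⟨S, hS, hS2⟩ := exists_common_support h
  choose M hM using fun m => (h m).bounded
  have hβ2 : ∀ s, ∑ m, β m s ^ 2 ≤ ∑ m, M m ^ 2 := fun s => Finset.sum_le_sum fun m _ =>
    sq_le_sq' (abs_le.1 (hM m s)).1 (abs_le.1 (hM m s)).2
  set c : ℝ := ((Fintype.card ι : ℕ) : ℝ) with hc
  have hc0 : 0 ≤ c := Nat.cast_nonneg _
  set B : ℝ := 9 * K ^ 2 * c * ∑ m, M m ^ 2 with hB
  have hB0 : 0 ≤ B := by positivity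
  obtain ⟨C, hC0, hC⟩ := exists_potential_le l (2 + (1 + B))
  have hpm := fun m => (h m).meas
  have hPi : Integrable fun s => 1 / 2 * (9 * K ^ 2 * c * ∑ m, p m s ^ 2) :=
    ((integrable_finsetSum _ fun m _ => (h m).memLp.integrable_sq).const_mul _).const_mul _
  set P : ℝ := ∫ s, 1 / 2 * (9 * K ^ 2 * c * ∑ m, p m s ^ 2)
  have hP0 : 0 ≤ P := integral_nonneg fun s => by positivity
  refine ⟨P + C * S, fun A n hA => ?_⟩
  have hpt : ∀ s ∈ Ioi (0 : ℝ), ENNReal.ofReal (density l (Qinf + combine A β n s) (combine A p n s)) ≤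
      ENNReal.ofReal (1 / 2 * (9 * K ^ 2 * c * ∑ m, p m s ^ 2)) +
        (Ioc 0 S).indicator (fun _ => ENNReal.ofReal C) s := by
    intro s hs
    by_cases hsS : s ≤ S
    · rw [indicator_of_mem (mem_Ioc.2 ⟨hs, hsS⟩), ← ENNReal.ofReal_add (by positivity) hC0]
      refine ENNReal.ofReal_le_ofReal ?_
      have h1 := normSq_combine_le (q := p) hA s
      have h2 : |l ^ 2 * f (Qinf + combine A β n s) + g (Qinf + combine A β n s)| ≤ C := by
        refine hC _ fun i j => ?_
        have h1 := (sq_entry_le_normSq (combine A β n s) i j).trans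
          ((normSq_combine_le hA s).trans (mul_le_mul_of_nonneg_left (hβ2 s) (by positivity)))
        refine (abs_add_le _ _).trans (add_le_add (abs_Qinf_le i j) ?_)
        refine abs_le_of_sq_le_sq ?_ (by positivity)
        nlinarith
      have h3 := le_of_abs_le h2
      unfold density
      linarith
    · have hz1 : combine A β n s = 0 :=
        Finset.sum_eq_zero fun m _ => by rw [(hS2 m s (not_le.1 hsS).le).1, zero_smul]
      have hz2 : combine A p n s = 0 :=
        Finset.sum_eq_zero fun m _ => by rw [(hS2 m s (not_le.1 hsS).le).2, zero_smul]
      simp [hz1, hz2, density, f_Qinf, g_Qinf]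
  refine (setLIntegral_mono' measurableSet_Ioi hpt).trans ?_
  rw [lintegral_add_left (by fun_prop), lintegral_indicator measurableSet_Ioc, setLIntegral_const,
    Measure.restrict_apply measurableSet_Ioc, inter_eq_left.2 Ioc_subset_Ioi_self, Real.volume_Ioc,
    sub_zero, ← ENNReal.ofReal_mul hC0, ENNReal.ofReal_add hP0 (by positivity)]
  refine add_le_add ((setLIntegral_le_lintegral _ _).trans (le_of_eq ?_)) le_rfl
  rw [← ofReal_integral_eq_lintegral_ofReal hPi
    (Eventually.of_forall fun s => by simp only [Pi.zero_apply]; positivity)]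

lemma Qb_of_norm_eq_one {n : E3} (hn : ‖n‖ = 1) : Qb n = uniaxial n := by
  rw [Qb, hn, inv_one, one_smul]

lemma normSq_single (a b : Fin 3) : normSq (Matrix.single a b 1) = 1 := by
  rw [normSq, Finset.sum_eq_single a, Finset.sum_eq_single b]
  · simp
  · intro j _ hj; simp [hj.symm]
  · simp
  · intro i _ hi; simp [hi.symm]
  · simp

/-- The bound does not depend on the cutoffs: conjugation by a rotation preserves the norm, and on
the axis, where `turn` is no rotation, the cutoff vanishes. -/
lemma abs_layerField_le {N : ℕ} {ψ : Fin N → ℝ → ℝ} {κ : ℝ} (hκ : 0 < κ)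
    (hz : ∀ j z, 1 - κ ≤ |z| → ψ j z = 0) (h1 : ∀ j z, |ψ j z| ≤ 1) {c s : Fin N → ℝ}
    (h : ∀ j, c j ^ 2 + s j ^ 2 = 1) {n : E3} (hn : ‖n‖ = 1) (m : Option (Fin N × Fin 3 × Fin 3))
    (i j : Fin 3) : |layerField ψ c s m n i j| ≤ 4 := by
  have hn0 : n ≠ 0 := by rintro rfl; simp at hn
  rcases m with _ | m
  · simp only [layerField, Matrix.sub_apply, Qb_of_norm_eq_one hn]
    refine (abs_sub _ _).trans ?_
    linarith [abs_uniaxial_le hn i j, abs_Qinf_le i j]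
  · simp only [layerField, bandField, Matrix.smul_apply, smul_eq_mul, abs_mul]
    by_cases hr : rho n = 0
    · rw [hz m.1 _ (by rw [abs_latitude_of_rho_eq_zero hn0 hr]; linarith)]
      simp
    · have h2 := sq_entry_le_normSq (turn (c m.1) (s m.1) n * Matrix.single m.2.1 m.2.2 1 *
        (turn (c m.1) (s m.1) n).transpose) i j
      rw [normSq_conj (turn_transpose_mul (h m.1) hr), normSq_single, sq_le_one_iff_abs_le_one] at h2
      have := mul_le_one₀ (h1 m.1 (n 2 / ‖n‖)) (abs_nonneg _) h2
      linarith

lemma Qinf_conj {c s : ℝ} (h : c ^ 2 + s ^ 2 = 1) :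
    rotM c s * Qinf * (rotM c s).transpose = Qinf := by
  rw [Qinf, ← uniaxial_conj (rotM_mul_transpose h)]
  congr 1
  ext i
  fin_cases i <;> simp [rotM, Matrix.mulVec, dotProduct]

lemma cost_conj (l : ℝ) {c s : ℝ} (h : c ^ 2 + s ^ 2 = 1) (b p : ℝ → Mat3) :
    cost l (fun t => rotM c s * b t * (rotM c s).transpose)
      (fun t => rotM c s * p t * (rotM c s).transpose) = cost l b p := by
  unfold cost density
  refine lintegral_congr fun t => ?_
  have e : Qinf + rotM c s * b t * (rotM c s).transpose =
      rotM c s * (Qinf + b t) * (rotM c s).transpose := by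
    rw [Matrix.mul_add, Matrix.add_mul, Qinf_conj h]
  rw [e, f_conj (rotM_transpose_mul h), g_conj h, normSq_conj (rotM_transpose_mul h)]

/-! ### Turning a profile to another meridian -/

/-- The image of `w` under the rotation to the meridian of `n`. -/
def turnVec (w n : E3) : E3 :=
  WithLp.toLp 2 ((turn (w 0 / rho w) (w 1 / rho w) n).mulVec w.ofLp)

lemma azimuth_sq {w : E3} (hw : rho w ≠ 0) : (w 0 / rho w) ^ 2 + (w 1 / rho w) ^ 2 = 1 := by
  rw [div_pow, div_pow, ← add_div, ← rho_sq, div_self (pow_ne_zero 2 hw)]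

lemma turnVec_coords {w n : E3} (hw : rho w ≠ 0) (hn : rho n ≠ 0) :
    turnVec w n 0 = rho w / rho n * n 0 ∧ turnVec w n 1 = rho w / rho n * n 1 ∧
      turnVec w n 2 = w 2 := by
  have h := rho_sq w
  refine ⟨?_, ?_, ?_⟩
  · simp [turnVec, turn, rotM, dotProduct, Fin.sum_univ_three]
    field_simp
    linear_combination (-(n 0)) * h
  · simp [turnVec, turn, rotM, dotProduct, Fin.sum_univ_three]
    field_simp
    linear_combination (-(n 1)) * h
  · simp [turnVec, turn, rotM, dotProduct, Fin.sum_univ_three]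

lemma norm_turnVec {w n : E3} (hw1 : ‖w‖ = 1) (hw : rho w ≠ 0) (hn : rho n ≠ 0) :
    ‖turnVec w n‖ = 1 := by
  obtain ⟨h0, h1, h2⟩ := turnVec_coords hw hn
  have h3 := norm_sq_eq_rho w
  have h4 := rho_sq n
  rw [← sq_eq_sq₀ (norm_nonneg _) zero_le_one, norm_sq_eq, h0, h1, h2, mul_pow, mul_pow, ← mul_add,
    ← h4, ← mul_pow, div_mul_cancel₀ _ hn, ← h3, hw1]

/-- The turned vector lies on the meridian of `n`, so only `rho` and the height differ. On the unit
sphere `(rho w - rho n)² ≤ |rho w² - rho n²| = |w₂² - n₂²|`, an estimate that does not degenerate at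
the poles. -/
lemma norm_turnVec_sub_sq_le {w n : E3} (hw1 : ‖w‖ = 1) (hn1 : ‖n‖ = 1) (hw : rho w ≠ 0)
    (hn : rho n ≠ 0) : ‖turnVec w n - n‖ ^ 2 ≤ 4 * |w 2 - n 2| := by
  obtain ⟨h0, h1, h2⟩ := turnVec_coords hw hn
  have e : ‖turnVec w n - n‖ ^ 2 = (rho w - rho n) ^ 2 + (w 2 - n 2) ^ 2 := by
    rw [norm_sq_eq]
    simp only [PiLp.sub_apply, h0, h1, h2]
    have h4 := rho_sq n
    have : (rho w / rho n * n 0 - n 0) ^ 2 + (rho w / rho n * n 1 - n 1) ^ 2 =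
        (rho w / rho n - 1) ^ 2 * rho n ^ 2 := by rw [h4]; ring
    rw [this, ← mul_pow, sub_mul, div_mul_cancel₀ _ hn, one_mul]
  have h3 := norm_sq_eq_rho w
  have h4 := norm_sq_eq_rho n
  rw [hw1] at h3
  rw [hn1] at h4
  have a1 := abs_entry_le_norm w 2
  have a2 := abs_entry_le_norm n 2
  rw [hw1] at a1
  rw [hn1] at a2
  have hsum : |w 2 + n 2| ≤ 2 := (abs_add_le _ _).trans (by linarith)
  have hdiff : |w 2 - n 2| ≤ 2 := (abs_sub _ _).trans (by linarith)
  have b1 : (w 2 - n 2) ^ 2 ≤ 2 * |w 2 - n 2| := by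
    rw [← sq_abs, pow_two]; gcongr
  have b2 : (rho w - rho n) ^ 2 ≤ 2 * |w 2 - n 2| := by
    have r1 : 0 ≤ rho w := Real.sqrt_nonneg _
    have r2 : 0 ≤ rho n := Real.sqrt_nonneg _
    calc (rho w - rho n) ^ 2 = |rho w - rho n| * |rho w - rho n| := by rw [← pow_two, sq_abs]
      _ ≤ |rho w - rho n| * |rho w + rho n| := by
          refine mul_le_mul_of_nonneg_left ?_ (abs_nonneg _)
          rw [abs_of_nonneg (add_nonneg r1 r2)]
          exact (abs_sub _ _).trans (by rw [abs_of_nonneg r1, abs_of_nonneg r2])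
      _ = |w 2 + n 2| * |w 2 - n 2| := by
          rw [← abs_mul, ← abs_mul, ← abs_neg]
          congr 1
          linarith
      _ ≤ _ := by gcongr
  rw [e]; linarith

/-- The profile that leaves `1` and reaches `0` at time `τ`. -/
def rampProf (τ : ℝ) : ℝ → ℝ := catFn τ (linFn τ 1 0) fun _ => 0

/-- The derivative of `rampProf`. -/
def rampDeriv (τ : ℝ) : ℝ → ℝ := catFn τ (linDeriv τ 1 0) fun _ => 0

/-- The loop at `0` that joins `Y` in time `τ` and then follows `b`. -/
def loopProf (τ : ℝ) (Y : Mat3) (b : ℝ → Mat3) : ℝ → Mat3 := catFn τ (linMat τ 0 Y) b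

/-- The derivative of `loopProf`. -/
def loopDeriv (τ : ℝ) (Y : Mat3) (p : ℝ → Mat3) : ℝ → Mat3 := catFn τ (linMatDeriv τ 0 Y) p

lemma isProfile_ramp {τ : ℝ} (hτ : 0 < τ) : IsProfile (rampProf τ) (rampDeriv τ) :=
  (isPiece_lin τ 1 0).cat hτ isProfile_zero (linFn_self hτ _ _)

lemma isMatProfile_loop {τ : ℝ} (hτ : 0 < τ) {b p : ℝ → Mat3} (h : IsMatProfile b p) :
    IsMatProfile (loopProf τ (b 0) b) (loopDeriv τ (b 0) p) :=
  (isMatPiece_lin S0_zero (h.2 0)).cat hτ h (linMat_self hτ _ _)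

/-- Where exactly one band is fully active, the energy of the path is at most the energy of the
profile of this band plus the cost of adjusting the boundary value. -/
lemma layerCost_le_of_band {N : ℕ} {ψ : Fin N → ℝ → ℝ} {c s : Fin N → ℝ} {l τ C : ℝ} (hτ : 0 < τ)
    (hC : ∀ Q : Mat3, (∀ i j, |Q i j| ≤ 2) → |l ^ 2 * f Q + g Q| ≤ C) {b p : Fin N → ℝ → Mat3}
    {j : Fin N} {w n : E3} (hw1 : ‖w‖ = 1) (hn1 : ‖n‖ = 1) (hw : rho w ≠ 0) (hn : rho n ≠ 0)
    (hc : c j = w 0 / rho w) (hs : s j = w 1 / rho w) (hb : b j 0 = uniaxial w - Qinf)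
    (hψ1 : ψ j (n 2) = 1) (hψ0 : ∀ i, i ≠ j → ψ i (n 2) = 0) :
    layerCost (layerField ψ c s) (layerProf (rampProf τ) fun j => loopProf τ (b j 0) (b j))
      (layerProf (rampDeriv τ) fun j => loopDeriv τ (b j 0) (p j)) l n ≤
      ENNReal.ofReal (144 * |w 2 - n 2| / τ / 2 + C * τ) + cost l (b j) (p j) := by
  set cc := (n 0 * c j + n 1 * s j) / rho n with hcc
  set ss := (n 1 * c j - n 0 * s j) / rho n with hss
  have hT : cc ^ 2 + ss ^ 2 = 1 := turn_sq_add_sq (by rw [hc, hs]; exact azimuth_sq hw) hn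
  have hturn : turn (c j) (s j) n = rotM cc ss := rfl
  have huni : rotM cc ss * uniaxial w * (rotM cc ss).transpose = uniaxial (turnVec w n) := by
    rw [← uniaxial_conj (rotM_mul_transpose hT), turnVec, ← hc, ← hs, hturn]
  have hY : rotM cc ss * b j 0 * (rotM cc ss).transpose = uniaxial (turnVec w n) - Qinf := by
    rw [hb, Matrix.mul_sub, Matrix.sub_mul, huni, Qinf_conj hT]
  have hcomb : ∀ (a : ℝ → ℝ) (q : Fin N → ℝ → Mat3) (t : ℝ),
      combine (layerField ψ c s) (layerProf a q) n t = a t • (uniaxial n - Qinf) +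
        rotM cc ss * q j t * (rotM cc ss).transpose := by
    intro a q t
    rw [combine_layerField, Qb_of_norm_eq_one hn1]
    congr 1
    rw [Finset.sum_eq_single j]
    · rw [bandField, hn1, div_one, hψ1, one_smul, hturn]
    · intro i _ hi
      rw [bandField, hn1, div_one, hψ0 i hi, zero_smul]
    · simp
  have hnear := norm_turnVec_sub_sq_le hw1 hn1 hw hn
  have hv1 := norm_turnVec hw1 hw hn
  set X := uniaxial n - Qinf with hX
  set Y := uniaxial (turnVec w n) - Qinf with hYdef
  -- On `[0, τ]` the ramp contributes `(1 - t/τ) X` and the loop `(t/τ) Y`, whose sum is the affine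
  -- path from `X` to `Y`; afterwards only the turned profile remains.
  have e1 : combine (layerField ψ c s) (layerProf (rampProf τ) fun j => loopProf τ (b j 0) (b j)) n =
      catFn τ (linMat τ X Y) fun t => rotM cc ss * b j t * (rotM cc ss).transpose := by
    ext1 t
    rw [hcomb]
    unfold rampProf loopProf catFn
    split_ifs with ht
    · rw [linFn, linMat, linMat, ← hY]
      simp only [sub_zero, zero_add, Matrix.mul_smul, Matrix.smul_mul, smul_sub]
      module
    · rw [zero_smul, zero_add]
  have e2 : combine (layerField ψ c s)
        (layerProf (rampDeriv τ) fun j => loopDeriv τ (b j 0) (p j)) n =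
      catFn τ (linMatDeriv τ X Y) fun t => rotM cc ss * p j t * (rotM cc ss).transpose := by
    ext1 t
    rw [hcomb]
    unfold rampDeriv loopDeriv catFn
    split_ifs with ht
    · unfold linDeriv linMatDeriv
      split_ifs with h0
      · simp
      · rw [← hY]
        simp only [sub_zero, Matrix.mul_smul, Matrix.smul_mul, div_eq_mul_inv]
        module
    · rw [zero_smul, zero_add]
  rw [layerCost, e1, e2, cost_catFn l hτ.le, cost_conj l hT]
  refine add_le_add (setLIntegral_linMat_le hC hτ ?_ ?_ ?_) le_rfl
  · intro i k; rw [hX, add_sub_cancel]; exact abs_uniaxial_le hn1 i k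
  · intro i k; rw [hYdef, add_sub_cancel]; exact abs_uniaxial_le hv1 i k
  · rw [hX, hYdef, sub_sub_sub_cancel_right]
    refine (normSq_uniaxial_sub_le hv1 hn1).trans ?_
    linarith

/-! ### Construction of the recovery maps -/

/-- Applied to `D` on a band: comparison with the infimum over the band replaces any regularity of
`D` in the direction. -/
lemma exists_near_minimum {α : Type*} (G : α → ℝ≥0∞) {S : Set α} (hS : S.Nonempty)
    (hfin : ∀ x, G x ≠ ⊤) {δ : ℝ≥0∞} (hδ : δ ≠ 0) : ∃ x ∈ S, ∀ y ∈ S, G x ≤ G y + δ := by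
  obtain ⟨x₀, hx₀⟩ := hS
  have hI : (⨅ x ∈ S, G x) ≠ ⊤ := ((iInf₂_le x₀ hx₀).trans_lt (hfin x₀).lt_top).ne
  have hlt := ENNReal.lt_add_right hI hδ
  obtain ⟨x, hx⟩ := iInf_lt_iff.1 hlt
  obtain ⟨hxS, hx⟩ := iInf_lt_iff.1 hx
  exact ⟨x, hxS, fun y hy => hx.le.trans (add_le_add (iInf₂_le y hy) le_rfl)⟩

lemma exists_bandFunctions (N : ℕ) {κ : ℝ} (hκ : 0 < κ) (hN : 2 * κ < 1 / (N : ℝ)) :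
    ∃ ψ : Fin N → ℝ → ℝ, (∀ j, ContDiff ℝ ∞ (ψ j)) ∧ (∀ j z, |ψ j z| ≤ 1) ∧
      (∀ j z, |z - latCenter N j| ≤ 1 / (N : ℝ) - 2 * κ → ψ j z = 1) ∧
      ∀ j z, 1 / (N : ℝ) - κ ≤ |z - latCenter N j| → ψ j z = 0 := by
  let B : ∀ j : Fin N, ContDiffBump (latCenter N j) := fun j =>
    ⟨1 / (N : ℝ) - 2 * κ, 1 / (N : ℝ) - κ, by linarith, by linarith⟩
  refine ⟨fun j => B j, fun j => (B j).contDiff, fun j z => ?_, fun j z h => ?_, fun j z h => ?_⟩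
  · rw [abs_of_nonneg (B j).nonneg]; exact (B j).le_one
  · exact (B j).one_of_mem_closedBall (by rwa [Metric.mem_closedBall, Real.dist_eq])
  · exact (B j).zero_of_le_dist (by rwa [Real.dist_eq])

lemma D_Qb_ne_top (l : ℝ) (n : Metric.sphere (0 : E3) 1) : D l (Qb (n : E3)) ≠ ⊤ := by
  obtain ⟨C, hC⟩ := exists_D_uniaxial_le l
  rw [Qb_of_norm_eq_one (norm_eq_of_mem_sphere n)]
  exact ((hC n (norm_eq_of_mem_sphere n)).trans_lt ENNReal.ofReal_lt_top).ne

lemma limitEnergy_ne_top (l : ℝ) : limitEnergy l ≠ ⊤ := by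
  obtain ⟨C, hC⟩ := exists_D_uniaxial_le l
  refine ne_top_of_le_ne_top ?_ (lintegral_mono (g := fun _ => ENNReal.ofReal C)
    fun n : Metric.sphere (0 : E3) 1 => ?_)
  · rw [lintegral_const]
    exact ENNReal.mul_ne_top ENNReal.ofReal_ne_top (measure_lt_top _ _).ne
  · rw [Qb_of_norm_eq_one (norm_eq_of_mem_sphere n)]
    exact hC n (norm_eq_of_mem_sphere n)

lemma exists_mem_sphere_latitude {z : ℝ} (hz : |z| ≤ 1) :
    ∃ n : Metric.sphere (0 : E3) 1, (n : E3) 2 = z := by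
  have hz2 : z ^ 2 ≤ 1 := (sq_le_one_iff_abs_le_one z).2 hz
  refine ⟨⟨!₂[√(1 - z ^ 2), 0, z], ?_⟩, by simp⟩
  rw [mem_sphere_zero_iff_norm, ← sq_eq_sq₀ (norm_nonneg _) zero_le_one, norm_sq_eq]
  simp [Real.sq_sqrt (sub_nonneg.2 hz2)]

lemma rho_ne_zero {n : E3} (hn : ‖n‖ = 1) (h : |n 2| < 1) : rho n ≠ 0 := by
  intro hr
  have hn0 : n ≠ 0 := by rintro rfl; simp at hn
  have := abs_latitude_of_rho_eq_zero hn0 hr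
  rw [hn, div_one] at this
  linarith

/-- For every `h > 0` there is an axially symmetric boundary layer with boundary values `Q_b` whose
one-dimensional energy exceeds that of the minimizers by at most `h`. -/
lemma exists_layer (l : ℝ) {h : ℝ} (hh : 0 < h) :
    ∃ (ι : Type) (_ : Fintype ι) (A : ι → E3 → Mat3) (β p : ι → ℝ → ℝ), IsLayer A β p ∧
      (∀ η x, x ∈ Ω → layerMap A β η x ∈ S0) ∧ (∀ x ∈ Ω, combine A β x 0 = Qb x - Qinf) ∧
      (∀ η, Axisymmetric (layerMap A β η)) ∧
      ∫⁻ n : Metric.sphere (0 : E3) 1, layerCost A β p l n ∂(volume : Measure E3).toSphere ≤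
        limitEnergy l + ENNReal.ofReal h := by
  set μ := (volume : Measure E3).toSphere with hμ
  set m : ℝ := μ.real univ with hm
  have hm0 : 0 ≤ m := measureReal_nonneg
  have hme : μ univ = ENNReal.ofReal m := (ofReal_measureReal (measure_lt_top _ _).ne).symm
  -- the admissible error in each direction
  set e : ℝ := h / (2 * (m + 1)) with he
  have he0 : 0 < e := by positivity
  have hem : e * m ≤ h / 2 := by
    rw [he, div_mul_eq_mul_div, div_le_div_iff₀ (by positivity) two_pos]; nlinarith
  obtain ⟨C, hC0, hC⟩ := exists_potential_le l 2
  -- The budget `e` is spent as `e/6` on the potential during the adjustment, `e/6` on its kinetic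
  -- energy, `e/3` on the profile and `e/3` on the choice of `w`. First `τ` is made small, then `N`
  -- large depending on `τ`, since latitudes in one band differ by at most `2/N` and `144 (2/N)/(2τ)
  -- = 144/(Nτ)`.
  obtain ⟨τ, hτ, hCτ⟩ : ∃ τ : ℝ, 0 < τ ∧ C * τ ≤ e / 6 := by
    refine ⟨e / 6 / (C + 1), by positivity, ?_⟩
    rw [← mul_div_assoc, div_le_iff₀ (by positivity)]; nlinarith
  obtain ⟨N, hN⟩ := exists_nat_gt (144 * 6 / (τ * e))
  have hN0 : (0 : ℝ) < N := lt_trans (by positivity) hN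
  have hNpos : 0 < N := by exact_mod_cast hN0
  have hNe : 144 * (2 / (N : ℝ)) / τ / 2 ≤ e / 6 := by
    rw [div_lt_iff₀ (by positivity)] at hN
    have : 144 * (2 / (N : ℝ)) / τ / 2 = 144 / (N * τ) := by field_simp
    rw [this, div_le_iff₀ (by positivity)]
    nlinarith
  -- near optimal directions in each band, and profiles for them
  have hband : ∀ j : Fin N, ∃ w : Metric.sphere (0 : E3) 1,
      |(w : E3) 2 - latCenter N j| < 1 / (N : ℝ) ∧
      ∀ n : Metric.sphere (0 : E3) 1, |(n : E3) 2 - latCenter N j| < 1 / (N : ℝ) →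
        D l (Qb (w : E3)) ≤ D l (Qb (n : E3)) + ENNReal.ofReal (e / 3) := by
    intro j
    have hc1 : |latCenter N j| ≤ 1 := (abs_latCenter_le j).trans (by
      have : 0 < 1 / (N : ℝ) := by positivity
      linarith)
    obtain ⟨n₀, hn₀⟩ := exists_mem_sphere_latitude hc1
    obtain ⟨w, hw, hw2⟩ := exists_near_minimum
      (fun n : Metric.sphere (0 : E3) 1 => D l (Qb (n : E3)))
      (S := {n | |(n : E3) 2 - latCenter N j| < 1 / (N : ℝ)})
      ⟨n₀, show |(n₀ : E3) 2 - latCenter N j| < 1 / (N : ℝ) by rw [hn₀, sub_self, abs_zero]; positivity⟩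
      (D_Qb_ne_top l) (δ := ENNReal.ofReal (e / 3)) (by simpa using he0)
    exact ⟨w, hw, hw2⟩
  choose w hw1 hw2 using hband
  have hwn : ∀ j, ‖(w j : E3)‖ = 1 := fun j => norm_eq_of_mem_sphere (w j)
  have hlat : ∀ (j : Fin N) (z : ℝ), |z - latCenter N j| < 1 / (N : ℝ) → |z| < 1 := by
    intro j z hz
    have h1 := abs_latCenter_le j
    have h2 := abs_add_le (z - latCenter N j) (latCenter N j)
    rw [sub_add_cancel] at h2
    linarith
  have hwr : ∀ j, rho (w j : E3) ≠ 0 := fun j => rho_ne_zero (hwn j) (hlat j _ (hw1 j))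
  choose b p hbp hb0 hbc using fun j => exists_profile_cost_le l (D_Qb_ne_top l (w j))
    (show 0 < e / 3 by positivity)
  set c : Fin N → ℝ := fun j => (w j : E3) 0 / rho (w j : E3) with hc
  set s : Fin N → ℝ := fun j => (w j : E3) 1 / rho (w j : E3) with hs
  have hcs : ∀ j, c j ^ 2 + s j ^ 2 = 1 := fun j => azimuth_sq (hwr j)
  set β := layerProf (rampProf τ) fun j => loopProf τ (b j 0) (b j) with hβ
  set β' := layerProf (rampDeriv τ) fun j => loopDeriv τ (b j 0) (p j) with hβ'
  have hloop := fun j => isMatProfile_loop hτ (hbp j)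
  have hprof : ∀ k, IsProfile (β k) (β' k) := by
    rintro (_ | k)
    exacts [isProfile_ramp hτ, (hloop k.1).1 k.2.1 k.2.2]
  -- `C₁` is fixed before the cutoffs, so `κ` can then be taken small enough that the transition
  -- regions contribute at most `h/2`.
  obtain ⟨C₁, hC₁⟩ := exists_layerCost_le hprof l 4
  -- the transition regions between the bands
  obtain ⟨κ, hκ, hκN, hbad⟩ := exists_badSet_le hNpos
    (ε := ENNReal.ofReal (h / 2 / (|C₁| + 1))) (by simp only [ENNReal.ofReal_pos]; positivity)
  obtain ⟨ψ, hψ, hψ1, hψone, hψzero⟩ := exists_bandFunctions N hκ hκN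
  have hz : ∀ j z, 1 - κ ≤ |z| → ψ j z = 0 := by
    intro j z hz
    refine hψzero j z ?_
    have h1 := abs_latCenter_le j
    have h2 := abs_sub_abs_le_abs_sub z (latCenter N j)
    linarith
  have hL : IsLayer (layerField ψ c s) β β' := isLayer_layerField hψ hκ hz c s (isProfile_ramp hτ) hloop
  refine ⟨Option (Fin N × Fin 3 × Fin 3), inferInstance, layerField ψ c s, β, β', hL, ?_, ?_, ?_, ?_⟩
  · exact fun η x hx => layerMap_mem_S0 hκ hz hcs _ (fun j => (hloop j).2) η (ne_zero_of_mem_Ω hx)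
  -- At `s = 0` the ramp is `1` and every loop is `0`, so the cutoffs do not affect the boundary
  -- values.
  · intro x _
    have h1 : rampProf τ 0 = 1 := by simp [rampProf, catFn, hτ.le, linFn_zero]
    have h2 : ∀ j, loopProf τ (b j 0) (b j) 0 = 0 := fun j => by
      simp [loopProf, catFn, hτ.le, linMat_zero]
    rw [hβ, combine_layerField, h1, one_smul]
    simp [bandField, h2]
  · exact fun η => axisymmetric_layerMap _ _ _ _ _ _
  · have hpt : ∀ n : Metric.sphere (0 : E3) 1, layerCost (layerField ψ c s) β β' l n ≤
        (D l (Qb (n : E3)) + ENNReal.ofReal e) +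
          (badSet N (2 * κ)).indicator (fun _ => ENNReal.ofReal |C₁|) n := by
      intro n
      have hn1 := norm_eq_of_mem_sphere n
      by_cases hn : n ∈ badSet N (2 * κ)
      · rw [indicator_of_mem hn]
        refine le_add_left ((hC₁ _ _ fun k i j => abs_layerField_le hκ hz hψ1 hcs hn1 k i j).trans ?_)
        exact ENNReal.ofReal_le_ofReal (le_abs_self _)
      · rw [indicator_of_notMem hn, add_zero]
        have hn' : ∃ j : Fin N, |(n : E3) 2 - latCenter N j| ≤ 1 / (N : ℝ) - 2 * κ := by
          by_contra! hcon
          exact hn hcon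
        obtain ⟨j, hj⟩ := hn'
        have hj2 : |(n : E3) 2 - latCenter N j| < 1 / (N : ℝ) := by linarith
        have hrn : rho (n : E3) ≠ 0 := rho_ne_zero hn1 (hlat j _ hj2)
        have hoff : ∀ i, i ≠ j → ψ i ((n : E3) 2) = 0 := by
          intro i hi
          refine hψzero i _ ?_
          have h1 := latCenter_dist hi
          have h2 := abs_sub_le (latCenter N i) ((n : E3) 2) (latCenter N j)
          rw [abs_sub_comm (latCenter N i) ((n : E3) 2)] at h2
          have h3 : 2 / (N : ℝ) = 1 / N + 1 / N := by ring
          linarith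
        have key := layerCost_le_of_band (b := b) (p := p) (l := l) hτ hC (hwn j) hn1 (hwr j) hrn
          (c := c) (s := s) rfl rfl (by rw [hb0 j, Qb_of_norm_eq_one (hwn j)]) (hψone j _ hj) hoff
        refine key.trans ?_
        have hdist : |(w j : E3) 2 - (n : E3) 2| ≤ 2 / (N : ℝ) := by
          have h2 := abs_sub_le ((w j : E3) 2) (latCenter N j) ((n : E3) 2)
          rw [abs_sub_comm (latCenter N j) ((n : E3) 2)] at h2
          have h3 : 2 / (N : ℝ) = 1 / N + 1 / N := by ring
          have h4 := hw1 j
          linarith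
        have h5 : 144 * |(w j : E3) 2 - (n : E3) 2| / τ / 2 + C * τ ≤ e / 3 := by
          have : 144 * |(w j : E3) 2 - (n : E3) 2| / τ / 2 ≤ 144 * (2 / (N : ℝ)) / τ / 2 := by gcongr
          linarith
        calc _ ≤ ENNReal.ofReal (e / 3) +
              (D l (Qb (n : E3)) + ENNReal.ofReal (e / 3) + ENNReal.ofReal (e / 3)) :=
              add_le_add (ENNReal.ofReal_le_ofReal h5)
                ((hbc j).trans (add_le_add (hw2 j n hj2) le_rfl))
          _ = D l (Qb (n : E3)) + (ENNReal.ofReal (e / 3) + ENNReal.ofReal (e / 3) +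
              ENNReal.ofReal (e / 3)) := by ring
          _ = _ := by
              rw [← ENNReal.ofReal_add (by positivity) (by positivity),
                ← ENNReal.ofReal_add (by positivity) (by positivity)]
              congr 2
              ring
    have hms := measurableSet_badSet N (2 * κ)
    refine (lintegral_mono hpt).trans ?_
    -- The splitting uses measurability of the two error terms only, not of `D`.
    rw [lintegral_add_right _ (measurable_const.indicator hms),
      lintegral_add_right _ measurable_const, lintegral_const, lintegral_indicator hms,
      setLIntegral_const, add_assoc]
    refine add_le_add le_rfl ?_
    calc ENNReal.ofReal e * μ univ + ENNReal.ofReal |C₁| * μ (badSet N (2 * κ))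
        ≤ ENNReal.ofReal (h / 2) + ENNReal.ofReal (h / 2) := by
          refine add_le_add ?_ ((mul_le_mul_right hbad.le _).trans ?_)
          · rw [hme, ← ENNReal.ofReal_mul he0.le]
            exact ENNReal.ofReal_le_ofReal hem
          · rw [← ENNReal.ofReal_mul (abs_nonneg _)]
            refine ENNReal.ofReal_le_ofReal ?_
            rw [← mul_div_assoc, div_le_iff₀ (by positivity)]
            nlinarith [abs_nonneg C₁]
      _ = ENNReal.ofReal h := by
          rw [← ENNReal.ofReal_add (by positivity) (by positivity), add_halves]

end Colloid

end

theorem proposition3p1 (l : ℝ) (hl : 0 < l) :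
    Colloid.limitEnergy l ≠ ⊤ ∧
    ∃ σ : ℝ → ℝ → NNReal,
      (∃ σ₀ : ℝ → NNReal,
        (∀ h, 0 < h → Tendsto (fun ε => σ h ε) (𝓝[>] 0) (𝓝 (σ₀ h))) ∧
        Tendsto σ₀ (𝓝[>] 0) (𝓝 0)) ∧
      ∀ η : ℝ → ℝ, (∀ ξ, 0 < ξ → 0 < η ξ) →
        Tendsto (fun ξ => η ξ / ξ) (𝓝[>] 0) (𝓝 l) →
        ∀ h ε : ℝ, 0 < h → 0 < ε →
          ∃ Q : ℝ → Colloid.E3 → Colloid.Mat3,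
            (∀ ξ, 0 < ξ → Q ξ ∈ Colloid.admissible ∧ Colloid.Axisymmetric (Q ξ)) ∧
            limsup (fun ξ => ENNReal.ofReal (η ξ) * Colloid.energy ξ (η ξ) (Q ξ)) (𝓝[>] 0) ≤
              Colloid.limitEnergy l + (σ h ε : ℝ≥0∞) := by
  -- All approximation errors are gathered in the single parameter `h`, so `σ(h, ε) = h` and the
  -- inner limit is that of a constant.
  refine ⟨Colloid.limitEnergy_ne_top l, fun h _ => h.toNNReal,
    ⟨fun h => h.toNNReal, fun h _ => tendsto_const_nhds, ?_⟩, fun η hη hlim h ε hh _ => ?_⟩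
  · have : Tendsto Real.toNNReal (𝓝 0) (𝓝 (Real.toNNReal 0)) := continuous_real_toNNReal.tendsto 0
    rw [Real.toNNReal_zero] at this
    exact this.mono_left nhdsWithin_le_nhds
  · obtain ⟨ι, _, A, β, p, hL, hS0, htr, hax, hle⟩ := Colloid.exists_layer l hh
    refine ⟨fun ξ => Colloid.layerMap A β (η ξ), fun ξ hξ =>
      ⟨⟨hL.mem_H1Ω (hη ξ hξ) (hS0 _), hL.hasTraceQb (hη ξ hξ) htr⟩, hax _⟩,
      (hL.limsup_energy_le l hη hlim).trans hle⟩
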